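/- **Setting.** Let $a>0$ and let $\Lambda=\mathbb Z v_1\oplus\mathbb Z v_2\oplus\mathbb Z v_3\subset\mathbb R^3$ with $v_1=\frac{a}{\sqrt3}(1,-1,-1)$, $v_2=\frac{a}{\sqrt3}(1,1,1)$, $v_3=\frac{a}{\sqrt3}(-1,1,-1)$, and fundamental cell $\Omega=\{\sum_i x_iv_i:0\le x_i\le 1\}$. With $q=\sqrt3\pi/a$, let $q_1=q(1,0,-1)$, $q_2=q(1,1,0)$, $q_3=q(0,1,-1)$ be the dual basis ($q_\ell\cdot v_j=2\pi\delta_{\ell j}$), and let $K=-\frac14(q_1+q_2+q_3)$. Let $$R=\begin{pmatrix}0&-1&0\\1&0&0\\0&0&-1\end{pmatrix},\qquad T=\begin{pmatrix}-1&0&0\\0&0&-1\\0&1&0\end{pmatrix}.$$ A potential $V\in C^\infty(\mathbb R^3,\mathbb R)$ is *admissible* if it is $\Lambda$-periodic, even, and satisfies $V(R^*x)=V(x)$ and $V(T^*x)=V(x)$ for all $x$. For $k\in\mathbb R^3$, let $\mu_1(k)\le\mu_2(k)\le\cdots$ be the eigenvalues, repeated according to multiplicity, of $$-\Delta\Phi+V\Phi=\mu\Phi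 \text{ on }\mathbb R^3,\qquad \Phi(x+v)=e^{ik\cdot v}\Phi(x)\quad(v\in\Lambda).$$ Let $L^2_{k,\Lambda}$ be the space of locally square-integrable functions with this pseudo-periodicity, with inner product $\langle F,G\rangle=\int_\Omega\overline F\,G$, and let $L^2_{K,\sigma}=\{F\in L^2_{K,\Lambda}:F(R^*x)=\sigma F(x)\}$ for $\sigma\in\{1,i,-1,-i\}$. **Hypothesis H1** for a real number $\mu_*$ with eigenspace $\mathcal E$ at $k=K$: $\dim\mathcal E=3$, $\mathcal E\perp L^2_{K,1}$, and $\dim(\mathcal E\cap L^2_{K,i})=1$. A *symmetry basis* of $\mathcal E$ is an orthonormal basis $\Phi_1,\Phi_2,\Phi_3$ of $\mathcal E$ with $\Phi_\ell\in L^2_{K,i^\ell}$ and $\Phi_3(x)=\overline{\Phi_1(-x)}$. Its scalars $\upsilon_1,\upsilon_2,\upsilon_3\in\mathbb C$ are defined by $$\langle\Phi_1,2i\nabla\Phi_2\rangle=\upsilon_1\omega_1,\quad\langle\Phi_2,2i\nabla\Phi_3\rangle=\upsilon_2\omega_1,\quad\langle\Phi_3,2i\nabla\Phi_1\rangle=\upsilon_3\omega_2,$$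 where $\omega_1=\frac1{\sqrt2}(1,-i,0)$ and $\omega_2=(0,0,1)$. **Theorem.** Let $V$ be admissible, let $b>1$ be an integer, and suppose that $\mu_{b-1}(K)=\mu_b(K)=\mu_{b+1}(K)=\mu_*$ and that H1 holds for $\mu_*$. Then: 1. Symmetry bases of $\mathcal E$ exist, every symmetry basis has scalars $\upsilon_1,\upsilon_2,\upsilon_3$ as above, and there is a number $\upsilon_{\mathcal F}\ge 0$, the *Fermi velocity*, with $|\upsilon_1|=|\upsilon_2|=|\upsilon_3|=\upsilon_{\mathcal F}$ for every symmetry basis. 2. Suppose moreover (**hypothesis H2**) that $\upsilon_{\mathcal F}\ne0$. Then there is a sign $\sigma\in\{1,-1\}$ with $\upsilon_1\upsilon_2\upsilon_3=i\,\sigma\,\upsilon_{\mathcal F}^3$ for every symmetry basis, and, as $\kappa=(\kappa_x,\kappa_y,\kappa_z)\to0$ in $\mathbb R^3\setminus\{0\}$, $$\begin{aligned}\mu_{b+1}(K+\kappa)&=\mu_*+\xi_+\upsilon_{\mathcal F}|\kappa|+o(|\kappa|),\\ \mu_{b}(K+\kappa)&=\mu_*+\xi_0\,\upsilon_{\mathcal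 F}|\kappa|+o(|\kappa|),\\ \mu_{b-1}(K+\kappa)&=\mu_*+\xi_-\upsilon_{\mathcal F}|\kappa|+o(|\kappa|),\end{aligned}$$ where, for each $\kappa\neq0$, $\xi_+\ge\xi_0\ge\xi_-$ are the three roots, all real and counted with multiplicity, of $$\xi^3-\xi+2\sigma\,\frac{\kappa_x\kappa_y\kappa_z}{|\kappa|^3}=0 .$$ -/

import Mathlib

open MeasureTheory Filter Topology
open scoped ContDiff InnerProductSpace ComplexConjugate

noncomputable section

namespace WeylPoint

/-- Euclidean three-space. -/
abbrev E3 : Type := EuclideanSpace ℝ (Fin 3)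

/-- The basis vectors `v₁, v₂, v₃` of the lattice with lattice constant `a`. -/
def latticeBasis (a : ℝ) : Fin 3 → E3 :=
  ![(a / √3) • !₂[1, -1, -1], (a / √3) • !₂[1, 1, 1], (a / √3) • !₂[-1, 1, -1]]

/-- The lattice `Λ = ℤ v₁ ⊕ ℤ v₂ ⊕ ℤ v₃`. -/
def lattice (a : ℝ) : Submodule ℤ E3 := Submodule.span ℤ (Set.range (latticeBasis a))

/-- The fundamental cell `Ω = {x₁ v₁ + x₂ v₂ + x₃ v₃ : 0 ≤ xᵢ ≤ 1}`. -/
def cell (a : ℝ) : Set E3 := parallelepiped (latticeBasis a)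

/-- The dual basis vectors `q₁, q₂, q₃`, with `q_ℓ ⬝ v_j = 2π δ_{ℓj}`. -/
def dualBasis (a : ℝ) : Fin 3 → E3 :=
  ![(√3 * Real.pi / a) • !₂[1, 0, -1], (√3 * Real.pi / a) • !₂[1, 1, 0],
    (√3 * Real.pi / a) • !₂[0, 1, -1]]

/-- The high symmetry point `K = -(q₁ + q₂ + q₃) / 4`. -/
def pointK (a : ℝ) : E3 := (-(1 / 4 : ℝ)) • (dualBasis a 0 + dualBasis a 1 + dualBasis a 2)

/-- The orthogonal matrix `R`. -/
def matR : Matrix (Fin 3) (Fin 3) ℝ := !![0, -1, 0; 1, 0, 0; 0, 0, -1]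

/-- The orthogonal matrix `T`. -/
def matT : Matrix (Fin 3) (Fin 3) ℝ := !![-1, 0, 0; 0, 0, -1; 0, 1, 0]

/-- The action of a matrix `Q` on functions, `F ↦ F(Q* ⬝)`. -/
def rotate {α : Type*} (Q : Matrix (Fin 3) (Fin 3) ℝ) (F : E3 → α) : E3 → α :=
  fun x => F (Matrix.toEuclideanLin Q.transpose x)

/-- Admissible potentials: smooth, real-valued, `Λ`-periodic, even and invariant under `R` and `T`. -/
structure IsAdmissible (a : ℝ) (V : E3 → ℝ) : Prop where
  smooth : ContDiff ℝ ∞ V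
  periodic : ∀ x, ∀ v ∈ lattice a, V (x + v) = V x
  even : ∀ x, V (-x) = V x
  invR : rotate matR V = V
  invT : rotate matT V = V

/-- `F(x + v) = exp(i k ⬝ v) F(x)` for all `x` and all `v ∈ Λ`. -/
def IsPseudoPeriodic (a : ℝ) (k : E3) (F : E3 → ℂ) : Prop :=
  ∀ x, ∀ v ∈ lattice a, F (x + v) = Complex.exp (Complex.I * (inner ℝ k v : ℝ)) * F x

/-- The space `L²_{k,Λ}` (as a space of functions, not of almost-everywhere classes). -/
def blochL2 (a : ℝ) (k : E3) : Submodule ℂ (E3 → ℂ) where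
  carrier := {F | MemLp F 2 (volume.restrict (cell a)) ∧ IsPseudoPeriodic a k F}
  zero_mem' := ⟨MemLp.zero, fun x v _ => by simp⟩
  add_mem' := fun {F G} hF hG => ⟨hF.1.add hG.1, fun x v hv => by
    simp only [Pi.add_apply, hF.2 x v hv, hG.2 x v hv, mul_add]⟩
  smul_mem' := fun c F hF => ⟨hF.1.const_smul c, fun x v hv => by
    simp only [Pi.smul_apply, smul_eq_mul, hF.2 x v hv]; ring⟩

/-- The inner product `⟨F, G⟩ = ∫_Ω conj F G`. -/
def cellInner (a : ℝ) (F G : E3 → ℂ) : ℂ := ∫ x in cell a, conj (F x) * G x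

/-- The symmetry sector `L²_{k,σ} = {F ∈ L²_{k,Λ} : F(R* x) = σ F(x)}`. -/
def sector (a : ℝ) (k : E3) (σ : ℂ) : Submodule ℂ (E3 → ℂ) where
  carrier := {F | F ∈ blochL2 a k ∧ rotate matR F = σ • F}
  zero_mem' := ⟨zero_mem _, by ext x; simp [rotate]⟩
  add_mem' := fun {F G} hF hG => ⟨add_mem hF.1 hG.1, by
    have h1 := hF.2
    have h2 := hG.2
    ext x
    have h3 := congrFun h1 x
    have h4 := congrFun h2 x
    simp only [rotate, Pi.smul_apply, Pi.add_apply, smul_eq_mul] at h3 h4 ⊢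
    rw [h3, h4, mul_add]⟩
  smul_mem' := fun c F hF => ⟨Submodule.smul_mem _ c hF.1, by
    have h1 := hF.2
    ext x
    have h3 := congrFun h1 x
    simp only [rotate, Pi.smul_apply, smul_eq_mul] at h3 ⊢
    rw [h3]; ring⟩

/-- The space of solutions of the Floquet-Bloch problem with quasi-momentum `k`:
`-ΔF + V F = μ F` on `ℝ³`, with `F` pseudo-periodic with respect to `k`. -/
def eigenspace (a : ℝ) (V : E3 → ℝ) (k : E3) (μ : ℝ) : Submodule ℂ (E3 → ℂ) where
  carrier := {F | ContDiff ℝ 2 F ∧ IsPseudoPeriodic a k F ∧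
    ∀ x, -(Laplacian.laplacian F x) + (V x : ℂ) * F x = (μ : ℂ) * F x}
  zero_mem' := ⟨contDiff_const, fun x v _ => by simp, fun x => by
    have h : Laplacian.laplacian (0 : E3 → ℂ) = 0 :=
      InnerProductSpace.laplacian_const (E := E3) (F := ℂ) (c := 0)
    simp [h]⟩
  add_mem' := fun {F G} hF hG => ⟨hF.1.add hG.1, fun x v hv => by
      simp only [Pi.add_apply, hF.2.1 x v hv, hG.2.1 x v hv, mul_add], fun x => by
      rw [hF.1.contDiffAt.laplacian_add hG.1.contDiffAt]
      have h1 := hF.2.2 x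
      have h2 := hG.2.2 x
      simp only [Pi.add_apply]
      linear_combination h1 + h2⟩
  smul_mem' := fun c F hF => ⟨contDiff_const.smul hF.1, fun x v hv => by
      simp only [Pi.smul_apply, smul_eq_mul, hF.2.1 x v hv]; ring, fun x => by
      rw [InnerProductSpace.laplacian_smul c hF.1.contDiffAt]
      have h1 := hF.2.2 x
      simp only [Pi.smul_apply, smul_eq_mul]
      linear_combination c * h1⟩

/-- The `b`-th eigenvalue `μ_b(k)`, `b = 1, 2, 3, …`, of the Floquet-Bloch problem, in increasing
order and repeated according to multiplicity: the least `t` for which there are `b` linearly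
independent eigenfunctions with eigenvalues at most `t`. -/
def band (a : ℝ) (V : E3 → ℝ) (b : ℕ) (k : E3) : ℝ :=
  sInf {t : ℝ | ∃ F : Fin b → E3 → ℂ,
    LinearIndependent ℂ F ∧ ∀ i, ∃ s ≤ t, F i ∈ eigenspace a V k s}

/-- Hypothesis `H1`: `μ` is a three-fold eigenvalue at `K`, its eigenspace is orthogonal to
`L²_{K,1}` and meets `L²_{K,i}` in a one-dimensional space. -/
structure H1 (a : ℝ) (V : E3 → ℝ) (μ : ℝ) : Prop where
  threefold : Module.finrank ℂ (eigenspace a V (pointK a) μ) = 3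
  orthogonal : ∀ F ∈ eigenspace a V (pointK a) μ, ∀ G ∈ sector a (pointK a) 1,
    cellInner a F G = 0
  simple : Module.finrank ℂ
    ↥(eigenspace a V (pointK a) μ ⊓ sector a (pointK a) Complex.I) = 1

/-- An orthonormal basis `Φ₁, Φ₂, Φ₃` of the eigenspace at `K` with `Φ_ℓ ∈ L²_{K,i^ℓ}` and
`Φ₃(x) = conj (Φ₁(-x))`. The index `ℓ` is shifted by one. -/
structure IsSymmetryBasis (a : ℝ) (V : E3 → ℝ) (μ : ℝ) (Φ : Fin 3 → E3 → ℂ) : Prop where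
  span_eq : Submodule.span ℂ (Set.range Φ) = eigenspace a V (pointK a) μ
  orthonormal : ∀ ℓ m, cellInner a (Φ ℓ) (Φ m) = if ℓ = m then 1 else 0
  mem_sector : ∀ ℓ : Fin 3, Φ ℓ ∈ sector a (pointK a) (Complex.I ^ ((ℓ : ℕ) + 1))
  conj_symm : ∀ x, Φ 2 x = conj (Φ 0 (-x))

/-- The vector `⟨F, 2i ∇G⟩ ∈ ℂ³`. -/
def gradInner (a : ℝ) (F G : E3 → ℂ) : Fin 3 → ℂ := fun j =>
  cellInner a F (fun x => 2 * Complex.I * fderiv ℝ G x (EuclideanSpace.single j 1))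

/-- The eigenvector `ω₁ = (1, -i, 0) / √2` of `R`. -/
def omega1 : Fin 3 → ℂ := ((√2 : ℝ) : ℂ)⁻¹ • ![1, -Complex.I, 0]

/-- The eigenvector `ω₂ = (0, 0, 1)` of `R`. -/
def omega2 : Fin 3 → ℂ := ![0, 0, 1]

/-- `υ₁, υ₂, υ₃` are the scalars attached to the basis `Φ`: `⟨Φ₁, 2i∇Φ₂⟩ = υ₁ ω₁`,
`⟨Φ₂, 2i∇Φ₃⟩ = υ₂ ω₁` and `⟨Φ₃, 2i∇Φ₁⟩ = υ₃ ω₂`. -/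
structure IsVelocity (a : ℝ) (Φ : Fin 3 → E3 → ℂ) (υ : Fin 3 → ℂ) : Prop where
  eq₁ : gradInner a (Φ 0) (Φ 1) = υ 0 • omega1
  eq₂ : gradInner a (Φ 1) (Φ 2) = υ 1 • omega1
  eq₃ : gradInner a (Φ 2) (Φ 0) = υ 2 • omega2

/-- `υF` is the Fermi velocity: symmetry bases exist, and each of them has scalars
`υ₁, υ₂, υ₃`, all of modulus `υF`. -/
def IsFermiVelocity (a : ℝ) (V : E3 → ℝ) (μ υF : ℝ) : Prop :=
  (∃ Φ, IsSymmetryBasis a V μ Φ) ∧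
    ∀ Φ, IsSymmetryBasis a V μ Φ → ∃ υ, IsVelocity a Φ υ ∧ ∀ ℓ, ‖υ ℓ‖ = υF

/-- `σ` is the sign in `υ₁ υ₂ υ₃ = i σ υF³`, for every symmetry basis. -/
def IsChirality (a : ℝ) (V : E3 → ℝ) (μ υF σ : ℝ) : Prop :=
  (σ = 1 ∨ σ = -1) ∧ ∀ Φ υ, IsSymmetryBasis a V μ Φ → IsVelocity a Φ υ →
    υ 0 * υ 1 * υ 2 = Complex.I * (σ : ℂ) * (υF : ℂ) ^ 3

/-- `κ^arg = κ_x κ_y κ_z / |κ|³`. -/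
def kappaArg (κ : E3) : ℝ := κ 0 * κ 1 * κ 2 / ‖κ‖ ^ 3

end WeylPoint

end

open WeylPoint Asymptotics

/-! In Fourier space an eigenfunction at quasi-momentum k becomes a sequence c on the reciprocal
lattice with |k+G|² c(G) + (V̂ * c)(G) = μ c(G). Since V̂ decays rapidly, bounded solutions decay
rapidly too (`decay_of_eigen`), so classical eigenfunctions and solutions of the sequence equation
are the same thing (`mem_eigenspace_iff`). Put c = A u, where A is multiplication by
(1+|K+G|²)^(-1/2), and multiply the equation by A. The problem at K becomes a pencil N u = ν A² u on
ℓ², with N bounded and coercive, A compact and injective, and ν equal to μ plus a constant. The gain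
is that moving K to K+κ leaves A alone and adds to N a bounded symmetric operator Z with ‖Z‖ ≤ |κ| +
|κ|². No unbounded operator appears.

For such pencils min-max holds in the forms `hasEigs_of_form_le` and `le_of_hasEigs`. The compact
operator A N⁻¹ A supplies a gap above the unperturbed eigenvalue (`exists_gap`). Trial spaces made
of lower eigenvectors together with vectors diagonalizing Z on the three-dimensional eigenspace then
give the perturbed eigenvalues up to O(‖Z‖²) (`perturb`, `band_expansion`).

What remains is the 3 × 3 matrix with entries -κ · ⟨Φᵢ, 2i∇Φⱼ⟩. Each vector ⟨Φᵢ, 2i∇Φⱼ⟩ is an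
eigenvector of R, or zero, because Φᵢ and Φⱼ are multiplied by fourth roots of unity under R. This
kills the diagonal and leaves three scalars υ₁, υ₂, υ₃ (`gradInner_eq_omega1`,
`gradInner_eq_omega2`). The antiunitary symmetry F ↦ conj F(-x) gives |υ₁| = |υ₂|. The symmetry T
turns a symmetry basis into another orthonormal basis of the same eigenspace while replacing κ by
T*κ, so the trace of the square and the determinant agree at κ and T*κ. Well-chosen κ then force
|υ₁| = |υ₃| and υ₁υ₂υ₃ ∈ iℝ (`IsSymmetryBasis.velocity`). The same invariants show that the modulus
and the product do not depend on the symmetry basis (`exists_fermiVelocity`).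

The eigenvalues of the matrix therefore have sum 0, sum of squares 2υ_F²|κ|² and product
-2συ_F³κ_xκ_yκ_z. Divided by υ_F|κ|, they are the roots of the stated cubic (`roots_cubic`). -/

noncomputable section

namespace WeylPoint

/-! ### Coercive pencils and their spectral gaps -/

section Pencil

variable {H : Type*} [NormedAddCommGroup H] [InnerProductSpace ℂ H]

/-- A symmetric pencil `N u = ν A² u` with `A` compact and injective and `N` coercive. -/
structure IsPencil (A N : H →L[ℂ] H) (α : ℝ) : Prop where
  symmA : A.IsSymmetric
  compact : IsCompactOperator A
  inj : Function.Injective A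
  symmN : N.IsSymmetric
  pos : 0 < α
  coercive : ∀ u, α * ‖u‖ ^ 2 ≤ (inner ℂ u (N u)).re

/-- The solutions of `N u = ν A² u`. -/
def genEig (A N : H →L[ℂ] H) (ν : ℝ) : Submodule ℂ H :=
  LinearMap.ker ((N - (ν : ℂ) • (A * A) : H →L[ℂ] H) : H →ₗ[ℂ] H)

lemma mem_genEig {A N : H →L[ℂ] H} {ν : ℝ} {u : H} :
    u ∈ genEig A N ν ↔ N u = (ν : ℂ) • A (A u) := by
  simp [genEig, sub_eq_zero]

namespace IsPencil

variable {A N : H →L[ℂ] H} {α : ℝ}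

lemma form_eq (h : IsPencil A N α) {ν : ℝ} {w : H} (hw : w ∈ genEig A N ν) (u : H) :
    inner ℂ u (N w) = ν * inner ℂ (A u) (A w) := by
  rw [mem_genEig.1 hw, inner_smul_right, h.symmA.apply_clm u (A w)]

lemma form_self (h : IsPencil A N α) {ν : ℝ} {w : H} (hw : w ∈ genEig A N ν) :
    (inner ℂ w (N w)).re = ν * ‖A w‖ ^ 2 := by
  rw [h.form_eq hw, Complex.re_ofReal_mul]
  congr 1
  exact (norm_sq_eq_re_inner (𝕜 := ℂ) (A w)).symm

/-- This is Lax-Milgram: coercivity bounds N from below, so N is injective with closed range, and a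
vector orthogonal to the range vanishes by coercivity again. -/
lemma exists_inverse [CompleteSpace H] (h : IsPencil A N α) :
    ∃ R : H →L[ℂ] H, (∀ u, N (R u) = u) ∧ ∀ u, R (N u) = u := by
  have hb : ∀ u, α * ‖u‖ ≤ ‖N u‖ := by
    intro u
    by_cases hu : 0 < ‖u‖
    · refine (mul_le_mul_iff_left₀ hu).mp ?_
      have h1 := h.coercive u
      have h2 : (inner ℂ u (N u)).re ≤ ‖u‖ * ‖N u‖ := re_inner_le_norm (𝕜 := ℂ) u (N u)
      nlinarith
    · have : u = 0 := by simpa using hu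
      simp [this]
  have hanti : AntilipschitzWith (α⁻¹.toNNReal) N := by
    refine ContinuousLinearMap.antilipschitz_of_bound N ?_
    simp_rw [Real.coe_toNNReal', max_eq_left_of_lt (inv_pos.mpr h.pos), ←
      inv_mul_le_iff₀ (inv_pos.mpr h.pos)]
    simpa using hb
  have hker : N.ker = ⊥ := by
    rw [LinearMap.ker_eq_bot]
    exact hanti.injective
  have hcl : IsClosed (N.range : Set H) := hanti.isClosed_range N.uniformContinuous
  have hrange : N.range = ⊤ := by
    have := hcl.completeSpace_coe
    rw [← N.range.orthogonal_orthogonal, Submodule.eq_top_iff']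
    intro v w hw
    obtain rfl : w = 0 := by
      have h1 := h.coercive w
      have h2 : inner ℂ w (N w) = 0 := by
        rw [← inner_conj_symm, show inner ℂ (N w) w = 0 from hw _ ⟨w, rfl⟩, map_zero]
      rw [h2, Complex.zero_re] at h1
      have h3 : ‖w‖ ^ 2 ≤ 0 := by
        by_contra hc
        push Not at hc
        have := mul_pos h.pos hc
        linarith
      have h4 : ‖w‖ = 0 := by nlinarith [norm_nonneg w]
      exact norm_eq_zero.1 h4
    exact inner_zero_left _
  let e := ContinuousLinearEquiv.ofBijective N hker hrange
  exact ⟨e.symm, fun u => e.apply_symm_apply u, fun u => e.symm_apply_apply u⟩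

/-- The Cauchy-Schwarz inequality for the form of `N`. -/
lemma form_cauchy_schwarz (h : IsPencil A N α) (u v : H) :
    ‖inner ℂ u (N v)‖ ^ 2 ≤ (inner ℂ u (N u)).re * (inner ℂ v (N v)).re := by
  have hsymm : ∀ x y, inner ℂ x (N y) = conj (inner ℂ y (N x)) := fun x y => by
    rw [inner_conj_symm, h.symmN.apply_clm x y]
  have hnn : ∀ x, 0 ≤ (inner ℂ x (N x)).re := fun x =>
    le_trans (mul_nonneg h.pos.le (sq_nonneg _)) (h.coercive x)
  set c : ℂ := inner ℂ u (N v) with hc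
  -- Positivity of the form at u - t c̄ v. The factor c̄ aligns phases, so that the result is a real
  -- quadratic in t whose discriminant is the claim times ‖c‖².
  have key : ∀ t : ℝ, 0 ≤ (inner ℂ v (N v)).re * ‖c‖ ^ 2 * (t * t)
      + (-2 * ‖c‖ ^ 2) * t + (inner ℂ u (N u)).re := by
    intro t
    have h1 := hnn (u - ((t : ℂ) * conj c) • v)
    have h2 : inner ℂ v (N u) = conj c := by rw [hc, hsymm u v, Complex.conj_conj]
    have h3 : inner ℂ (u - ((t : ℂ) * conj c) • v) (N (u - ((t : ℂ) * conj c) • v))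
        = inner ℂ u (N u) - 2 * (t : ℂ) * (c * conj c)
          + ((t : ℂ) * t * (c * conj c)) * inner ℂ v (N v) := by
      rw [map_sub, map_smul, inner_sub_left, inner_sub_right, inner_sub_right, inner_smul_left,
        inner_smul_left, inner_smul_right, inner_smul_right, h2, ← hc]
      simp only [map_mul, Complex.conj_conj, Complex.conj_ofReal]
      ring
    rw [h3, Complex.mul_conj] at h1
    have h4 : (inner ℂ u (N u) - 2 * (t : ℂ) * ((Complex.normSq c : ℝ) : ℂ)
          + ((t : ℂ) * t * ((Complex.normSq c : ℝ) : ℂ)) * inner ℂ v (N v)).re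
        = (inner ℂ u (N u)).re - 2 * t * Complex.normSq c
          + t * t * Complex.normSq c * (inner ℂ v (N v)).re := by
      simp
    rw [h4, Complex.normSq_eq_norm_sq] at h1
    linarith
  have hd := discrim_le_zero key
  rw [discrim] at hd
  rcases eq_or_ne (‖c‖ ^ 2) 0 with h0 | h0
  · rw [h0]; exact mul_nonneg (hnn u) (hnn v)
  · have h5 : 0 < ‖c‖ ^ 2 := lt_of_le_of_ne (sq_nonneg _) h0.symm
    nlinarith

end IsPencil

/-- The norm of a nonzero positive compact operator is an eigenvalue. -/
lemma exists_eigenvector_norm [CompleteSpace H] {T : H →L[ℂ] H} (hT : IsCompactOperator T)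
    (hs : T.IsSymmetric) (hp : ∀ x, 0 ≤ (inner ℂ x (T x)).re) (h0 : T ≠ 0) :
    ∃ x, x ≠ 0 ∧ T x = (‖T‖ : ℂ) • x := by
  have hnt : Nontrivial H := by
    by_contra hc
    rw [not_nontrivial_iff_subsingleton] at hc
    exact h0 (ContinuousLinearMap.ext fun x => Subsingleton.elim _ _)
  -- For a self-adjoint operator some spectral value has modulus ‖T‖. Compactness makes a nonzero
  -- spectral value an eigenvalue, and positivity of the form excludes -‖T‖.
  obtain ⟨z, hz, hzr⟩ := spectrum.exists_nnnorm_eq_spectralRadius (A := H →L[ℂ] H) T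
  rw [T.spectralRadius_eq_nnnorm hs.isSelfAdjoint] at hzr
  have hzn : ‖z‖ = ‖T‖ := by
    have : ‖z‖₊ = ‖T‖₊ := by exact_mod_cast hzr
    exact congrArg NNReal.toReal this
  have hz0 : z ≠ 0 := by
    intro h
    rw [h, norm_zero] at hzn
    exact h0 (norm_eq_zero.1 hzn.symm)
  have hev := (hT.hasEigenvalue_iff_mem_spectrum hz0).2 hz
  obtain ⟨x, hx⟩ := hev.exists_hasEigenvector
  have hx1 : T x = z • x := hx.apply_eq_smul
  have hreal := hs.conj_eigenvalue_eq_self hev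
  have hxn : 0 < ‖x‖ ^ 2 := by have := norm_pos_iff.2 hx.2; positivity
  have hzre : z = (z.re : ℂ) := (Complex.conj_eq_iff_re.1 hreal).symm
  have h1 := hp x
  rw [hx1, inner_smul_right, hzre, Complex.re_ofReal_mul,
    show (inner ℂ x x).re = ‖x‖ ^ 2 from (norm_sq_eq_re_inner (𝕜 := ℂ) x).symm] at h1
  have h2 : 0 ≤ z.re := nonneg_of_mul_nonneg_left h1 hxn
  refine ⟨x, hx.2, ?_⟩
  rw [hx1, ← hzn]
  congr 1
  rw [hzre, Complex.norm_real, Real.norm_of_nonneg h2]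

/-- Above the eigenvalues of a pencil up to `ν₀` there is a spectral gap. -/
lemma IsPencil.exists_gap [CompleteSpace H] {A N : H →L[ℂ] H} {α : ℝ} (h : IsPencil A N α)
    {ν₀ : ℝ} (hν : 0 < ν₀) :
    ∃ ν₁, ν₀ < ν₁ ∧ ∀ u, (∀ ν ≤ ν₀, ∀ w ∈ genEig A N ν, inner ℂ (A w) (A u) = 0) →
      ν₁ * ‖A u‖ ^ 2 ≤ (inner ℂ u (N u)).re := by
  obtain ⟨R, hNR, hRN⟩ := h.exists_inverse
  have hRs : R.IsSymmetric := fun x y => by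
    have := h.symmN.apply_clm (R x) (R y)
    rw [hNR, hNR] at this
    exact this.symm
  have hRp : ∀ x, 0 ≤ (inner ℂ x (R x)).re := fun x => by
    have h1 := h.coercive (R x)
    rw [hNR, ← inner_conj_symm, Complex.conj_re] at h1
    exact le_trans (mul_nonneg h.pos.le (sq_nonneg _)) h1
  -- With R = N⁻¹, solutions w for ν ≠ 0 correspond to eigenvectors A w of the positive compact
  -- operator B with eigenvalue 1/ν. The span P of the A w with ν ≤ ν₀ is invariant under B, hence
  -- so is its orthogonal complement.
  set B : H →L[ℂ] H := A * R * A with hB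
  have hBap : ∀ x, B x = A (R (A x)) := fun x => rfl
  have hBs : B.IsSymmetric := fun x y => by
    change inner ℂ (A (R (A x))) y = inner ℂ x (A (R (A y)))
    rw [h.symmA.apply_clm, hRs.apply_clm, h.symmA.apply_clm]
  have hBc : IsCompactOperator B := h.compact.clm_comp (A * R)
  have hBp : ∀ x, 0 ≤ (inner ℂ x (B x)).re := fun x => by
    rw [hBap, ← h.symmA.apply_clm]
    exact hRp _
  let P : Submodule ℂ H := ⨆ ν : {ν : ℝ // ν ≤ ν₀}, (genEig A N ν).map (A : H →ₗ[ℂ] H)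
  have hPB : ∀ x ∈ P, B x ∈ P := by
    intro x hx
    refine Submodule.iSup_induction _ (motive := fun x => B x ∈ P) hx ?_ ?_ ?_
    · rintro ν y ⟨w, hw, rfl⟩
      have h1 : N w = ((ν : ℝ) : ℂ) • A (A w) := mem_genEig.1 hw
      have hmem : A w ∈ P := Submodule.mem_iSup_of_mem ν ⟨w, hw, rfl⟩
      by_cases h0 : ((ν : ℝ) : ℂ) = 0
      · have h2 : w = 0 := by rw [← hRN w, h1, h0, zero_smul, map_zero]
        subst h2
        simp
      · have h2 : B (A w) = ((ν : ℝ) : ℂ)⁻¹ • A w := by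
          rw [hBap]
          have : A (A w) = ((ν : ℝ) : ℂ)⁻¹ • N w := by rw [h1, smul_smul, inv_mul_cancel₀ h0, one_smul]
          rw [this, map_smul, hRN, map_smul]
        change B (A w) ∈ P
        rw [h2]
        exact P.smul_mem _ hmem
    · simp
    · intro x y hx hy
      rw [map_add]
      exact P.add_mem hx hy
  have hYB : ∀ y ∈ Pᗮ, B y ∈ Pᗮ := by
    intro y hy x hx
    change inner ℂ x (B y) = 0
    rw [← hBs.apply_clm]
    exact hy _ (hPB x hx)
  let S : Pᗮ →L[ℂ] Pᗮ := B.restrict hYB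
  have hSap : ∀ y : Pᗮ, ((S y : Pᗮ) : H) = B y := fun y => rfl
  have hSc : IsCompactOperator S := hBc.restrict' hYB
  have hSs : S.IsSymmetric := fun x y => hBs _ _
  have hSp : ∀ x, 0 ≤ (inner ℂ x (S x)).re := fun x => hBp x
  -- Otherwise ‖S‖ would be an eigenvalue of B on Pᗮ with ‖S‖⁻¹ ≤ ν₀, and its eigenvector would lie
  -- in P as well. The strict inequality leaves room for β, and ν₁ = 1/β is the gap.
  have hnorm : ‖S‖ < 1 / ν₀ := by
    by_contra hc
    push Not at hc
    have hpos : 0 < ‖S‖ := lt_of_lt_of_le (by positivity) hc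
    obtain ⟨x, hx0, hx⟩ := exists_eigenvector_norm hSc hSs hSp (norm_pos_iff.1 hpos)
    have hx' : B x = (‖S‖ : ℂ) • (x : H) := by rw [← hSap, hx]; rfl
    have hne : (‖S‖ : ℂ) ≠ 0 := by exact_mod_cast hpos.ne'
    have hmem : (x : H) ∈ P := by
      have hle : ‖S‖⁻¹ ≤ ν₀ := by
        rw [inv_le_comm₀ hpos hν]
        simpa using hc
      refine Submodule.mem_iSup_of_mem ⟨‖S‖⁻¹, hle⟩ ⟨(‖S‖ : ℂ)⁻¹ • R (A x), ?_, ?_⟩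
      · have h1 : A ((‖S‖ : ℂ)⁻¹ • R (A x)) = x := by
          rw [map_smul, ← hBap, hx', smul_smul, inv_mul_cancel₀ hne, one_smul]
        rw [SetLike.mem_coe, mem_genEig, h1, map_smul, hNR]
        push_cast
        rfl
      · change A ((‖S‖ : ℂ)⁻¹ • R (A x)) = x
        rw [map_smul, ← hBap, hx', smul_smul, inv_mul_cancel₀ hne, one_smul]
    have h0 := x.2 _ hmem
    rw [inner_self_eq_zero] at h0
    exact hx0 (Subtype.ext h0)
  obtain ⟨β, hβ1, hβ2⟩ := exists_between hnorm
  have hβ : 0 < β := lt_of_le_of_lt (norm_nonneg S) hβ1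
  refine ⟨1 / β, ?_, fun u hu => ?_⟩
  · rw [lt_one_div hν hβ]; exact hβ2
  · set y := A u with hy
    have hyY : y ∈ Pᗮ := by
      intro x hx
      refine Submodule.iSup_induction _ (motive := fun x => inner ℂ x y = 0) hx ?_ ?_ ?_
      · rintro ν x ⟨w, hw, rfl⟩
        exact hu ν ν.2 w hw
      · simp
      · intro a b ha hb
        rw [inner_add_left, ha, hb, add_zero]
    have h1 : (inner ℂ y (B y)).re ≤ β * ‖y‖ ^ 2 := by
      have h2 : (inner ℂ y (B y)).re ≤ ‖y‖ * ‖B y‖ := re_inner_le_norm (𝕜 := ℂ) y (B y)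
      have h3 : ‖B y‖ ≤ β * ‖y‖ := by
        have := S.le_opNorm ⟨y, hyY⟩
        have h4 : ‖S ⟨y, hyY⟩‖ = ‖B y‖ := rfl
        rw [h4] at this
        exact this.trans (mul_le_mul_of_nonneg_right hβ1.le (norm_nonneg _))
      nlinarith [norm_nonneg y]
    -- Testing u against N⁻¹ A y, where y = A u, gives ‖y‖⁴ ≤ ⟨u, N u⟩ ⟨y, B y⟩ ≤ ⟨u, N u⟩ β ‖y‖².
    have h2 := h.form_cauchy_schwarz u (R (A y))
    have h3 : inner ℂ u (N (R (A y))) = (‖y‖ : ℂ) ^ 2 := by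
      rw [hNR, ← h.symmA.apply_clm, ← hy]
      exact inner_self_eq_norm_sq_to_K (𝕜 := ℂ) y
    have h4 : (inner ℂ (R (A y)) (N (R (A y)))).re = (inner ℂ y (B y)).re := by
      rw [hNR, hBap, ← h.symmA.apply_clm y, ← inner_conj_symm, Complex.conj_re]
    rw [h3, h4] at h2
    simp only [norm_pow, Complex.norm_real, norm_norm] at h2
    have hnn : 0 ≤ (inner ℂ u (N u)).re :=
      le_trans (mul_nonneg h.pos.le (sq_nonneg _)) (h.coercive u)
    rcases eq_or_ne (‖y‖ ^ 2) 0 with h0 | h0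
    · rw [h0, mul_zero]; exact hnn
    · have h5 : 0 < ‖y‖ ^ 2 := lt_of_le_of_ne (sq_nonneg _) h0.symm
      rw [one_div, inv_mul_le_iff₀ hβ]
      have h6 : ‖y‖ ^ 2 * ‖y‖ ^ 2 ≤ (β * (inner ℂ u (N u)).re) * ‖y‖ ^ 2 := by
        nlinarith
      exact le_of_mul_le_mul_right h6 h5

end Pencil

/-! ### Min-max principle for pencils -/

section MinMax

variable {H : Type*} [NormedAddCommGroup H] [InnerProductSpace ℂ H]

/-- The pencil has `n` eigenvalues, counted with multiplicity, up to `ν`. -/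
def HasEigs (A N : H →L[ℂ] H) (n : ℕ) (ν : ℝ) : Prop :=
  ∃ F : Fin n → H, LinearIndependent ℂ F ∧ ∀ i, ∃ s ≤ ν, F i ∈ genEig A N s

/-- Applied to sets of eigenvectors, this dichotomy replaces counting: either there are enough
eigenvalues, or all the eigenvectors in question span a space of known small dimension. No
finite-dimensionality has to be known beforehand. -/
lemma exists_fin_linearIndependent_or_card_lt {V : Type*} [AddCommGroup V] [Module ℂ V]
    (s : Set V) (n : ℕ) :
    (∃ F : Fin n → V, LinearIndependent ℂ F ∧ ∀ i, F i ∈ s) ∨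
      ∃ k < n, ∃ F : Fin k → V, LinearIndependent ℂ F ∧ (∀ i, F i ∈ s) ∧
        Submodule.span ℂ (Set.range F) = Submodule.span ℂ s := by
  obtain ⟨b, hbs, hspan, hli⟩ := exists_linearIndependent ℂ s
  by_cases hfin : b.Finite
  · have : Fintype b := hfin.fintype
    let e := (Fintype.equivFin b).symm
    rcases le_or_gt n (Fintype.card b) with hn | hn
    · left
      exact ⟨fun i => (e (Fin.castLE hn i) : V),
        hli.comp (fun i => e (Fin.castLE hn i)) (e.injective.comp (Fin.castLE_injective hn)),
        fun i => hbs (e _).2⟩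
    · right
      refine ⟨_, hn, fun i => (e i : V), hli.comp e e.injective, fun i => hbs (e i).2, ?_⟩
      rw [← hspan]
      congr 1
      ext x
      constructor
      · rintro ⟨i, rfl⟩
        exact (e i).2
      · intro hx
        exact ⟨e.symm ⟨x, hx⟩, by simp⟩
  · left
    have : Infinite b := Set.infinite_coe_iff.2 hfin
    let g := Infinite.natEmbedding b
    exact ⟨fun i => (g i : V), hli.comp (fun i : Fin n => g i)
      (g.injective.comp Fin.val_injective), fun i => hbs (g _).2⟩

namespace IsPencil

variable {A N : H →L[ℂ] H} {α : ℝ}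

/-- Evaluating ⟨v, N w⟩ from either side gives t ⟨A v, A w⟩ = s ⟨A v, A w⟩. -/
lemma apply_orthogonal (h : IsPencil A N α) {s t : ℝ} (hst : s ≠ t) {v w : H}
    (hv : v ∈ genEig A N s) (hw : w ∈ genEig A N t) : inner ℂ (A v) (A w) = 0 := by
  have h1 := h.form_eq hw v
  have h2 := h.form_eq hv w
  rw [← inner_conj_symm, h.symmN.apply_clm, h1] at h2
  have h3 : (t : ℂ) * inner ℂ (A v) (A w) = s * inner ℂ (A v) (A w) := by
    have := congrArg conj h2
    rw [Complex.conj_conj, map_mul, Complex.conj_ofReal, inner_conj_symm] at this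
    exact this
  have h4 : ((t : ℂ) - s) * inner ℂ (A v) (A w) = 0 := by rw [sub_mul, h3, sub_self]
  rcases mul_eq_zero.1 h4 with h5 | h5
  · exact absurd (by exact_mod_cast (sub_eq_zero.1 h5).symm) hst
  · exact h5

/-- Grouping by eigenvalue makes both forms diagonal, by `apply_orthogonal`, and the bound is then
termwise. -/
lemma form_le_of_mem_span (h : IsPencil A N α) {ν : ℝ} {u : H}
    (hu : u ∈ Submodule.span ℂ {u | ∃ s ≤ ν, u ∈ genEig A N s}) :
    (inner ℂ u (N u)).re ≤ ν * ‖A u‖ ^ 2 := by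
  have hu' : u ∈ ⨆ s : {s : ℝ // s ≤ ν}, genEig A N s := by
    refine Submodule.span_le.2 ?_ hu
    rintro x ⟨s, hs, hx⟩
    exact Submodule.mem_iSup_of_mem (⟨s, hs⟩ : {s : ℝ // s ≤ ν}) hx
  rw [Submodule.mem_iSup_iff_exists_finsupp] at hu'
  obtain ⟨f, hf, rfl⟩ := hu'
  rw [Finsupp.sum]
  have h1 : ∀ s ∈ f.support, ∀ t ∈ f.support, s ≠ t → inner ℂ (A (f s)) (A (f t)) = 0 :=
    fun s _ t _ hst => h.apply_orthogonal (fun hc => hst (Subtype.ext hc)) (hf s) (hf t)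
  have h2 : (inner ℂ (∑ s ∈ f.support, f s) (N (∑ s ∈ f.support, f s))).re
      = ∑ s ∈ f.support, (s : ℝ) * ‖A (f s)‖ ^ 2 := by
    rw [map_sum, inner_sum, Complex.re_sum]
    refine Finset.sum_congr rfl fun s hs => ?_
    rw [sum_inner, Finset.sum_eq_single s]
    · exact h.form_self (hf s)
    · intro t ht hts
      rw [h.form_eq (hf s), h1 t ht s hs hts, mul_zero]
    · exact fun hc => absurd hs hc
  have h3 : ‖A (∑ s ∈ f.support, f s)‖ ^ 2 = ∑ s ∈ f.support, ‖A (f s)‖ ^ 2 := by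
    rw [map_sum, norm_sq_eq_re_inner (𝕜 := ℂ), inner_sum]
    simp only [RCLike.re_to_complex]
    rw [Complex.re_sum]
    refine Finset.sum_congr rfl fun s hs => ?_
    rw [sum_inner, Finset.sum_eq_single s, norm_sq_eq_re_inner (𝕜 := ℂ)]
    · rfl
    · exact fun t ht hts => h1 t ht s hs hts
    · exact fun hc => absurd hs hc
  rw [h2, h3, Finset.mul_sum]
  exact Finset.sum_le_sum fun s _ => mul_le_mul_of_nonneg_right s.2 (sq_nonneg _)

lemma apply_norm_sq_pos (h : IsPencil A N α) {u : H} (hu : u ≠ 0) : 0 < ‖A u‖ ^ 2 := by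
  have : A u ≠ 0 := fun hc => hu (h.inj (by rw [hc, map_zero]))
  have := norm_pos_iff.2 this
  positivity

/-- Dimension count: the constraints define a linear map from the span into a space of smaller
dimension, so it has a kernel. -/
lemma exists_ne_zero_mem_span {ι κ : Type*} [Fintype ι] [Fintype κ] (A : H →L[ℂ] H) {F : ι → H}
    (hF : LinearIndependent ℂ F) (g : κ → H) (hcard : Fintype.card κ < Fintype.card ι) :
    ∃ u ∈ Submodule.span ℂ (Set.range F), u ≠ 0 ∧ ∀ i, inner ℂ (A (g i)) (A u) = 0 := by
  let S := Submodule.span ℂ (Set.range F)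
  have hfr : Module.finrank ℂ S = Fintype.card ι := finrank_span_eq_card hF
  have : FiniteDimensional ℂ S := FiniteDimensional.span_of_finite ℂ (Set.finite_range F)
  let φ : S →ₗ[ℂ] (κ → ℂ) := LinearMap.pi fun i =>
    ((innerSL ℂ (A (g i))).comp A : H →L[ℂ] ℂ).toLinearMap.comp S.subtype
  have hker : LinearMap.ker φ ≠ ⊥ := LinearMap.ker_ne_bot_of_finrank_lt (by
    rw [hfr, Module.finrank_fintype_fun_eq_card]; exact hcard)
  obtain ⟨x, hx, hx0⟩ := (Submodule.ne_bot_iff _).1 hker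
  refine ⟨x, x.2, fun hc => hx0 (Subtype.ext hc), fun i => ?_⟩
  exact congrFun (LinearMap.mem_ker.1 hx) i

/-- The upper half of the min-max principle. -/
lemma hasEigs_of_form_le [CompleteSpace H] (h : IsPencil A N α) {ν : ℝ} (hν : 0 < ν)
    {ι : Type*} [Fintype ι] {F : ι → H} (hF : LinearIndependent ℂ F)
    (hform : ∀ u ∈ Submodule.span ℂ (Set.range F), (inner ℂ u (N u)).re ≤ ν * ‖A u‖ ^ 2) :
    HasEigs A N (Fintype.card ι) ν := by
  rcases exists_fin_linearIndependent_or_card_lt {u | ∃ s ≤ ν, u ∈ genEig A N s}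
    (Fintype.card ι) with hc | ⟨k, hk, G, -, -, hG⟩
  · exact hc
  · exfalso
    -- If fewer eigenvectors are available, the trial space contains a nonzero vector orthogonal to
    -- all of them; the gap then puts its quotient at ν₁ or above, while the trial bound says at
    -- most ν.
    obtain ⟨ν₁, hν₁, hgap⟩ := h.exists_gap hν
    obtain ⟨u, huS, hu0, hu⟩ := exists_ne_zero_mem_span A hF G (by simpa using hk)
    have h1 := hgap u fun s hs w hw => by
      have hw' : w ∈ Submodule.span ℂ (Set.range G) := by
        rw [hG]; exact Submodule.subset_span ⟨s, hs, hw⟩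
      refine Submodule.span_induction (p := fun w _ => inner ℂ (A w) (A u) = 0) ?_ ?_ ?_ ?_ hw'
      · rintro _ ⟨i, rfl⟩; exact hu i
      · simp
      · intro x y _ _ hx hy; rw [map_add, inner_add_left, hx, hy, add_zero]
      · intro c x _ hx; rw [map_smul, inner_smul_left, hx, mul_zero]
    have h2 := hform u huS
    have h3 := h.apply_norm_sq_pos hu0
    nlinarith

/-- The lower half of the min-max principle. -/
lemma le_of_hasEigs (h : IsPencil A N α) {κ : Type*} [Fintype κ] (g : κ → H) {n : ℕ}
    (hcard : Fintype.card κ < n) {t ν : ℝ}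
    (hform : ∀ u, (∀ i, inner ℂ (A (g i)) (A u) = 0) → t * ‖A u‖ ^ 2 ≤ (inner ℂ u (N u)).re)
    (hn : HasEigs A N n ν) : t ≤ ν := by
  obtain ⟨F, hF, hFν⟩ := hn
  obtain ⟨u, huS, hu0, hu⟩ := exists_ne_zero_mem_span A hF g (by simpa using hcard)
  have h1 := hform u hu
  have h2 := h.form_le_of_mem_span (ν := ν) (Submodule.span_mono (by
    rintro _ ⟨i, rfl⟩; exact hFν i) huS)
  exact le_of_mul_le_mul_right (h1.trans h2) (h.apply_norm_sq_pos hu0)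

/-- If there are fewer than `n` eigenvalues up to `ν₀`, then the `n`-th one stays away from `ν₀`. -/
lemma exists_lt_of_not_hasEigs [CompleteSpace H] (h : IsPencil A N α) {ν₀ : ℝ} (hν : 0 < ν₀)
    {n : ℕ} (hn : ¬ HasEigs A N n ν₀) : ∃ ν₁, ν₀ < ν₁ ∧ ∀ ν, HasEigs A N n ν → ν₁ ≤ ν := by
  rcases exists_fin_linearIndependent_or_card_lt {u | ∃ s ≤ ν₀, u ∈ genEig A N s} n with
    hc | ⟨k, hk, G, -, -, hG⟩
  · exact absurd hc hn
  · obtain ⟨ν₁, hν₁, hgap⟩ := h.exists_gap hν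
    refine ⟨ν₁, hν₁, fun ν hν' => h.le_of_hasEigs G (by simpa using hk) (fun u hu => ?_) hν'⟩
    refine hgap u fun s hs w hw => ?_
    have hw' : w ∈ Submodule.span ℂ (Set.range G) := by
      rw [hG]; exact Submodule.subset_span ⟨s, hs, hw⟩
    refine Submodule.span_induction (p := fun w _ => inner ℂ (A w) (A u) = 0) ?_ ?_ ?_ ?_ hw'
    · rintro _ ⟨i, rfl⟩; exact hu i
    · simp
    · intro x y _ _ hx hy; rw [map_add, inner_add_left, hx, hy, add_zero]
    · intro c x _ hx; rw [map_smul, inner_smul_left, hx, mul_zero]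

/-- The eigenvectors below a three-fold eigenvalue. -/
lemma exists_lower (h : IsPencil A N α) {ν₀ : ℝ} {m : ℕ}
    (hlow : ∀ ν < ν₀, ¬ HasEigs A N (m + 1) ν) (hup : HasEigs A N (m + 3) ν₀)
    {e : Fin 3 → H} (he : Submodule.span ℂ (Set.range e) = genEig A N ν₀) :
    ∃ w : Fin m → H, LinearIndependent ℂ w ∧
      (∃ ν₁ < ν₀, ∀ u ∈ Submodule.span ℂ (Set.range w),
        u ∈ Submodule.span ℂ {u | ∃ s ≤ ν₁, u ∈ genEig A N s}) ∧
      ∀ s < ν₀, genEig A N s ≤ Submodule.span ℂ (Set.range w) := by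
  -- Finitely many eigenvalues below ν₀ lie below a common ν₁ < ν₀; this ν₁ is the gap under ν₀.
  have hmax : ∀ {k : ℕ} (F : Fin k → H), (∀ i, ∃ s < ν₀, F i ∈ genEig A N s) →
      ∃ ν₁ < ν₀, ∀ i, ∃ s ≤ ν₁, F i ∈ genEig A N s := by
    intro k F hF
    choose s hs hsF using hF
    obtain ⟨c, hc, hcs⟩ : ∃ c < ν₀, ∀ i, s i ≤ c := by
      by_cases hk : Nonempty (Fin k)
      · refine ⟨Finset.univ.sup' Finset.univ_nonempty s, ?_, fun i =>
          Finset.le_sup' s (Finset.mem_univ i)⟩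
        rw [Finset.sup'_lt_iff]
        exact fun i _ => hs i
      · exact ⟨ν₀ - 1, by linarith, fun i => absurd ⟨i⟩ hk⟩
    exact ⟨c, hc, fun i => ⟨s i, hcs i, hsF i⟩⟩
  rcases exists_fin_linearIndependent_or_card_lt {u | ∃ s < ν₀, u ∈ genEig A N s} (m + 1) with
    ⟨F, hF, hFs⟩ | ⟨k, hk, G, hG, hGs, hGspan⟩
  · obtain ⟨ν₁, hν₁, hF1⟩ := hmax F hFs
    exact absurd ⟨F, hF, hF1⟩ (hlow ν₁ hν₁)
  · have hmk : m ≤ k := by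
      by_contra hc
      push Not at hc
      obtain ⟨F, hF, hFs⟩ := hup
      -- If k < m, the k + 3 vectors of G and e cannot exhaust the m + 3 independent eigenvectors F.
      -- But F lies in their span, so u would be orthogonal to itself after applying A.
      obtain ⟨u, huS, hu0, hu⟩ := exists_ne_zero_mem_span A hF (Sum.elim G e) (by
        simp; omega)
      have hu1 : u ∈ Submodule.span ℂ (Set.range (Sum.elim G e)) := by
        refine Submodule.span_le.2 ?_ huS
        rintro _ ⟨i, rfl⟩
        obtain ⟨s, hs, hsF⟩ := hFs i
        rw [Set.Sum.elim_range, Submodule.span_union, SetLike.mem_coe, he, hGspan]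
        rcases hs.lt_or_eq with hs | rfl
        · exact Submodule.mem_sup_left (Submodule.subset_span ⟨s, hs, hsF⟩)
        · exact Submodule.mem_sup_right hsF
      have h2 : inner ℂ (A u) (A u) = 0 := by
        refine Submodule.span_induction (p := fun w _ => inner ℂ (A w) (A u) = 0) ?_ ?_ ?_ ?_ hu1
        · rintro _ ⟨i, rfl⟩; exact hu i
        · simp
        · intro x y _ _ hx hy; rw [map_add, inner_add_left, hx, hy, add_zero]
        · intro c x _ hx; rw [map_smul, inner_smul_left, hx, mul_zero]
      rw [inner_self_eq_zero] at h2
      exact hu0 (h.inj (by rw [h2, map_zero]))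
    obtain rfl : k = m := by omega
    obtain ⟨ν₁, hν₁, hG1⟩ := hmax G hGs
    refine ⟨G, hG, ⟨ν₁, hν₁, fun u hu => ?_⟩, fun s hs w hw => ?_⟩
    · refine Submodule.span_mono ?_ hu
      rintro _ ⟨i, rfl⟩
      exact hG1 i
    · rw [hGspan]
      exact Submodule.subset_span ⟨s, hs, hw⟩

end IsPencil

end MinMax

/-! ### First-order perturbation of a three-fold eigenvalue -/

section Perturbation

variable {H : Type*} [NormedAddCommGroup H] [InnerProductSpace ℂ H]

/-- Young's inequality with a weight. It splits the cross term into a part absorbed by the spectral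
gap and a part quadratic in ‖Z‖; only the latter survives. -/
lemma two_mul_le_of_pos {p z x y : ℝ} (hp : 0 < p) :
    2 * z * x * y ≤ p * x ^ 2 + z ^ 2 * y ^ 2 / p := by
  have h : 0 ≤ (p * x - z * y) ^ 2 / p := by positivity
  have h2 : (p * x - z * y) ^ 2 / p = p * x ^ 2 + z ^ 2 * y ^ 2 / p - 2 * z * x * y := by
    field_simp
    ring
  linarith

lemma abs_re_inner_apply_le (Z : H →L[ℂ] H) (x y : H) :
    |(inner ℂ x (Z y)).re| ≤ ‖Z‖ * ‖x‖ * ‖y‖ := by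
  refine (Complex.abs_re_le_norm _).trans ((norm_inner_le_norm _ _).trans ?_)
  have := mul_le_mul_of_nonneg_left (Z.le_opNorm y) (norm_nonneg x)
  linarith

lemma re_inner_add_apply_add {Z : H →L[ℂ] H} (hZ : Z.IsSymmetric) (x y : H) :
    (inner ℂ (x + y) (Z (x + y))).re
      = (inner ℂ x (Z x)).re + (inner ℂ y (Z y)).re + 2 * (inner ℂ x (Z y)).re := by
  have h : (inner ℂ y (Z x)).re = (inner ℂ x (Z y)).re := by
    rw [← hZ.apply_clm y x, ← inner_conj_symm, Complex.conj_re]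
  rw [map_add, inner_add_left, inner_add_right, inner_add_right]
  simp only [Complex.add_re]
  rw [h]
  ring

lemma norm_add_sq_of_inner_eq_zero {x y : H} (h : inner ℂ x y = 0) :
    ‖x + y‖ ^ 2 = ‖x‖ ^ 2 + ‖y‖ ^ 2 := by
  have := norm_add_sq_eq_norm_sq_add_norm_sq_of_inner_eq_zero x y h
  nlinarith

lemma norm_sum_smul_sq {n : ℕ} {f : Fin n → H}
    (hf : ∀ i j, inner ℂ (f i) (f j) = if i = j then 1 else 0) (c : Fin n → ℂ) :
    ‖∑ i, c i • f i‖ ^ 2 = ∑ i, ‖c i‖ ^ 2 := by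
  have h1 : inner ℂ (∑ i, c i • f i) (∑ i, c i • f i) = ((∑ i, ‖c i‖ ^ 2 : ℝ) : ℂ) := by
    rw [sum_inner]
    push_cast
    refine Finset.sum_congr rfl fun i _ => ?_
    rw [inner_sum, Finset.sum_eq_single i]
    · rw [inner_smul_left, inner_smul_right, hf, if_pos rfl, mul_one, Complex.conj_mul']
    · intro j _ hj
      rw [inner_smul_left, inner_smul_right, hf, if_neg hj.symm, mul_zero, mul_zero]
    · simp
  rw [norm_sq_eq_re_inner (𝕜 := ℂ), h1, RCLike.re_to_complex, Complex.ofReal_re]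

lemma re_inner_sum_apply_sum {n : ℕ} {f : Fin n → H} {Z : H →L[ℂ] H} {l : Fin n → ℝ}
    (hf : ∀ i j, inner ℂ (f i) (Z (f j)) = if i = j then (l i : ℂ) else 0) (c : Fin n → ℂ) :
    (inner ℂ (∑ i, c i • f i) (Z (∑ i, c i • f i))).re = ∑ i, l i * ‖c i‖ ^ 2 := by
  have h1 : inner ℂ (∑ i, c i • f i) (Z (∑ i, c i • f i)) = ((∑ i, l i * ‖c i‖ ^ 2 : ℝ) : ℂ) := by
    rw [sum_inner, map_sum]
    push_cast
    refine Finset.sum_congr rfl fun i _ => ?_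
    rw [inner_sum, Finset.sum_eq_single i]
    · rw [map_smul, inner_smul_left, inner_smul_right, hf, if_pos rfl, ← Complex.conj_mul']
      ring
    · intro j _ hj
      rw [map_smul, inner_smul_left, inner_smul_right, hf, if_neg hj.symm, mul_zero, mul_zero]
    · simp
  rw [h1, Complex.ofReal_re]

namespace IsPencil

variable {A N : H →L[ℂ] H} {α : ℝ}

lemma norm_sq_le_form (h : IsPencil A N α) (u : H) : ‖u‖ ^ 2 ≤ (inner ℂ u (N u)).re / α := by
  rw [le_div_iff₀ h.pos, mul_comm]
  exact h.coercive u

lemma norm_sq_le_of_form_le (h : IsPencil A N α) {ν : ℝ} {u : H}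
    (hu : (inner ℂ u (N u)).re ≤ ν * ‖A u‖ ^ 2) : ‖u‖ ^ 2 ≤ ν / α * ‖A u‖ ^ 2 := by
  refine (h.norm_sq_le_form u).trans ?_
  rw [div_mul_eq_mul_div]
  exact div_le_div_of_nonneg_right hu h.pos.le

/-- Upper bound for the perturbed form on the span of lower eigenvectors and eigenvectors. -/
lemma perturb_form_le (h : IsPencil A N α) {ν₀ ν₁ : ℝ} (hν : 0 < ν₀) (hν₁ : ν₁ < ν₀)
    {Z : H →L[ℂ] H} (hZ : Z.IsSymmetric) (hz : ‖Z‖ ≤ (ν₀ - ν₁) * α / (4 * ν₀)) {l q : H}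
    (hl : (inner ℂ l (N l)).re ≤ ν₁ * ‖A l‖ ^ 2) (hq : q ∈ genEig A N ν₀)
    (hlq : inner ℂ (A l) (A q) = 0) {t : ℝ} (ht : -(‖Z‖ * ν₀ / α) ≤ t)
    (hqt : (inner ℂ q (Z q)).re ≤ t * ‖A q‖ ^ 2) :
    (inner ℂ (l + q) ((N + Z) (l + q))).re
      ≤ (ν₀ + t + 2 * ν₀ ^ 2 / (α ^ 2 * (ν₀ - ν₁)) * ‖Z‖ ^ 2) * ‖A (l + q)‖ ^ 2 := by
  have hα := h.pos
  have hδ : 0 < ν₀ - ν₁ := sub_pos.2 hν₁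
  have e1 : (inner ℂ (l + q) ((N + Z) (l + q))).re
      = (inner ℂ (l + q) (N (l + q))).re + (inner ℂ (l + q) (Z (l + q))).re := by
    rw [_root_.add_apply, inner_add_right, Complex.add_re]
  rw [e1, re_inner_add_apply_add h.symmN, re_inner_add_apply_add hZ, h.form_eq hq l, hlq, mul_zero,
    Complex.zero_re, h.form_self hq, map_add, norm_add_sq_of_inner_eq_zero hlq]
  have b1 := (abs_le.1 (abs_re_inner_apply_le Z l q)).2
  have b2 := (abs_le.1 (abs_re_inner_apply_le Z l l)).2
  have hl2 := h.norm_sq_le_of_form_le (ν := ν₀) (hl.trans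
    (mul_le_mul_of_nonneg_right hν₁.le (sq_nonneg _)))
  have hq2 := h.norm_sq_le_of_form_le (h.form_self hq).le
  set k := ν₀ / α with hk
  have hkpos : 0 < k := by positivity
  set z := ‖Z‖ with hzdef
  have hz0 : 0 ≤ z := norm_nonneg Z
  -- The gap ν₀ - ν₁ is spent as 1/2 + 1/4 + 1/4: half on the cross term through this p, a quarter
  -- on ⟨l, Z l⟩, and a quarter on a possibly negative t.
  set p := (ν₀ - ν₁) / (2 * k) with hp
  have hppos : 0 < p := by positivity
  have b3 := two_mul_le_of_pos (z := z) (x := ‖l‖) (y := ‖q‖) hppos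
  have hzk : z * k ≤ (ν₀ - ν₁) / 4 := by
    have := mul_le_mul_of_nonneg_right hz hkpos.le
    refine this.trans (le_of_eq ?_)
    rw [hk]; field_simp
  have hpl : p * ‖l‖ ^ 2 ≤ (ν₀ - ν₁) / 2 * ‖A l‖ ^ 2 := by
    have := mul_le_mul_of_nonneg_left hl2 hppos.le
    refine this.trans (le_of_eq ?_)
    rw [hp]; field_simp
  have hzq : z ^ 2 * ‖q‖ ^ 2 / p ≤ 2 * ν₀ ^ 2 / (α ^ 2 * (ν₀ - ν₁)) * z ^ 2 * ‖A q‖ ^ 2 := by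
    have := mul_le_mul_of_nonneg_left hq2 (by positivity : 0 ≤ z ^ 2 / p)
    refine (le_of_eq (by ring)).trans (this.trans (le_of_eq ?_))
    rw [hp, hk]; field_simp
  have hzl : z * ‖l‖ * ‖l‖ ≤ (z * k) * ‖A l‖ ^ 2 := by
    have := mul_le_mul_of_nonneg_left hl2 hz0
    nlinarith
  have hC : 0 ≤ 2 * ν₀ ^ 2 / (α ^ 2 * (ν₀ - ν₁)) * z ^ 2 * ‖A l‖ ^ 2 := by positivity
  have ht' : -(z * k) ≤ t := by rw [hk]; rw [mul_div_assoc] at ht; exact ht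
  nlinarith [mul_le_mul_of_nonneg_right ht' (sq_nonneg ‖A l‖),
    mul_le_mul_of_nonneg_right hzk (sq_nonneg ‖A l‖)]

/-- Lower bound for the perturbed form on the span of eigenvectors and the upper spectral space. -/
lemma le_perturb_form (h : IsPencil A N α) {ν₀ ν₁ : ℝ} (hν : 0 < ν₀) (hν₁ : ν₀ < ν₁)
    {Z : H →L[ℂ] H} (hZ : Z.IsSymmetric)
    (hz : ‖Z‖ * (1 / α + ν₀ / (α * ν₁)) ≤ (ν₁ - ν₀) / (2 * ν₁)) {q r : H}
    (hr : ν₁ * ‖A r‖ ^ 2 ≤ (inner ℂ r (N r)).re) (hq : q ∈ genEig A N ν₀)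
    (hrq : inner ℂ (A r) (A q) = 0) {t : ℝ} (ht : t ≤ ‖Z‖ * ν₀ / α)
    (hqt : t * ‖A q‖ ^ 2 ≤ (inner ℂ q (Z q)).re) :
    (ν₀ + t - 2 * ν₁ * ν₀ / (α ^ 2 * (ν₁ - ν₀)) * ‖Z‖ ^ 2) * ‖A (r + q)‖ ^ 2
      ≤ (inner ℂ (r + q) ((N + Z) (r + q))).re := by
  have hα := h.pos
  have hδ : 0 < ν₁ - ν₀ := sub_pos.2 hν₁
  have hν₁' : 0 < ν₁ := hν.trans hν₁
  have e1 : (inner ℂ (r + q) ((N + Z) (r + q))).re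
      = (inner ℂ (r + q) (N (r + q))).re + (inner ℂ (r + q) (Z (r + q))).re := by
    rw [_root_.add_apply, inner_add_right, Complex.add_re]
  rw [e1, re_inner_add_apply_add h.symmN, re_inner_add_apply_add hZ, h.form_eq hq r, hrq, mul_zero,
    Complex.zero_re, h.form_self hq, map_add, norm_add_sq_of_inner_eq_zero hrq]
  have b1 := (abs_le.1 (abs_re_inner_apply_le Z r q)).1
  have b2 := (abs_le.1 (abs_re_inner_apply_le Z r r)).1
  have hr2 := h.norm_sq_le_form r
  have hq2 := h.norm_sq_le_of_form_le (h.form_self hq).le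
  set n := (inner ℂ r (N r)).re with hn
  set z := ‖Z‖ with hzdef
  have hz0 : 0 ≤ z := norm_nonneg Z
  -- Since ‖A r‖² ≤ n/ν₁, a fraction (ν₁ - ν₀)/ν₁ of n is free. Half pays for the cross term through
  -- this p; `hz` lets the other half pay for ⟨r, Z r⟩ and for the term of t in front of ‖A r‖².
  set p := (ν₁ - ν₀) / (2 * ν₁) * α with hp
  have hppos : 0 < p := by positivity
  have b3 := two_mul_le_of_pos (z := z) (x := ‖r‖) (y := ‖q‖) hppos
  have hn0 : 0 ≤ n := le_trans (by positivity) hr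
  have hpr : p * ‖r‖ ^ 2 ≤ (ν₁ - ν₀) / (2 * ν₁) * n := by
    have := mul_le_mul_of_nonneg_left hr2 hppos.le
    refine this.trans (le_of_eq ?_)
    rw [hp]; field_simp
  have hzq : z ^ 2 * ‖q‖ ^ 2 / p ≤ 2 * ν₁ * ν₀ / (α ^ 2 * (ν₁ - ν₀)) * z ^ 2 * ‖A q‖ ^ 2 := by
    have := mul_le_mul_of_nonneg_left hq2 (by positivity : 0 ≤ z ^ 2 / p)
    refine (le_of_eq (by ring)).trans (this.trans (le_of_eq ?_))
    rw [hp]; field_simp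
  have hzr : z * ‖r‖ * ‖r‖ ≤ z * (1 / α) * n := by
    have := mul_le_mul_of_nonneg_left hr2 hz0
    refine (le_of_eq (by ring)).trans (this.trans (le_of_eq (by ring)))
  have hr3 : ‖A r‖ ^ 2 ≤ n / ν₁ := by
    rw [le_div_iff₀ hν₁', mul_comm]; exact hr
  have h5 : (ν₀ + t) * ‖A r‖ ^ 2 ≤ ν₀ / ν₁ * n + z * (ν₀ / (α * ν₁)) * n := by
    have s1 : (ν₀ + t) * ‖A r‖ ^ 2 ≤ (ν₀ + z * ν₀ / α) * ‖A r‖ ^ 2 :=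
      mul_le_mul_of_nonneg_right (by linarith) (sq_nonneg _)
    have s2 : (ν₀ + z * ν₀ / α) * ‖A r‖ ^ 2 ≤ (ν₀ + z * ν₀ / α) * (n / ν₁) :=
      mul_le_mul_of_nonneg_left hr3 (by positivity)
    refine s1.trans (s2.trans (le_of_eq ?_))
    field_simp
  have h6 := mul_le_mul_of_nonneg_right hz hn0
  have h7 : n = ν₀ / ν₁ * n + 2 * ((ν₁ - ν₀) / (2 * ν₁) * n) := by
    field_simp
    ring
  have hC : 0 ≤ 2 * ν₁ * ν₀ / (α ^ 2 * (ν₁ - ν₀)) * z ^ 2 * ‖A r‖ ^ 2 := by positivity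
  nlinarith

/-- First-order perturbation theory for a three-fold eigenvalue of a pencil. -/
theorem perturb [CompleteSpace H] (h : IsPencil A N α) {ν₀ : ℝ} (hν : 0 < ν₀) {m : ℕ}
    (hlow : ∀ ν < ν₀, ¬ HasEigs A N (m + 1) ν) (hup : HasEigs A N (m + 3) ν₀) {e : Fin 3 → H}
    (he : Submodule.span ℂ (Set.range e) = genEig A N ν₀) :
    ∃ C z₀ : ℝ, 0 < z₀ ∧ ∀ (Z : H →L[ℂ] H) (β : ℝ), Z.IsSymmetric → ‖Z‖ ≤ z₀ →
      IsPencil A (N + Z) β → ∀ (f : Fin 3 → H) (l : Fin 3 → ℝ),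
      (∀ i, f i ∈ genEig A N ν₀) →
      (∀ i j, inner ℂ (A (f i)) (A (f j)) = if i = j then 1 else 0) →
      Submodule.span ℂ (Set.range f) = genEig A N ν₀ →
      (∀ i j, inner ℂ (f i) (Z (f j)) = if i = j then (l i : ℂ) else 0) → Antitone l →
      ∀ j : Fin 3, (0 < ν₀ + l j + C * ‖Z‖ ^ 2 →
        HasEigs A (N + Z) (m + 3 - j) (ν₀ + l j + C * ‖Z‖ ^ 2)) ∧
        ∀ ν, HasEigs A (N + Z) (m + 3 - j) ν → ν₀ + l j - C * ‖Z‖ ^ 2 ≤ ν := by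
  obtain ⟨w, hw, ⟨νm, hνm, hwm⟩, hwlow⟩ := h.exists_lower hlow hup he
  obtain ⟨νp, hνp, hgap⟩ := h.exists_gap hν
  have hα := h.pos
  have hνp' : 0 < νp := hν.trans hνp
  have hδm : 0 < ν₀ - νm := sub_pos.2 hνm
  have hδp : 0 < νp - ν₀ := sub_pos.2 hνp
  set C1 := 2 * ν₀ ^ 2 / (α ^ 2 * (ν₀ - νm)) with hC1
  set C2 := 2 * νp * ν₀ / (α ^ 2 * (νp - ν₀)) with hC2
  have hC1p : 0 ≤ C1 := by positivity
  have hC2p : 0 ≤ C2 := by positivity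
  set s := 1 / α + ν₀ / (α * νp) with hs
  have hsp : 0 < s := by positivity
  -- C1 is the error constant of the upper bound and C2 that of the lower bound; both are
  -- nonnegative, so their sum serves for both.
  refine ⟨C1 + C2, min ((ν₀ - νm) * α / (4 * ν₀)) ((νp - ν₀) / (2 * νp) / s), by positivity,
    fun Z β hZ hz hpen f l hfE hf hfs hfZ hl j => ?_⟩
  have hz1 : ‖Z‖ ≤ (ν₀ - νm) * α / (4 * ν₀) := hz.trans (min_le_left _ _)
  have hz2 : ‖Z‖ * s ≤ (νp - ν₀) / (2 * νp) := by
    rw [← le_div_iff₀ hsp]; exact hz.trans (min_le_right _ _)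
  have hlj : |l j| ≤ ‖Z‖ * ν₀ / α := by
    have h1 : (inner ℂ (f j) (Z (f j))).re = l j := by rw [hfZ, if_pos rfl, Complex.ofReal_re]
    have h2 := abs_re_inner_apply_le Z (f j) (f j)
    rw [h1] at h2
    have h3 : ‖A (f j)‖ ^ 2 = 1 := by
      rw [norm_sq_eq_re_inner (𝕜 := ℂ), hf, if_pos rfl]; simp
    have h4 := h.norm_sq_le_of_form_le (h.form_self (hfE j)).le
    rw [h3, mul_one] at h4
    have h5 := mul_le_mul_of_nonneg_left h4 (norm_nonneg Z)
    calc |l j| ≤ _ := h2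
      _ = ‖Z‖ * ‖f j‖ ^ 2 := by ring
      _ ≤ _ := h5
      _ = _ := by ring
  have hAsum : ∀ c : Fin 3 → ℂ, ‖A (∑ i, c i • f i)‖ ^ 2 = ∑ i, ‖c i‖ ^ 2 := fun c => by
    rw [map_sum]
    simp only [map_smul]
    exact norm_sum_smul_sq (f := fun i => A (f i)) hf c
  have hfli : LinearIndependent ℂ f := by
    rw [Fintype.linearIndependent_iff]
    intro c hc i
    have h1 := hAsum c
    rw [hc, map_zero, norm_zero, zero_pow two_ne_zero] at h1
    have h2 := (Finset.sum_eq_zero_iff_of_nonneg fun i _ => sq_nonneg ‖c i‖).1 h1.symm i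
      (Finset.mem_univ i)
    exact norm_eq_zero.1 (pow_eq_zero_iff two_ne_zero |>.1 h2)
  have hwE : ∀ x ∈ Submodule.span ℂ (Set.range w), ∀ y ∈ genEig A N ν₀,
      inner ℂ (A x) (A y) = 0 := by
    intro x hx y hy
    refine Submodule.span_induction (p := fun x _ => inner ℂ (A x) (A y) = 0) ?_ ?_ ?_ ?_ (hwm x hx)
    · rintro u ⟨s, hs, hu⟩
      exact h.apply_orthogonal (hs.trans_lt hνm).ne hu hy
    · simp
    · intro x y _ _ hx hy; rw [map_add, inner_add_left, hx, hy, add_zero]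
    · intro c x _ hx; rw [map_smul, inner_smul_left, hx, mul_zero]
  constructor
  · intro hpos
    -- Trial space of dimension m + 3 - j. As `l` is decreasing, the form of Z on the span of the f
    -- i with i ≥ j is at most l j.
    let F : Fin m ⊕ {i : Fin 3 // j ≤ i} → H := Sum.elim w (fun i => f i)
    have hrange : Submodule.span ℂ (Set.range fun i : {i : Fin 3 // j ≤ i} => f i)
        ≤ genEig A N ν₀ := Submodule.span_le.2 (by rintro _ ⟨i, rfl⟩; exact hfE i)
    have hF : LinearIndependent ℂ F := by
      refine LinearIndependent.sum_type hw (hfli.comp _ Subtype.val_injective) ?_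
      rw [Submodule.disjoint_def]
      intro x hx hx'
      have := hwE x hx x (hrange hx')
      rw [inner_self_eq_zero] at this
      exact h.inj (by rw [this, map_zero])
    have hcard : Fintype.card (Fin m ⊕ {i : Fin 3 // j ≤ i}) = m + 3 - j := by
      rw [Fintype.card_sum, Fintype.card_fin, Fintype.card_subtype]
      have : (Finset.univ.filter fun i : Fin 3 => j ≤ i).card = 3 - j := by
        fin_cases j <;> rfl
      rw [this]
      have := j.2
      omega
    rw [← hcard]
    refine hpen.hasEigs_of_form_le hpos hF fun u hu => ?_
    rw [Set.Sum.elim_range, Submodule.span_union] at hu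
    obtain ⟨x, hx, q, hq, rfl⟩ := Submodule.mem_sup.1 hu
    have hqE := hrange hq
    obtain ⟨c, hc⟩ := (Submodule.mem_span_range_iff_exists_fun ℂ).1 hq
    let c' : Fin 3 → ℂ := fun i => if hi : j ≤ i then c ⟨i, hi⟩ else 0
    have hc' : ∑ i, c' i • f i = q := by
      rw [← hc, ← Finset.sum_subset (Finset.subset_univ (Finset.univ.filter fun i => j ≤ i)),
        Finset.sum_subtype (p := fun i => j ≤ i) _ (by simp)]
      · exact Finset.sum_congr rfl fun i _ => by simp [c', i.2]
      · intro i _ hi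
        have hi' : ¬ j ≤ i := by simpa using hi
        simp [c', hi']
    have hqt : (inner ℂ q (Z q)).re ≤ l j * ‖A q‖ ^ 2 := by
      rw [← hc', hAsum, re_inner_sum_apply_sum hfZ, Finset.mul_sum]
      refine Finset.sum_le_sum fun i _ => ?_
      by_cases hi : j ≤ i
      · exact mul_le_mul_of_nonneg_right (hl hi) (sq_nonneg _)
      · simp [c', hi]
    refine (h.perturb_form_le hν hνm hZ hz1 (h.form_le_of_mem_span (hwm x hx)) hqE
      (hwE x hx q hqE) (abs_le.1 hlj).1 hqt).trans ?_
    refine mul_le_mul_of_nonneg_right ?_ (sq_nonneg _)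
    have : 0 ≤ C2 * ‖Z‖ ^ 2 := by positivity
    linarith
  · intro ν hνn
    -- Only m + 2 - j constraints, one fewer than the number of eigenvalues. They leave the f i with
    -- i ≤ j, where the form of Z is at least l j, and the space above the gap.
    let g : Fin m ⊕ {i : Fin 3 // j < i} → H := Sum.elim w (fun i => f i)
    have hcard : Fintype.card (Fin m ⊕ {i : Fin 3 // j < i}) < m + 3 - j := by
      rw [Fintype.card_sum, Fintype.card_fin, Fintype.card_subtype]
      have : (Finset.univ.filter fun i : Fin 3 => j < i).card = 2 - j := by
        fin_cases j <;> rfl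
      rw [this]
      have := j.2
      omega
    refine hpen.le_of_hasEigs g hcard (fun u hu => ?_) hνn
    let c : Fin 3 → ℂ := fun i => inner ℂ (A (f i)) (A u)
    set q := ∑ i, c i • f i with hq
    have hqE : q ∈ genEig A N ν₀ := Submodule.sum_mem _ fun i _ => Submodule.smul_mem _ _ (hfE i)
    set r := u - q with hr
    have hfr : ∀ i, inner ℂ (A (f i)) (A r) = 0 := by
      intro i
      rw [hr, map_sub, inner_sub_right, hq, map_sum, inner_sum, Finset.sum_eq_single i]
      · rw [map_smul, inner_smul_right, hf, if_pos rfl, mul_one, sub_self]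
      · intro k _ hk
        rw [map_smul, inner_smul_right, hf, if_neg hk.symm, mul_zero]
      · simp
    have hEr : ∀ y ∈ genEig A N ν₀, inner ℂ (A y) (A r) = 0 := by
      intro y hy
      rw [← hfs] at hy
      refine Submodule.span_induction (p := fun x _ => inner ℂ (A x) (A r) = 0) ?_ ?_ ?_ ?_ hy
      · rintro _ ⟨i, rfl⟩; exact hfr i
      · simp
      · intro x y _ _ hx hy; rw [map_add, inner_add_left, hx, hy, add_zero]
      · intro c x _ hx; rw [map_smul, inner_smul_left, hx, mul_zero]
    have hwr : ∀ x ∈ Submodule.span ℂ (Set.range w), inner ℂ (A x) (A r) = 0 := by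
      intro x hx
      have h1 : inner ℂ (A x) (A u) = 0 := by
        refine Submodule.span_induction (p := fun x _ => inner ℂ (A x) (A u) = 0) ?_ ?_ ?_ ?_ hx
        · rintro _ ⟨i, rfl⟩; exact hu (Sum.inl i)
        · simp
        · intro x y _ _ hx hy; rw [map_add, inner_add_left, hx, hy, add_zero]
        · intro c x _ hx; rw [map_smul, inner_smul_left, hx, mul_zero]
      rw [hr, map_sub, inner_sub_right, h1, hwE x hx q hqE, sub_zero]
    have hrform := hgap r fun s hs y hy => by
      rcases hs.lt_or_eq with hs | rfl
      · exact hwr y (hwlow s hs hy)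
      · exact hEr y hy
    have hqt : l j * ‖A q‖ ^ 2 ≤ (inner ℂ q (Z q)).re := by
      rw [hq, hAsum, re_inner_sum_apply_sum hfZ, Finset.mul_sum]
      refine Finset.sum_le_sum fun i _ => ?_
      by_cases hi : j < i
      · have : c i = 0 := hu (Sum.inr ⟨i, hi⟩)
        simp [this]
      · exact mul_le_mul_of_nonneg_right (hl (not_lt.1 hi)) (sq_nonneg _)
    have hrq : inner ℂ (A r) (A q) = 0 := by
      rw [← inner_conj_symm, hEr q hqE, map_zero]
    have hfin := h.le_perturb_form hν hνp hZ hz2 hrform hqE hrq (abs_le.1 hlj).2 hqt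
    rw [show r + q = u by rw [hr]; abel] at hfin
    refine le_trans (mul_le_mul_of_nonneg_right ?_ (sq_nonneg _)) hfin
    have : 0 ≤ C1 * ‖Z‖ ^ 2 := by positivity
    linarith

end IsPencil

end Perturbation

/-! ### Diagonalization on the degenerate eigenspace -/

section Diagonalization

/-- Diagonalization of a hermitian `3 × 3` matrix with ordered eigenvalues. -/
lemma exists_unitary_antitone {M : Matrix (Fin 3) (Fin 3) ℂ} (hM : M.IsHermitian) :
    ∃ (U : Matrix (Fin 3) (Fin 3) ℂ) (l : Fin 3 → ℝ), Antitone l ∧ U.conjTranspose * U = 1 ∧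
      U * U.conjTranspose = 1 ∧ U.conjTranspose * M * U = Matrix.diagonal (fun i => (l i : ℂ)) := by
  let l₀ := hM.eigenvalues
  -- Sorting the negatives in increasing order lists the eigenvalues in decreasing order.
  let σ := Tuple.sort (fun i => -l₀ i)
  let V : Matrix (Fin 3) (Fin 3) ℂ := (hM.eigenvectorUnitary : Matrix (Fin 3) (Fin 3) ℂ)
  have hV1 : V.conjTranspose * V = 1 := Unitary.coe_star_mul_self hM.eigenvectorUnitary
  have hV2 : V * V.conjTranspose = 1 := Unitary.coe_mul_star_self hM.eigenvectorUnitary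
  have hVM : V.conjTranspose * M * V = Matrix.diagonal (fun i => (l₀ i : ℂ)) := by
    have h := hM.spectral_theorem
    have h2 : M = V * Matrix.diagonal (fun i => (l₀ i : ℂ)) * V.conjTranspose := h
    conv_lhs => rw [h2]
    calc V.conjTranspose * (V * Matrix.diagonal (fun i => (l₀ i : ℂ)) * V.conjTranspose) * V
        = (V.conjTranspose * V) * Matrix.diagonal (fun i => (l₀ i : ℂ)) *
          (V.conjTranspose * V) := by simp only [Matrix.mul_assoc]
      _ = _ := by rw [hV1, Matrix.one_mul, Matrix.mul_one]
  refine ⟨V.submatrix id σ, fun i => l₀ (σ i), ?_, ?_, ?_, ?_⟩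
  · intro i j hij
    have := Tuple.monotone_sort (fun i => -l₀ i) hij
    simpa using this
  · rw [Matrix.conjTranspose_submatrix, ← Matrix.submatrix_mul _ _ _ _ _ Function.bijective_id, hV1]
    exact Matrix.submatrix_one_equiv σ
  · rw [Matrix.conjTranspose_submatrix, ← Matrix.submatrix_mul _ _ _ _ _ σ.bijective, hV2]
    exact Matrix.submatrix_id_id _
  · rw [Matrix.conjTranspose_submatrix,
      show M = M.submatrix id id from (Matrix.submatrix_id_id M).symm,
      ← Matrix.submatrix_mul _ _ _ _ _ Function.bijective_id,
      ← Matrix.submatrix_mul _ _ _ _ _ Function.bijective_id, hVM]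
    exact Matrix.submatrix_diagonal_equiv _ σ

variable {H : Type*} [NormedAddCommGroup H] [InnerProductSpace ℂ H]

lemma inner_sum_apply_sum (B : H →L[ℂ] H) (e : Fin 3 → H) (U : Matrix (Fin 3) (Fin 3) ℂ)
    (i j : Fin 3) :
    inner ℂ (∑ k, U k i • e k) (B (∑ k, U k j • e k))
      = (U.conjTranspose * (Matrix.of fun k m => inner ℂ (e k) (B (e m))) * U) i j := by
  simp only [Matrix.mul_apply, Matrix.conjTranspose_apply, Matrix.of_apply, map_sum, map_smul,
    sum_inner, inner_sum, inner_smul_left, inner_smul_right, Finset.sum_mul, Finset.mul_sum]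
  refine Finset.sum_congr rfl fun k _ => Finset.sum_congr rfl fun m _ => ?_
  rw [RCLike.star_def]
  ring

/-- The new basis is the old one rotated by a diagonalizing unitary matrix. The trace, the trace of
the square and the determinant survive the rotation; they are all that is needed to identify the
eigenvalues later. -/
lemma exists_diagonalizing_basis {A Z : H →L[ℂ] H} (hA : A.IsSymmetric) (hZ : Z.IsSymmetric)
    {e : Fin 3 → H} (he : ∀ i j, inner ℂ (A (e i)) (A (e j)) = if i = j then 1 else 0)
    {M : Matrix (Fin 3) (Fin 3) ℂ} (hM : ∀ i j, M i j = inner ℂ (e i) (Z (e j))) :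
    ∃ (f : Fin 3 → H) (l : Fin 3 → ℝ), Antitone l ∧
      Submodule.span ℂ (Set.range f) = Submodule.span ℂ (Set.range e) ∧
      (∀ i j, inner ℂ (A (f i)) (A (f j)) = if i = j then 1 else 0) ∧
      (∀ i j, inner ℂ (f i) (Z (f j)) = if i = j then (l i : ℂ) else 0) ∧
      ((l 0 : ℂ) + l 1 + l 2 = M.trace) ∧ ((l 0 : ℂ) ^ 2 + l 1 ^ 2 + l 2 ^ 2 = (M * M).trace) ∧
      ((l 0 : ℂ) * l 1 * l 2 = M.det) := by
  have hMe : M = Matrix.of fun k m => inner ℂ (e k) (Z (e m)) := by ext i j; exact hM i j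
  have hMh : M.IsHermitian := by
    ext i j
    rw [Matrix.conjTranspose_apply, hM, hM, RCLike.star_def, inner_conj_symm, hZ.apply_clm]
  obtain ⟨U, l, hl, hU1, hU2, hU3⟩ := exists_unitary_antitone hMh
  refine ⟨fun j => ∑ k, U k j • e k, l, hl, le_antisymm ?_ ?_, ?_, ?_, ?_, ?_, ?_⟩
  · refine Submodule.span_le.2 ?_
    rintro _ ⟨j, rfl⟩
    exact Submodule.sum_mem _ fun k _ => Submodule.smul_mem _ _ (Submodule.subset_span ⟨k, rfl⟩)
  · refine Submodule.span_le.2 ?_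
    rintro _ ⟨i, rfl⟩
    have : e i = ∑ j, U.conjTranspose j i • ∑ k, U k j • e k := by
      simp only [Finset.smul_sum, smul_smul]
      rw [Finset.sum_comm]
      simp only [← Finset.sum_smul]
      rw [Finset.sum_eq_single i]
      · have := congrFun (congrFun hU2 i) i
        rw [Matrix.mul_apply, Matrix.one_apply_eq] at this
        simp only [mul_comm (U.conjTranspose _ _)]
        rw [this, one_smul]
      · intro k _ hk
        have := congrFun (congrFun hU2 k) i
        rw [Matrix.mul_apply, Matrix.one_apply_ne hk] at this
        simp only [mul_comm (U.conjTranspose _ _)]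
        rw [this, zero_smul]
      · simp
    rw [this]
    exact Submodule.sum_mem _ fun k _ => Submodule.smul_mem _ _ (Submodule.subset_span ⟨k, rfl⟩)
  · intro i j
    have h1 := inner_sum_apply_sum (A * A) e U i j
    have h2 : (Matrix.of fun k m => inner ℂ (e k) ((A * A) (e m)) : Matrix (Fin 3) (Fin 3) ℂ) = 1 := by
      ext k m
      rw [Matrix.of_apply, Matrix.one_apply, ← he k m, mul_apply_eq_comp,
        hA.apply_clm]
    rw [h2, Matrix.mul_one, hU1, Matrix.one_apply, mul_apply_eq_comp,
      ← hA.apply_clm] at h1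
    exact h1
  · intro i j
    rw [inner_sum_apply_sum Z e U i j, ← hMe, hU3, Matrix.diagonal_apply]
  · have : (U.conjTranspose * M * U).trace = M.trace := by
      rw [Matrix.trace_mul_comm, ← Matrix.mul_assoc, hU2, Matrix.one_mul]
    rw [← this, hU3, Matrix.trace_diagonal, Fin.sum_univ_three]
  · have h1 : U.conjTranspose * M * U * (U.conjTranspose * M * U)
        = U.conjTranspose * (M * M) * U := by
      calc _ = U.conjTranspose * M * (U * U.conjTranspose) * M * U := by
            simp only [Matrix.mul_assoc]
        _ = _ := by rw [hU2, Matrix.mul_one]; simp only [Matrix.mul_assoc]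
    have : (U.conjTranspose * (M * M) * U).trace = (M * M).trace := by
      rw [Matrix.trace_mul_comm, ← Matrix.mul_assoc, hU2, Matrix.one_mul]
    rw [← this, ← h1, hU3, Matrix.diagonal_mul_diagonal, Matrix.trace_diagonal, Fin.sum_univ_three]
    ring
  · have : (U.conjTranspose * M * U).det = M.det := by
      rw [Matrix.det_mul, Matrix.det_mul, mul_right_comm, ← Matrix.det_mul, hU1, Matrix.det_one,
        one_mul]
    rw [← this, hU3, Matrix.det_diagonal, Fin.prod_univ_three]

end Diagonalization

/-! ### The lattice, its dual, and characters -/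

section Lattice

lemma inner_dualBasis_latticeBasis {a : ℝ} (ha : 0 < a) (l j : Fin 3) :
    inner ℝ (dualBasis a l) (latticeBasis a j) = if l = j then 2 * Real.pi else 0 := by
  have h3 : √3 ≠ 0 := by positivity
  have ha' := ha.ne'
  fin_cases l <;> fin_cases j <;>
    simp [dualBasis, latticeBasis, PiLp.inner_apply, Fin.sum_univ_three] <;>
    field_simp <;> ring

/-- The reciprocal lattice vector with integer coordinates `m`. -/
def recip (a : ℝ) (m : Fin 3 → ℤ) : E3 := ∑ j, (m j : ℝ) • dualBasis a j

/-- The point `k + G` with `G` in the reciprocal lattice. -/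
def freq (a : ℝ) (k : E3) (m : Fin 3 → ℤ) : E3 := k + recip a m

/-- The character `exp (i (k + G) ⬝ x)`. -/
def char (a : ℝ) (k : E3) (m : Fin 3 → ℤ) (x : E3) : ℂ :=
  Complex.exp (Complex.I * (inner ℝ (freq a k m) x : ℝ))

lemma recip_add (a : ℝ) (m n : Fin 3 → ℤ) : recip a (m + n) = recip a m + recip a n := by
  simp [recip, add_smul, Finset.sum_add_distrib]

lemma recip_neg (a : ℝ) (m : Fin 3 → ℤ) : recip a (-m) = -recip a m := by
  simp [recip, neg_smul]

lemma inner_recip_latticeBasis {a : ℝ} (ha : 0 < a) (m : Fin 3 → ℤ) (j : Fin 3) :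
    inner ℝ (recip a m) (latticeBasis a j) = 2 * Real.pi * m j := by
  rw [recip, sum_inner, Finset.sum_eq_single j]
  · rw [real_inner_smul_left, inner_dualBasis_latticeBasis ha, if_pos rfl, mul_comm]
  · intro i _ hi
    rw [real_inner_smul_left, inner_dualBasis_latticeBasis ha, if_neg hi, mul_zero]
  · simp

lemma exp_inner_recip {a : ℝ} (ha : 0 < a) (m : Fin 3 → ℤ) {v : E3} (hv : v ∈ lattice a) :
    Complex.exp (Complex.I * (inner ℝ (recip a m) v : ℝ)) = 1 := by
  refine Submodule.span_induction
    (p := fun v _ => Complex.exp (Complex.I * (inner ℝ (recip a m) v : ℝ)) = 1) ?_ ?_ ?_ ?_ hv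
  · rintro _ ⟨j, rfl⟩
    rw [inner_recip_latticeBasis ha, Complex.exp_eq_one_iff]
    exact ⟨m j, by push_cast; ring⟩
  · simp
  · intro x y _ _ hx hy
    rw [inner_add_right, Complex.ofReal_add, mul_add, Complex.exp_add, hx, hy, mul_one]
  · intro n x _ hx
    rw [← Int.cast_smul_eq_zsmul ℝ, inner_smul_right, Complex.ofReal_mul,
      show Complex.I * (((n : ℝ) : ℂ) * (inner ℝ (recip a m) x : ℝ))
        = (n : ℤ) * (Complex.I * (inner ℝ (recip a m) x : ℝ)) by push_cast; ring,
      Complex.exp_int_mul, hx, one_zpow]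

lemma char_pseudoPeriodic {a : ℝ} (ha : 0 < a) (k : E3) (m : Fin 3 → ℤ) :
    IsPseudoPeriodic a k (char a k m) := by
  intro x v hv
  have h := exp_inner_recip ha m hv
  simp only [char, freq]
  rw [inner_add_right, Complex.ofReal_add, mul_add, Complex.exp_add, mul_comm]
  congr 1
  rw [inner_add_left, Complex.ofReal_add, mul_add, Complex.exp_add, h, mul_one]

lemma norm_char (a : ℝ) (k : E3) (m : Fin 3 → ℤ) (x : E3) : ‖char a k m x‖ = 1 := by
  rw [char, mul_comm]
  exact Complex.norm_exp_ofReal_mul_I _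

lemma conj_char (a : ℝ) (k : E3) (m : Fin 3 → ℤ) (x : E3) :
    conj (char a k m x) = Complex.exp (-(Complex.I * (inner ℝ (freq a k m) x : ℝ))) := by
  rw [char, ← Complex.exp_conj, map_mul, Complex.conj_I, Complex.conj_ofReal, neg_mul]

lemma char_mul_char (a : ℝ) (k l : E3) (m n : Fin 3 → ℤ) (x : E3) :
    char a k m x * char a l n x = char a (k + l) (m + n) x := by
  simp only [char, freq, recip_add]
  rw [← Complex.exp_add, ← mul_add, ← Complex.ofReal_add, ← inner_add_left]
  congr 4
  abel

lemma conj_char_eq (a : ℝ) (k : E3) (m : Fin 3 → ℤ) (x : E3) :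
    conj (char a k m x) = char a (-k) (-m) x := by
  rw [conj_char, char, freq, freq, recip_neg, ← neg_add, inner_neg_left, Complex.ofReal_neg, mul_neg]

lemma conj_char_mul_self (a : ℝ) (k : E3) (m : Fin 3 → ℤ) (x : E3) :
    conj (char a k m x) * char a k m x = 1 := by
  rw [Complex.conj_mul', norm_char]; simp

lemma char_contDiff (a : ℝ) (k : E3) (m : Fin 3 → ℤ) {n : WithTop ℕ∞} :
    ContDiff ℝ n (char a k m) := by
  unfold char
  refine ContDiff.cexp (contDiff_const.mul ?_)
  exact Complex.ofRealCLM.contDiff.comp (contDiff_const.inner ℝ contDiff_id)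

lemma char_continuous (a : ℝ) (k : E3) (m : Fin 3 → ℤ) : Continuous (char a k m) :=
  (char_contDiff a k m (n := 0)).continuous

lemma hasFDerivAt_char (a : ℝ) (k : E3) (m : Fin 3 → ℤ) (x : E3) :
    HasFDerivAt (char a k m)
      ((Complex.I * char a k m x) • (Complex.ofRealCLM.comp (innerSL ℝ (freq a k m)))) x := by
  have h1 : HasFDerivAt (fun x : E3 => Complex.I * ((inner ℝ (freq a k m) x : ℝ) : ℂ))
      (Complex.I • (Complex.ofRealCLM.comp (innerSL ℝ (freq a k m)))) x :=
    (Complex.ofRealCLM.hasFDerivAt.comp x (innerSL ℝ (freq a k m)).hasFDerivAt).const_mul Complex.I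
  have h2 := h1.cexp
  rw [smul_smul, mul_comm] at h2
  exact h2

/-- The lattice basis as a basis of `ℝ³`. -/
def latBasis {a : ℝ} (ha : 0 < a) : Module.Basis (Fin 3) ℝ E3 :=
  basisOfLinearIndependentOfCardEqFinrank (b := latticeBasis a) (by
    rw [Fintype.linearIndependent_iff]
    intro g hg i
    have h : inner ℝ (dualBasis a i) (∑ j, g j • latticeBasis a j) = 0 := by
      rw [hg, inner_zero_right]
    rw [inner_sum, Finset.sum_eq_single i] at h
    · rw [inner_smul_right, inner_dualBasis_latticeBasis ha, if_pos rfl] at h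
      have := Real.pi_pos
      have h2 : (2 * Real.pi) ≠ 0 := by positivity
      exact (mul_eq_zero.1 h).resolve_right h2
    · intro j _ hj
      rw [inner_smul_right, inner_dualBasis_latticeBasis ha, if_neg hj.symm, mul_zero]
    · simp) (by simp)

lemma latBasis_apply {a : ℝ} (ha : 0 < a) (j : Fin 3) : latBasis ha j = latticeBasis a j := by
  simp [latBasis]

/-- The lattice coordinates as a linear homeomorphism. -/
def latCoord {a : ℝ} (ha : 0 < a) : (Fin 3 → ℝ) ≃L[ℝ] E3 :=
  (latBasis ha).equivFun.symm.toContinuousLinearEquiv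

lemma latCoord_apply {a : ℝ} (ha : 0 < a) (t : Fin 3 → ℝ) :
    latCoord ha t = ∑ j, t j • latticeBasis a j := by
  simp [latCoord, latBasis_apply, Module.Basis.equivFun_symm_apply]

lemma latCoord_intCast_mem {a : ℝ} (ha : 0 < a) (n : Fin 3 → ℤ) :
    latCoord ha (fun j => (n j : ℝ)) ∈ lattice a := by
  rw [latCoord_apply]
  refine Submodule.sum_mem _ fun j _ => ?_
  rw [Int.cast_smul_eq_zsmul]
  exact Submodule.smul_mem _ _ (Submodule.subset_span ⟨j, rfl⟩)

lemma cell_eq_image {a : ℝ} (ha : 0 < a) : cell a = latCoord ha '' Set.Icc 0 1 := by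
  rw [cell, parallelepiped]
  ext x
  simp [latCoord_apply]

lemma isCompact_cell {a : ℝ} (ha : 0 < a) : IsCompact (cell a) := by
  rw [cell_eq_image ha]
  exact isCompact_Icc.image (latCoord ha).continuous

/-- Uniqueness of Haar measure gives the change of variables to lattice coordinates without
computing a Jacobian. -/
lemma exists_integral_cell {a : ℝ} (ha : 0 < a) :
    ∃ c : ℝ, 0 < c ∧ ∀ f : E3 → ℂ,
      ∫ x in cell a, f x = c * ∫ t in Set.Icc (0 : Fin 3 → ℝ) 1, f (latCoord ha t) := by
  let L := latCoord ha
  have hL : MeasurableEmbedding L := L.toHomeomorph.measurableEmbedding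
  have : (Measure.map L (volume : Measure (Fin 3 → ℝ))).IsAddHaarMeasure :=
    L.isAddHaarMeasure_map volume
  let c := Measure.addHaarScalarFactor (volume : Measure E3) (Measure.map L volume)
  have hc : (volume : Measure E3) = c • Measure.map L volume :=
    Measure.isAddLeftInvariant_eq_smul _ _
  have hcpos : 0 < c := Measure.addHaarScalarFactor_pos_of_isAddHaarMeasure _ _
  refine ⟨c, by exact_mod_cast hcpos, fun f => ?_⟩
  conv_lhs => rw [hc]
  rw [Measure.restrict_smul, integral_smul_nnreal_measure, cell_eq_image ha, hL.setIntegral_map,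
    Set.preimage_image_eq _ hL.injective]
  rfl

end Lattice

/-! ### Periodic functions as functions on the torus -/

section Torus

/-- The projection of `ℝ³` onto the torus. -/
def torusMk (t : Fin 3 → ℝ) : UnitAddTorus (Fin 3) := fun i => (t i : UnitAddCircle)

lemma isOpenQuotientMap_torusMk : IsOpenQuotientMap torusMk := by
  have h : IsOpenQuotientMap (fun t : ℝ => (t : UnitAddCircle)) :=
    QuotientAddGroup.isOpenQuotientMap_mk
  exact IsOpenQuotientMap.piMap (fun _ : Fin 3 => h)

/-- The normalized Haar measure of the torus. -/
abbrev torusHaar : Measure (UnitAddTorus (Fin 3)) :=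
  Measure.pi fun _ => AddCircle.haarAddCircle

/-- The volume of the fundamental cell. -/
def cellVol (a : ℝ) : ℝ := (volume (cell a)).toReal

lemma integral_cell_eq {a : ℝ} (ha : 0 < a) :
    0 < cellVol a ∧ ∀ f : E3 → ℂ,
      ∫ x in cell a, f x = cellVol a * ∫ t in Set.Icc (0 : Fin 3 → ℝ) 1, f (latCoord ha t) := by
  obtain ⟨c, hc, h⟩ := exists_integral_cell ha
  have h1 := h (fun _ => 1)
  rw [setIntegral_const, setIntegral_const] at h1
  have h2 : volume.real (Set.Icc (0 : Fin 3 → ℝ) 1) = 1 := by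
    rw [Measure.real, Real.volume_Icc_pi]
    simp
  rw [h2] at h1
  have h3 : cellVol a = c := by
    have : ((cellVol a : ℝ) : ℂ) = c := by simpa [cellVol, Measure.real] using h1
    exact_mod_cast this
  rw [h3]
  exact ⟨hc, h⟩

lemma cellVol_pos {a : ℝ} (ha : 0 < a) : 0 < cellVol a := (integral_cell_eq ha).1

/-- `f(x + v) = f(x)` for all lattice vectors `v`. -/
def IsPeriodic (a : ℝ) (f : E3 → ℂ) : Prop := ∀ x, ∀ v ∈ lattice a, f (x + v) = f x

/-- In lattice coordinates, points with the same image on the torus differ by an integer vector,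
that is, by a lattice vector, so f descends to the quotient. -/
lemma exists_torus {a : ℝ} (ha : 0 < a) {f : E3 → ℂ} (hf : Continuous f) (hp : IsPeriodic a f) :
    ∃ g : C(UnitAddTorus (Fin 3), ℂ), ∀ t, g (torusMk t) = f (latCoord ha t) := by
  have hq := isOpenQuotientMap_torusMk.isQuotientMap
  let F : C(Fin 3 → ℝ, ℂ) := ⟨fun t => f (latCoord ha t), hf.comp (latCoord ha).continuous⟩
  have hF : Function.FactorsThrough F torusMk := by
    intro s t hst
    have h1 : ∀ i, ∃ n : ℤ, s i = t i + n := fun i => by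
      have h2 := congrFun hst i
      have h3 := (QuotientAddGroup.eq.1 h2)
      obtain ⟨n, hn⟩ := AddSubgroup.mem_zmultiples_iff.1 h3
      refine ⟨-n, ?_⟩
      simp at hn
      push_cast
      linarith
    choose n hn using h1
    have h2 : latCoord ha s = latCoord ha t + latCoord ha (fun j => (n j : ℝ)) := by
      rw [← map_add]
      congr 1
      ext i
      exact hn i
    change f (latCoord ha s) = f (latCoord ha t)
    rw [h2]
    exact hp _ _ (latCoord_intCast_mem ha n)
  let p : C(Fin 3 → ℝ, UnitAddTorus (Fin 3)) := ⟨torusMk, isOpenQuotientMap_torusMk.continuous⟩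
  have hp' : IsQuotientMap p := hq
  exact ⟨hp'.lift F hF, fun t => congrArg (fun g => g t) (hp'.lift_comp F hF)⟩

lemma integral_cell_eq_torus {a : ℝ} (ha : 0 < a) {f : E3 → ℂ} {g : UnitAddTorus (Fin 3) → ℂ}
    (h : ∀ t, g (torusMk t) = f (latCoord ha t)) :
    ∫ x in cell a, f x = cellVol a * ∫ y, g y ∂torusHaar := by
  have h0 : ∫ y, g y ∂torusHaar = _ := UnitAddTorus.integral_preimage g 0
  rw [(integral_cell_eq ha).2 f, h0]
  congr 1
  have h1 : {x : Fin 3 → ℝ | ∀ i, x i ∈ Set.Ioc ((0 : Fin 3 → ℝ) i) ((0 : Fin 3 → ℝ) i + 1)}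
      = Set.univ.pi fun i => Set.Ioc ((0 : Fin 3 → ℝ) i) ((1 : Fin 3 → ℝ) i) := by
    ext x; simp
  -- The torus integral lives on the half-open cube and the cell integral on the closed one; their
  -- difference is null.
  have h2 : (Set.univ.pi fun i => Set.Ioc ((0 : Fin 3 → ℝ) i) ((1 : Fin 3 → ℝ) i))
      =ᵐ[(volume : Measure (Fin 3 → ℝ))] Set.Icc 0 1 := Measure.univ_pi_Ioc_ae_eq_Icc
  rw [h1, setIntegral_congr_set h2]
  exact integral_congr_ae (Eventually.of_forall fun t => (h t).symm)

lemma mFourier_torusMk {a : ℝ} (ha : 0 < a) (m : Fin 3 → ℤ) (t : Fin 3 → ℝ) :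
    UnitAddTorus.mFourier m (torusMk t) = char a 0 m (latCoord ha t) := by
  rw [char, freq, zero_add, latCoord_apply, inner_sum]
  simp only [inner_smul_right, inner_recip_latticeBasis ha, UnitAddTorus.mFourier,
    ContinuousMap.coe_mk, torusMk]
  rw [Complex.ofReal_sum, Finset.mul_sum, Complex.exp_sum]
  refine Finset.prod_congr rfl fun i _ => ?_
  rw [fourier_coe_apply]
  congr 1
  push_cast
  ring

lemma integral_char {a : ℝ} (ha : 0 < a) (m : Fin 3 → ℤ) :
    ∫ x in cell a, char a 0 m x = if m = 0 then (cellVol a : ℂ) else 0 := by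
  rw [integral_cell_eq_torus ha (mFourier_torusMk ha m)]
  have h := orthonormal_iff_ite.1 (UnitAddTorus.orthonormal_mFourier (d := Fin 3)) 0 m
  simp only [ContinuousMap.inner_toLp] at h
  simp only [UnitAddTorus.mFourier_zero, ContinuousMap.one_apply, map_one, mul_one] at h
  rw [show ∫ y, UnitAddTorus.mFourier m y ∂torusHaar = _ from h]
  by_cases hm : m = 0
  · simp [hm]
  · rw [if_neg (fun hc => hm hc.symm), if_neg hm, mul_zero]

lemma IsPeriodic.bounded {a : ℝ} (ha : 0 < a) {f : E3 → ℂ} (hf : Continuous f)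
    (hp : IsPeriodic a f) : ∃ C, ∀ x, ‖f x‖ ≤ C := by
  obtain ⟨g, hg⟩ := exists_torus ha hf hp
  refine ⟨‖g‖, fun x => ?_⟩
  have h := hg ((latCoord ha).symm x)
  rw [ContinuousLinearEquiv.apply_symm_apply] at h
  rw [← h]
  exact g.norm_coe_le_norm _

/-- On the torus this is translation invariance of Haar measure. The vector v is arbitrary, not only
a lattice vector. -/
lemma integral_cell_translate {a : ℝ} (ha : 0 < a) {f : E3 → ℂ} (hf : Continuous f)
    (hp : IsPeriodic a f) (v : E3) : ∫ x in cell a, f (x + v) = ∫ x in cell a, f x := by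
  obtain ⟨g, hg⟩ := exists_torus ha hf hp
  set s := torusMk ((latCoord ha).symm v) with hs
  rw [integral_cell_eq_torus ha hg, integral_cell_eq_torus ha (g := fun y => g (y + s)),
    integral_add_right_eq_self]
  intro t
  have : torusMk t + s = torusMk (t + (latCoord ha).symm v) := by
    ext i; simp [torusMk, hs]
  rw [this, hg, map_add, ContinuousLinearEquiv.apply_symm_apply]

end Torus

/-! ### Fourier coefficients -/

section Coefficients

/-- The Fourier coefficients of a function that is pseudo-periodic with respect to `k`. -/
def coef (a : ℝ) (k : E3) (f : E3 → ℂ) (m : Fin 3 → ℤ) : ℂ :=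
  (cellVol a : ℂ)⁻¹ * ∫ x in cell a, conj (char a k m x) * f x

lemma cellVol_ne_zero {a : ℝ} (ha : 0 < a) : (cellVol a : ℂ) ≠ 0 := by
  exact_mod_cast (cellVol_pos ha).ne'

lemma integrable_cell {a : ℝ} (ha : 0 < a) {f : E3 → ℂ} (hf : Continuous f) :
    IntegrableOn f (cell a) :=
  hf.continuousOn.integrableOn_compact (isCompact_cell ha)

lemma continuous_conj_char (a : ℝ) (k : E3) (m : Fin 3 → ℤ) :
    Continuous fun x => conj (char a k m x) :=
  Complex.continuous_conj.comp (char_continuous a k m)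

lemma IsPseudoPeriodic.conj_mul {a : ℝ} {k : E3} {f g : E3 → ℂ}
    (hf : IsPseudoPeriodic a k f) (hg : IsPseudoPeriodic a k g) :
    IsPeriodic a (fun x => conj (f x) * g x) := by
  intro x v hv
  change conj (f (x + v)) * g (x + v) = conj (f x) * g x
  rw [hf x v hv, hg x v hv, map_mul, mul_mul_mul_comm, ← Complex.exp_conj, ← Complex.exp_add,
    map_mul, Complex.conj_I, Complex.conj_ofReal, neg_mul, neg_add_cancel, Complex.exp_zero, one_mul]

lemma coef_char {a : ℝ} (ha : 0 < a) (k : E3) (m n : Fin 3 → ℤ) :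
    coef a k (char a k n) m = if n = m then 1 else 0 := by
  have h : ∀ x, conj (char a k m x) * char a k n x = char a 0 (n - m) x := fun x => by
    rw [conj_char_eq, char_mul_char]
    congr 1 <;> abel
  rw [coef]
  simp only [h]
  rw [integral_char ha]
  by_cases hmn : n = m
  · simp [hmn, inv_mul_cancel₀ (cellVol_ne_zero ha)]
  · rw [if_neg (sub_ne_zero.2 hmn), if_neg hmn, mul_zero]

lemma norm_coef_le {a : ℝ} (ha : 0 < a) (k : E3) {f : E3 → ℂ} {C : ℝ} (hC : ∀ x, ‖f x‖ ≤ C)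
    (m : Fin 3 → ℤ) : ‖coef a k f m‖ ≤ C := by
  have h1 : ‖∫ x in cell a, conj (char a k m x) * f x‖ ≤ C * cellVol a := by
    refine norm_setIntegral_le_of_norm_le_const (isCompact_cell ha).measure_lt_top fun x _ => ?_
    rw [norm_mul, RCLike.norm_conj, norm_char, one_mul]
    exact hC x
  have hv := cellVol_pos ha
  rw [coef, norm_mul, norm_inv, Complex.norm_real, Real.norm_of_nonneg hv.le, inv_mul_le_iff₀ hv,
    mul_comm]
  exact h1

lemma coef_add {a : ℝ} (ha : 0 < a) (k : E3) {f g : E3 → ℂ} (hf : Continuous f)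
    (hg : Continuous g) (m : Fin 3 → ℤ) :
    coef a k (fun x => f x + g x) m = coef a k f m + coef a k g m := by
  rw [coef, coef, coef, ← mul_add, ← integral_add]
  · simp only [mul_add]
  · exact integrable_cell ha ((continuous_conj_char a k m).mul hf)
  · exact integrable_cell ha ((continuous_conj_char a k m).mul hg)

lemma coef_const_mul (a : ℝ) (k : E3) (f : E3 → ℂ) (c : ℂ) (m : Fin 3 → ℤ) :
    coef a k (fun x => c * f x) m = c * coef a k f m := by
  rw [coef, coef, mul_left_comm c]
  congr 1
  rw [← integral_const_mul]
  exact integral_congr_ae (Eventually.of_forall fun x =>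
    mul_left_comm (conj (char a k m x)) c (f x))

/-- A continuous pseudo-periodic function with summable Fourier coefficients is the sum of its
Fourier series. -/
lemma hasSum_coef {a : ℝ} (ha : 0 < a) {k : E3} {f : E3 → ℂ} (hf : Continuous f)
    (hp : IsPseudoPeriodic a k f) (hs : Summable (coef a k f)) (x : E3) :
    HasSum (fun m => coef a k f m * char a k m x) (f x) := by
  -- Multiplication by the conjugate of the character with m = 0 turns a pseudo-periodic function
  -- into a periodic one with the same coefficients.
  obtain ⟨g, hg⟩ := exists_torus ha (f := fun x => conj (char a k 0 x) * f x) ((continuous_conj_char a k 0).mul hf)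
    ((char_pseudoPeriodic ha k 0).conj_mul hp)
  have hcoef : ∀ m, UnitAddTorus.mFourierCoeff g m = coef a k f m := by
    intro m
    have h1 : ∫ x in cell a, conj (char a k m x) * f x = cellVol a * ∫ y,
        UnitAddTorus.mFourier (-m) y * g y ∂torusHaar := by
      refine integral_cell_eq_torus ha fun t => ?_
      rw [mFourier_torusMk ha, hg, ← mul_assoc, conj_char_eq, char_mul_char, conj_char_eq]
      congr 2 <;> simp
    rw [coef, h1, inv_mul_cancel_left₀ (cellVol_ne_zero ha)]
    rfl
  have hs' : Summable (UnitAddTorus.mFourierCoeff g) := by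
    refine hs.congr fun m => (hcoef m).symm
  have h2 := UnitAddTorus.hasSum_mFourier_series_apply_of_summable hs'
    (torusMk ((latCoord ha).symm x))
  rw [hg, ContinuousLinearEquiv.apply_symm_apply] at h2
  have h3 := h2.mul_left (char a k 0 x)
  have h4 : char a k 0 x * (conj (char a k 0 x) * f x) = f x := by
    rw [← mul_assoc, mul_comm (char a k 0 x), conj_char_mul_self, one_mul]
  rw [h4] at h3
  refine h3.congr_fun ?_
  intro m
  rw [hcoef, mFourier_torusMk ha, ContinuousLinearEquiv.apply_symm_apply, smul_eq_mul,
    mul_left_comm, char_mul_char, add_zero, zero_add]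

/-- The integral of f(x + t v) over the cell does not depend on t; differentiating under the
integral at t = 0 gives the claim with no boundary terms. -/
lemma integral_fderiv_eq_zero {a : ℝ} (ha : 0 < a) {f : E3 → ℂ} (hf : ContDiff ℝ 1 f)
    (hp : IsPeriodic a f) (v : E3) : ∫ x in cell a, fderiv ℝ f x v = 0 := by
  have hper : IsPeriodic a (fun x => fderiv ℝ f x v) := by
    intro x w hw
    have h1 : fderiv ℝ (fun y => f (y + w)) x = fderiv ℝ f (x + w) := fderiv_comp_add_right w
    have h2 : (fun y => f (y + w)) = f := funext fun y => hp y w hw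
    rw [h2] at h1
    change fderiv ℝ f (x + w) v = fderiv ℝ f x v
    rw [h1]
  have hcont : Continuous (fun x => fderiv ℝ f x v) :=
    (hf.continuous_fderiv one_ne_zero).clm_apply continuous_const
  obtain ⟨C, hC⟩ := hper.bounded ha hcont
  have hderiv : ∀ (x : E3) (t : ℝ), HasDerivAt (fun t : ℝ => f (x + t • v))
      (fderiv ℝ f (x + t • v) v) t := by
    intro x t
    have h1 : HasDerivAt (fun t : ℝ => x + t • v) v t := by
      simpa using ((hasDerivAt_id t).smul_const v).const_add x
    exact ((hf.differentiable one_ne_zero _).hasFDerivAt.comp_hasDerivAt t h1)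
  have : IsFiniteMeasure (volume.restrict (cell a)) :=
    ⟨by rw [Measure.restrict_apply_univ]; exact (isCompact_cell ha).measure_lt_top⟩
  have key := hasDerivAt_integral_of_dominated_loc_of_deriv_le (μ := volume.restrict (cell a))
    (F := fun (t : ℝ) x => f (x + t • v)) (F' := fun t x => fderiv ℝ f (x + t • v) v)
    (x₀ := 0) (s := Set.univ) (bound := fun _ => C) univ_mem
    (Eventually.of_forall fun t =>
      (hf.continuous.comp (continuous_id.add continuous_const)).aestronglyMeasurable)
    (integrable_cell ha (hf.continuous.comp (continuous_id.add continuous_const)))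
    (hcont.comp (continuous_id.add continuous_const)).aestronglyMeasurable
    (Eventually.of_forall fun x t _ => hC _) (integrable_const C)
    (Eventually.of_forall fun x t _ => hderiv x t)
  have h2 := key.2
  have h3 : (fun t : ℝ => ∫ x in cell a, f (x + t • v)) = fun _ => ∫ x in cell a, f x :=
    funext fun t => integral_cell_translate ha hf.continuous hp _
  rw [h3] at h2
  have h4 := h2.unique (hasDerivAt_const _ _)
  simpa using h4

lemma IsPseudoPeriodic.fderiv {a : ℝ} {k : E3} {f : E3 → ℂ} (hp : IsPseudoPeriodic a k f)
    (v : E3) : IsPseudoPeriodic a k (fun x => fderiv ℝ f x v) := by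
  intro x w hw
  have h1 : _root_.fderiv ℝ (fun y => f (y + w)) x = _root_.fderiv ℝ f (x + w) :=
    fderiv_comp_add_right w
  have h2 : (fun y => f (y + w)) = Complex.exp (Complex.I * (inner ℝ k w : ℝ)) • f :=
    funext fun y => hp y w hw
  rw [h2, fderiv_const_smul_field] at h1
  change _root_.fderiv ℝ f (x + w) v = _
  rw [← h1]
  rfl

/-- Integration by parts: the product of f with a conjugate character of the same quasi-momentum is
periodic, so its derivative integrates to zero. -/
lemma coef_fderiv {a : ℝ} (ha : 0 < a) {k : E3} {f : E3 → ℂ} (hf : ContDiff ℝ 1 f)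
    (hp : IsPseudoPeriodic a k f) (v : E3) (m : Fin 3 → ℤ) :
    coef a k (fun x => fderiv ℝ f x v) m
      = Complex.I * (inner ℝ (freq a k m) v : ℝ) * coef a k f m := by
  have hg : ContDiff ℝ 1 fun x => conj (char a k m x) * f x :=
    (Complex.conjCLE.contDiff.comp (char_contDiff a k m)).mul hf
  have h1 := integral_fderiv_eq_zero ha hg ((char_pseudoPeriodic ha k m).conj_mul hp) v
  have h2 : ∀ x, fderiv ℝ (fun x => conj (char a k m x) * f x) x v
      = conj (char a k m x) * fderiv ℝ f x v
        - Complex.I * (inner ℝ (freq a k m) v : ℝ) * (conj (char a k m x) * f x) := by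
    intro x
    have e1 : HasFDerivAt (fun x => conj (char a k m x)) _ x :=
      Complex.conjCLE.hasFDerivAt.comp x (hasFDerivAt_char a k m x)
    have e2 := (e1.fun_mul (hf.differentiable one_ne_zero x).hasFDerivAt).fderiv
    rw [e2]
    simp
    ring
  simp only [h2] at h1
  rw [integral_sub, integral_const_mul, sub_eq_zero] at h1
  · rw [coef, coef, h1]
    ring
  · exact integrable_cell ha ((continuous_conj_char a k m).mul
      ((hf.continuous_fderiv one_ne_zero).clm_apply continuous_const))
  · exact (integrable_cell ha ((continuous_conj_char a k m).mul hf.continuous)).const_mul _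

end Coefficients

/-! ### Rapid decay and elliptic regularity -/

section Decay

/-- The weight `1 + |G|²`. -/
def weight (a : ℝ) (m : Fin 3 → ℤ) : ℝ := 1 + ‖recip a m‖ ^ 2

lemma one_le_weight (a : ℝ) (m : Fin 3 → ℤ) : 1 ≤ weight a m := by
  unfold weight; nlinarith [sq_nonneg ‖recip a m‖]

lemma weight_pos (a : ℝ) (m : Fin 3 → ℤ) : 0 < weight a m := lt_of_lt_of_le one_pos (one_le_weight a m)

/-- Peetre's inequality. It lets weights pass through convolutions and compares the weights of G and
k + G. -/
lemma one_add_norm_add_sq_le (x y : E3) :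
    1 + ‖x + y‖ ^ 2 ≤ 2 * (1 + ‖x‖ ^ 2) * (1 + ‖y‖ ^ 2) := by
  have h1 := norm_add_le x y
  have h2 : ‖x + y‖ ^ 2 ≤ (‖x‖ + ‖y‖) ^ 2 := pow_le_pow_left₀ (norm_nonneg _) h1 2
  nlinarith [sq_nonneg (‖x‖ - ‖y‖), mul_nonneg (sq_nonneg ‖x‖) (sq_nonneg ‖y‖)]

lemma weight_le (a : ℝ) (m g : Fin 3 → ℤ) : weight a m ≤ 2 * weight a g * weight a (m - g) := by
  have h := one_add_norm_add_sq_le (recip a g) (recip a (m - g))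
  rw [← recip_add, add_sub_cancel] at h
  exact h

lemma weight_le_freq (a : ℝ) (k : E3) (m : Fin 3 → ℤ) :
    weight a m ≤ 2 * (1 + ‖k‖ ^ 2) * (1 + ‖freq a k m‖ ^ 2) := by
  have h := one_add_norm_add_sq_le (-k) (freq a k m)
  rw [freq, neg_add_cancel_left, norm_neg] at h
  exact h

lemma freq_le_weight (a : ℝ) (k : E3) (m : Fin 3 → ℤ) :
    1 + ‖freq a k m‖ ^ 2 ≤ 2 * (1 + ‖k‖ ^ 2) * weight a m :=
  one_add_norm_add_sq_le k (recip a m)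

/-- The integer coordinates are recovered by pairing with the lattice basis. -/
lemma exists_norm_le_recip {a : ℝ} (ha : 0 < a) :
    ∃ C, 0 < C ∧ ∀ m : Fin 3 → ℤ, ‖(fun j => (m j : ℝ))‖ ≤ C * ‖recip a m‖ := by
  refine ⟨(∑ j, ‖latticeBasis a j‖) / (2 * Real.pi) + 1, ?_, fun m => ?_⟩
  · have := Real.pi_pos
    have : 0 ≤ ∑ j, ‖latticeBasis a j‖ := Finset.sum_nonneg fun _ _ => norm_nonneg _
    positivity
  · have hpi := Real.pi_pos
    rw [pi_norm_le_iff_of_nonneg (by positivity)]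
    intro j
    have h1 := abs_real_inner_le_norm (recip a m) (latticeBasis a j)
    rw [inner_recip_latticeBasis ha, abs_mul, abs_of_pos (by positivity : 0 < 2 * Real.pi)] at h1
    have h2 : ‖latticeBasis a j‖ ≤ ∑ j, ‖latticeBasis a j‖ :=
      Finset.single_le_sum (f := fun j => ‖latticeBasis a j‖) (fun _ _ => norm_nonneg _)
        (Finset.mem_univ j)
    rw [Real.norm_eq_abs]
    have h3 : |(m j : ℝ)| ≤ ‖recip a m‖ * (∑ j, ‖latticeBasis a j‖) / (2 * Real.pi) := by
      rw [le_div_iff₀ (by positivity), mul_comm]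
      exact h1.trans (mul_le_mul_of_nonneg_left h2 (norm_nonneg _))
    refine h3.trans ?_
    rw [add_mul, one_mul, div_mul_eq_mul_div, mul_comm]
    linarith [norm_nonneg (recip a m)]

lemma intCast_mem_span (m : Fin 3 → ℤ) :
    (fun j => (m j : ℝ)) ∈ Submodule.span ℤ (Set.range (Pi.basisFun ℝ (Fin 3))) := by
  have : (fun j => (m j : ℝ)) = ∑ j, m j • Pi.basisFun ℝ (Fin 3) j := by
    ext i
    simp [Pi.single_apply]
  rw [this]
  exact Submodule.sum_mem _ fun j _ => Submodule.smul_mem _ _ (Submodule.subset_span ⟨j, rfl⟩)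

lemma summable_norm_intCast_inv :
    Summable fun m : Fin 3 → ℤ => ‖(fun j => (m j : ℝ))‖⁻¹ ^ 4 := by
  have hfr : Module.finrank ℤ (Submodule.span ℤ (Set.range (Pi.basisFun ℝ (Fin 3)))) = 3 := by
    rw [Module.finrank_eq_card_basis ((Pi.basisFun ℝ (Fin 3)).restrictScalars ℤ)]
    simp
  have h := ZLattice.summable_norm_pow_inv
    (Submodule.span ℤ (Set.range (Pi.basisFun ℝ (Fin 3)))) 4 (by rw [hfr]; norm_num)
  have hφ : Function.Injective fun m : Fin 3 → ℤ =>
      (⟨_, intCast_mem_span m⟩ : Submodule.span ℤ (Set.range (Pi.basisFun ℝ (Fin 3)))) := by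
    intro m n hmn
    have h1 := congrArg Subtype.val hmn
    ext i
    have h2 : (m i : ℝ) = n i := congrFun h1 i
    exact_mod_cast h2
  exact (h.comp_injective hφ :)

/-- The terms are O(|m|⁻⁴), and 4 exceeds the rank 3 of the lattice. The bound fails only at m = 0,
where the right side is zero by convention. -/
lemma summable_weight {a : ℝ} (ha : 0 < a) : Summable fun m => (weight a m)⁻¹ ^ 2 := by
  obtain ⟨C, hC, h⟩ := exists_norm_le_recip ha
  refine Summable.of_norm_bounded_eventually (summable_norm_intCast_inv.mul_left (C ^ 4)) ?_
  refine (Set.finite_singleton (0 : Fin 3 → ℤ)).subset fun m hm => ?_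
  by_contra hm0
  apply hm
  change ‖(weight a m)⁻¹ ^ 2‖ ≤ C ^ 4 * ‖(fun j => (m j : ℝ))‖⁻¹ ^ 4
  have hpos : 0 < ‖(fun j => (m j : ℝ))‖ := by
    rw [norm_pos_iff]
    intro hc
    apply hm0
    ext i
    have := congrFun hc i
    simpa using this
  have hw := weight_pos a m
  rw [Real.norm_of_nonneg (by positivity), inv_pow, inv_pow, ← div_eq_mul_inv,
    inv_le_comm₀ (by positivity) (by positivity), inv_div]
  have h1 : ‖(fun j => (m j : ℝ))‖ ^ 4 ≤ (C * ‖recip a m‖) ^ 4 :=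
    pow_le_pow_left₀ (norm_nonneg _) (h m) 4
  rw [div_le_iff₀ (by positivity)]
  refine h1.trans ?_
  have h2 : ‖recip a m‖ ^ 4 ≤ weight a m ^ 2 := by
    unfold weight; nlinarith [sq_nonneg ‖recip a m‖]
  rw [mul_pow, mul_comm]
  exact mul_le_mul_of_nonneg_right h2 (by positivity)

/-- Rapidly decreasing sequences. -/
def Decay (a : ℝ) (c : (Fin 3 → ℤ) → ℂ) : Prop :=
  ∀ n : ℕ, ∃ C, ∀ m, weight a m ^ n * ‖c m‖ ≤ C

lemma summable_of_weight_le {a : ℝ} (ha : 0 < a) {c : (Fin 3 → ℤ) → ℂ} {C : ℝ}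
    (h : ∀ m, weight a m ^ 2 * ‖c m‖ ≤ C) : Summable fun m => ‖c m‖ := by
  refine Summable.of_nonneg_of_le (fun _ => norm_nonneg _) (fun m => ?_)
    ((summable_weight ha).mul_left C)
  have hw := weight_pos a m
  rw [inv_pow, ← div_eq_mul_inv, le_div_iff₀ (by positivity), mul_comm]
  exact h m

lemma Decay.summable_norm {a : ℝ} (ha : 0 < a) {c : (Fin 3 → ℤ) → ℂ} (hc : Decay a c) :
    Summable fun m => ‖c m‖ := by
  obtain ⟨C, hC⟩ := hc 2
  exact summable_of_weight_le ha hC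

lemma Decay.summable {a : ℝ} (ha : 0 < a) {c : (Fin 3 → ℤ) → ℂ} (hc : Decay a c) : Summable c :=
  (hc.summable_norm ha).of_norm

/-- A multiplier of order at most two in the frequency costs one power of the weight. -/
lemma Decay.mul_of_le {a : ℝ} {c p : (Fin 3 → ℤ) → ℂ} (hc : Decay a c) {B : ℝ}
    (hp : ∀ m, ‖p m‖ ≤ B * weight a m) : Decay a (fun m => p m * c m) := by
  intro n
  obtain ⟨C, hC⟩ := hc (n + 1)
  have hB : 0 ≤ B := by
    have h1 := (norm_nonneg _).trans (hp 0)
    exact nonneg_of_mul_nonneg_left h1 (weight_pos a 0)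
  refine ⟨B * C, fun m => ?_⟩
  have hw := weight_pos a m
  rw [norm_mul]
  calc weight a m ^ n * (‖p m‖ * ‖c m‖) ≤ weight a m ^ n * (B * weight a m * ‖c m‖) := by
        gcongr; exact hp m
    _ = B * (weight a m ^ (n + 1) * ‖c m‖) := by ring
    _ ≤ B * C := mul_le_mul_of_nonneg_left (hC m) hB

lemma Decay.add {a : ℝ} {c d : (Fin 3 → ℤ) → ℂ} (hc : Decay a c) (hd : Decay a d) :
    Decay a (fun m => c m + d m) := by
  intro n
  obtain ⟨C, hC⟩ := hc n
  obtain ⟨D, hD⟩ := hd n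
  refine ⟨C + D, fun m => ?_⟩
  have hw := weight_pos a m
  calc weight a m ^ n * ‖c m + d m‖ ≤ weight a m ^ n * (‖c m‖ + ‖d m‖) := by
        gcongr; exact norm_add_le _ _
    _ = weight a m ^ n * ‖c m‖ + weight a m ^ n * ‖d m‖ := by ring
    _ ≤ C + D := add_le_add (hC m) (hD m)

lemma Decay.const_mul {a : ℝ} {c : (Fin 3 → ℤ) → ℂ} (hc : Decay a c) (z : ℂ) :
    Decay a (fun m => z * c m) :=
  hc.mul_of_le (B := ‖z‖) fun m => by
    nlinarith [one_le_weight a m, norm_nonneg z]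

/-- The coordinates of the frequencies are dominated by the weight. -/
lemma exists_inner_freq_le (a : ℝ) (k v : E3) :
    ∃ B, ∀ m, ‖(Complex.I * (inner ℝ (freq a k m) v : ℝ) : ℂ)‖ ≤ B * weight a m := by
  refine ⟨2 * (1 + ‖k‖ ^ 2) * ‖v‖, fun m => ?_⟩
  rw [norm_mul, Complex.norm_I, one_mul, Complex.norm_real, Real.norm_eq_abs]
  refine (abs_real_inner_le_norm _ _).trans ?_
  have h := freq_le_weight a k m
  have h2 : ‖freq a k m‖ ≤ 2 * (1 + ‖k‖ ^ 2) * weight a m := by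
    nlinarith [sq_nonneg (‖freq a k m‖ - 1)]
  nlinarith [mul_le_mul_of_nonneg_right h2 (norm_nonneg v)]

/-- Convolution of sequences. -/
def conv (V c : (Fin 3 → ℤ) → ℂ) (m : Fin 3 → ℤ) : ℂ := ∑' g, V g * c (m - g)

/-- Convolution with a rapidly decreasing sequence preserves polynomial decay. -/
lemma conv_weight_le {a : ℝ} (ha : 0 < a) {V : (Fin 3 → ℤ) → ℂ} (hV : Decay a V) {n : ℕ} {C : ℝ}
    {c : (Fin 3 → ℤ) → ℂ} (hc : ∀ m, weight a m ^ n * ‖c m‖ ≤ C) :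
    ∃ D, ∀ m, weight a m ^ n * ‖conv V c m‖ ≤ D := by
  have hV' : Decay a (fun m => ((2 * weight a m : ℝ) : ℂ) ^ n * V m) := by
    intro l
    obtain ⟨K, hK⟩ := hV (l + n)
    refine ⟨2 ^ n * K, fun m => ?_⟩
    have hw := weight_pos a m
    rw [norm_mul, norm_pow, Complex.norm_real, Real.norm_of_nonneg (by positivity)]
    calc weight a m ^ l * ((2 * weight a m) ^ n * ‖V m‖)
        = 2 ^ n * (weight a m ^ (l + n) * ‖V m‖) := by ring
      _ ≤ _ := mul_le_mul_of_nonneg_left (hK m) (by positivity)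
  have hsum := (hV'.summable_norm ha).mul_right C
  refine ⟨∑' g, ‖((2 * weight a g : ℝ) : ℂ) ^ n * V g‖ * C, fun m => ?_⟩
  have hw := weight_pos a m
  have hterm : ∀ g, ‖((weight a m ^ n : ℝ) : ℂ) * (V g * c (m - g))‖
      ≤ ‖((2 * weight a g : ℝ) : ℂ) ^ n * V g‖ * C := by
    intro g
    have hg := weight_pos a g
    have hmg := weight_pos a (m - g)
    rw [norm_mul, norm_mul, norm_mul, norm_pow, Complex.norm_real, Complex.norm_real,
      Real.norm_of_nonneg (by positivity), Real.norm_of_nonneg (by positivity)]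
    calc weight a m ^ n * (‖V g‖ * ‖c (m - g)‖)
        ≤ (2 * weight a g * weight a (m - g)) ^ n * (‖V g‖ * ‖c (m - g)‖) := by
          gcongr; exact weight_le a m g
      _ = (2 * weight a g) ^ n * ‖V g‖ * (weight a (m - g) ^ n * ‖c (m - g)‖) := by ring
      _ ≤ _ := mul_le_mul_of_nonneg_left (hc _) (by positivity)
  have h1 : weight a m ^ n * ‖conv V c m‖ = ‖∑' g, ((weight a m ^ n : ℝ) : ℂ) * (V g * c (m - g))‖ := by
    rw [tsum_mul_left, norm_mul, Complex.norm_real, Real.norm_of_nonneg (by positivity)]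
    rfl
  rw [h1]
  exact tsum_of_norm_bounded hsum.hasSum hterm

/-- Elliptic regularity for the Fourier coefficients of an eigenfunction. -/
lemma decay_of_eigen {a : ℝ} (ha : 0 < a) {V : (Fin 3 → ℤ) → ℂ} (hV : Decay a V) {k : E3} {μ : ℝ}
    {c : (Fin 3 → ℤ) → ℂ} {B : ℝ} (hB : ∀ m, ‖c m‖ ≤ B)
    (hc : ∀ m, ((‖freq a k m‖ ^ 2 : ℝ) : ℂ) * c m + WeylPoint.conv V c m = μ * c m) :
    Decay a c := by
  intro n
  induction n with
  | zero => exact ⟨B, fun m => by simpa using hB m⟩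
  | succ n ih =>
    obtain ⟨C, hC⟩ := ih
    obtain ⟨D, hD⟩ := conv_weight_le ha hV hC
    refine ⟨2 * (1 + ‖k‖ ^ 2) * ((1 + |μ|) * C + D), fun m => ?_⟩
    have hw := weight_pos a m
    -- Bootstrap: the right side decays as fast as c already does, since convolution preserves the
    -- rate, while the factor on the left gains one power of the weight.
    have h1 : ((1 + ‖freq a k m‖ ^ 2 : ℝ) : ℂ) * c m = (1 + μ : ℂ) * c m - WeylPoint.conv V c m := by
      have := hc m
      push_cast at this ⊢
      linear_combination this
    have h2 : (1 + ‖freq a k m‖ ^ 2) * ‖c m‖ ≤ (1 + |μ|) * ‖c m‖ + ‖WeylPoint.conv V c m‖ := by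
      have h3 := congrArg norm h1
      rw [norm_mul, Complex.norm_real, Real.norm_of_nonneg (by positivity)] at h3
      rw [h3]
      refine (norm_sub_le _ _).trans ?_
      rw [norm_mul]
      gcongr
      refine (norm_add_le _ _).trans ?_
      simp
    have h3 := weight_le_freq a k m
    calc weight a m ^ (n + 1) * ‖c m‖ = weight a m ^ n * (weight a m * ‖c m‖) := by ring
      _ ≤ weight a m ^ n * (2 * (1 + ‖k‖ ^ 2) * (1 + ‖freq a k m‖ ^ 2) * ‖c m‖) := by gcongr
      _ = 2 * (1 + ‖k‖ ^ 2) * (weight a m ^ n * ((1 + ‖freq a k m‖ ^ 2) * ‖c m‖)) := by ring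
      _ ≤ 2 * (1 + ‖k‖ ^ 2) * (weight a m ^ n *
          ((1 + |μ|) * ‖c m‖ + ‖WeylPoint.conv V c m‖)) := by gcongr
      _ = 2 * (1 + ‖k‖ ^ 2) * ((1 + |μ|) * (weight a m ^ n * ‖c m‖)
          + weight a m ^ n * ‖WeylPoint.conv V c m‖) := by ring
      _ ≤ _ := by
        gcongr
        · exact hC m
        · exact hD m

end Decay

/-! ### Fourier series -/

section Synthesis

/-- The Fourier series with coefficients `c`. -/
def synth (a : ℝ) (k : E3) (c : (Fin 3 → ℤ) → ℂ) (x : E3) : ℂ := ∑' m, c m * char a k m x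

lemma summable_synth {a : ℝ} {k : E3} {c : (Fin 3 → ℤ) → ℂ} (hc : Summable fun m => ‖c m‖) (x : E3) :
    Summable fun m => c m * char a k m x := by
  refine Summable.of_norm ?_
  simpa only [norm_mul, norm_char, mul_one] using hc

lemma synth_pseudoPeriodic {a : ℝ} (ha : 0 < a) (k : E3) (c : (Fin 3 → ℤ) → ℂ) :
    IsPseudoPeriodic a k (synth a k c) := by
  intro x v hv
  rw [synth, synth, ← tsum_mul_left]
  refine tsum_congr fun m => ?_
  rw [char_pseudoPeriodic ha k m x v hv]
  ring

lemma norm_clm_char_le (a : ℝ) (k : E3) (m : Fin 3 → ℤ) (z : ℂ) (x : E3) :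
    ‖z • ((Complex.I * char a k m x) • (Complex.ofRealCLM.comp (innerSL ℝ (freq a k m))))‖
      ≤ ‖z‖ * ‖freq a k m‖ := by
  rw [norm_smul, norm_smul, norm_mul, Complex.norm_I, norm_char, one_mul, one_mul]
  refine mul_le_mul_of_nonneg_left ?_ (norm_nonneg z)
  refine (ContinuousLinearMap.opNorm_comp_le _ _).trans ?_
  rw [Complex.ofRealCLM_norm, one_mul, innerSL_apply_norm]

lemma Decay.summable_freq {a : ℝ} (ha : 0 < a) (k : E3) {c : (Fin 3 → ℤ) → ℂ} (hc : Decay a c) :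
    Summable fun m => ‖c m‖ * ‖freq a k m‖ := by
  have h : Decay a (fun m => (‖freq a k m‖ : ℂ) * c m) := by
    refine hc.mul_of_le (B := 2 * (1 + ‖k‖ ^ 2)) fun m => ?_
    rw [Complex.norm_real, norm_norm]
    nlinarith [freq_le_weight a k m, sq_nonneg (‖freq a k m‖ - 1)]
  refine (h.summable_norm ha).congr fun m => ?_
  rw [norm_mul, Complex.norm_real, norm_norm, mul_comm]

lemma hasFDerivAt_synth {a : ℝ} (ha : 0 < a) (k : E3) {c : (Fin 3 → ℤ) → ℂ} (hc : Decay a c)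
    (x : E3) : HasFDerivAt (synth a k c) (∑' m, c m •
      ((Complex.I * char a k m x) • (Complex.ofRealCLM.comp (innerSL ℝ (freq a k m))))) x :=
  hasFDerivAt_tsum (hc.summable_freq ha k)
    (fun m x => (hasFDerivAt_char a k m x).const_mul (c m))
    (fun m x => norm_clm_char_le a k m (c m) x) (summable_synth (hc.summable_norm ha) 0) x

lemma fderiv_synth {a : ℝ} (ha : 0 < a) (k : E3) {c : (Fin 3 → ℤ) → ℂ} (hc : Decay a c)
    (x v : E3) : fderiv ℝ (synth a k c) x v
      = synth a k (fun m => Complex.I * (inner ℝ (freq a k m) v : ℝ) * c m) x := by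
  rw [(hasFDerivAt_synth ha k hc x).fderiv]
  have hs : Summable fun m => c m •
      ((Complex.I * char a k m x) • (Complex.ofRealCLM.comp (innerSL ℝ (freq a k m)))) :=
    Summable.of_norm_bounded (hc.summable_freq ha k) fun m => norm_clm_char_le a k m (c m) x
  have h := (ContinuousLinearMap.apply ℝ ℂ v).map_tsum hs
  rw [ContinuousLinearMap.apply_apply] at h
  rw [h, synth]
  refine tsum_congr fun m => ?_
  simp
  ring

lemma Decay.fderiv {a : ℝ} {c : (Fin 3 → ℤ) → ℂ} (hc : Decay a c) (k v : E3) :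
    Decay a (fun m => Complex.I * (inner ℝ (freq a k m) v : ℝ) * c m) := by
  obtain ⟨B, hB⟩ := exists_inner_freq_le a k v
  exact hc.mul_of_le hB

/-- Directional derivatives of such a series are series of the same kind with rapidly decreasing
coefficients, so induction applies. -/
lemma contDiff_synth {a : ℝ} (ha : 0 < a) (k : E3) {c : (Fin 3 → ℤ) → ℂ} (hc : Decay a c) (n : ℕ) :
    ContDiff ℝ n (synth a k c) := by
  have hd : ∀ {c : (Fin 3 → ℤ) → ℂ}, Decay a c → Differentiable ℝ (synth a k c) :=
    fun hc x => (hasFDerivAt_synth ha k hc x).differentiableAt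
  induction n generalizing c with
  | zero => exact contDiff_zero.2 (hd hc).continuous
  | succ n ih =>
    have := (contDiff_succ_iff_fderiv_apply (𝕜 := ℝ) (n := n) (f := synth a k c)).2
      ⟨hd hc, fun h => by simp at h, fun v => by
        simp only [fderiv_synth ha k hc]
        exact ih (hc.fderiv k v)⟩
    exact_mod_cast this

lemma continuous_synth {a : ℝ} (ha : 0 < a) (k : E3) {c : (Fin 3 → ℤ) → ℂ} (hc : Decay a c) :
    Continuous (synth a k c) := (contDiff_synth ha k hc 0).continuous

lemma hasSum_integral_mul_synth {a : ℝ} (ha : 0 < a) (k : E3) {c : (Fin 3 → ℤ) → ℂ}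
    (hc : Summable fun m => ‖c m‖) {h : E3 → ℂ} (hh : Continuous h) :
    HasSum (fun m => c m * ∫ x in cell a, h x * char a k m x)
      (∫ x in cell a, h x * synth a k c x) := by
  have key := hasSum_integral_of_summable_integral_norm (μ := volume.restrict (cell a))
    (F := fun m x => h x * (c m * char a k m x))
    (fun m => integrable_cell ha (hh.mul (continuous_const.mul (char_continuous a k m)))) (by
      simp only [norm_mul, norm_char, mul_one]
      simp only [integral_mul_const]
      exact hc.mul_left _)
  simp only [tsum_mul_left] at key
  refine key.congr_fun fun m => ?_
  rw [← integral_const_mul]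
  exact integral_congr_ae (Eventually.of_forall fun x => mul_left_comm (c m) (h x) _)

lemma coef_synth {a : ℝ} (ha : 0 < a) (k : E3) {c : (Fin 3 → ℤ) → ℂ}
    (hc : Summable fun m => ‖c m‖) (m : Fin 3 → ℤ) : coef a k (synth a k c) m = c m := by
  have h := (hasSum_integral_mul_synth ha k hc (continuous_conj_char a k m)).mul_left
    (cellVol a : ℂ)⁻¹
  refine (h.unique ?_)
  have h2 : ∀ n, (cellVol a : ℂ)⁻¹ * (c n * ∫ x in cell a, conj (char a k m x) * char a k n x)
      = if n = m then c m else 0 := by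
    intro n
    have := coef_char ha k m n
    rw [coef] at this
    rw [mul_left_comm, this]
    by_cases hnm : n = m
    · simp [hnm]
    · simp [hnm]
  simp only [h2]
  exact hasSum_ite_eq m (c m)

lemma synth_injective {a : ℝ} (ha : 0 < a) (k : E3) {c d : (Fin 3 → ℤ) → ℂ}
    (hc : Summable fun m => ‖c m‖) (hd : Summable fun m => ‖d m‖)
    (h : synth a k c = synth a k d) : c = d := by
  ext m
  rw [← coef_synth ha k hc m, h, coef_synth ha k hd]

lemma eq_synth_coef {a : ℝ} (ha : 0 < a) {k : E3} {f : E3 → ℂ} (hf : Continuous f)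
    (hp : IsPseudoPeriodic a k f) (hs : Summable (coef a k f)) : f = synth a k (coef a k f) :=
  funext fun x => (hasSum_coef ha hf hp hs x).tsum_eq.symm

/-- Parseval's identity. -/
lemma cellInner_synth {a : ℝ} (ha : 0 < a) (k : E3) {c d : (Fin 3 → ℤ) → ℂ} (hc : Decay a c)
    (hd : Decay a d) :
    HasSum (fun m => cellVol a * (conj (c m) * d m)) (cellInner a (synth a k c) (synth a k d)) := by
  have h := hasSum_integral_mul_synth ha k (hd.summable_norm ha)
    (Complex.continuous_conj.comp (continuous_synth ha k hc))
  refine h.congr_fun fun m => ?_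
  have h1 := coef_synth ha k (hc.summable_norm ha) m
  have h2 : ∫ x in cell a, conj (synth a k c x) * char a k m x
      = conj (∫ x in cell a, conj (char a k m x) * synth a k c x) := by
    rw [← integral_conj]
    refine integral_congr_ae (Eventually.of_forall fun x => ?_)
    simp only [map_mul, Complex.conj_conj]
    ring
  rw [coef, inv_mul_eq_iff_eq_mul₀ (cellVol_ne_zero ha)] at h1
  simp only [Function.comp_apply]
  rw [h2, h1, map_mul, Complex.conj_ofReal]
  ring

end Synthesis

/-! ### The Laplacian and products in Fourier space -/

section Laplacian

lemma laplacian_eq_sum_fderiv {f : E3 → ℂ} (hf : ContDiff ℝ 2 f) (x : E3) :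
    Laplacian.laplacian f x = ∑ j : Fin 3, fderiv ℝ
      (fun y => fderiv ℝ f y (EuclideanSpace.single j 1)) x (EuclideanSpace.single j 1) := by
  rw [InnerProductSpace.laplacian_eq_iteratedFDeriv_orthonormalBasis f
    (EuclideanSpace.basisFun (Fin 3) ℝ)]
  refine Finset.sum_congr rfl fun j _ => ?_
  have hd : DifferentiableAt ℝ (fderiv ℝ f) x :=
    (hf.fderiv_right (m := 1) (by norm_num)).differentiable one_ne_zero x
  rw [iteratedFDeriv_two_apply, fderiv_clm_apply hd (differentiableAt_const _)]
  simp

lemma sum_inner_single_sq (p : E3) :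
    ∑ j : Fin 3, (Complex.I * (inner ℝ p (EuclideanSpace.single j 1) : ℝ))
      * (Complex.I * (inner ℝ p (EuclideanSpace.single j 1) : ℝ)) = -((‖p‖ ^ 2 : ℝ) : ℂ) := by
  have h : ∀ j : Fin 3, inner ℝ p (EuclideanSpace.single j 1) = p j := fun j => by
    simp [EuclideanSpace.inner_single_right]
  simp only [h]
  rw [EuclideanSpace.norm_sq_eq]
  simp only [Real.norm_eq_abs, sq_abs]
  push_cast
  rw [← Finset.sum_neg_distrib]
  refine Finset.sum_congr rfl fun j _ => ?_
  linear_combination ((p j : ℂ)) ^ 2 * Complex.I_sq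

lemma contDiff_fderiv_apply {n m : WithTop ℕ∞} {f : E3 → ℂ} (hf : ContDiff ℝ n f) (hm : m + 1 ≤ n)
    (v : E3) : ContDiff ℝ m (fun y => fderiv ℝ f y v) :=
  (hf.fderiv_right hm).clm_apply contDiff_const

lemma coef_sum {a : ℝ} (ha : 0 < a) (k : E3) {f : Fin 3 → E3 → ℂ} (hf : ∀ j, Continuous (f j))
    (m : Fin 3 → ℤ) : coef a k (fun x => ∑ j, f j x) m = ∑ j, coef a k (f j) m := by
  simp only [coef, Finset.mul_sum]
  have h : ∀ j ∈ Finset.univ, Integrable (fun x => conj (char a k m x) * f j x)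
      (volume.restrict (cell a)) :=
    fun j _ => integrable_cell ha ((continuous_conj_char a k m).mul (hf j))
  rw [integral_finsetSum _ h, Finset.mul_sum]

lemma coef_laplacian {a : ℝ} (ha : 0 < a) {k : E3} {f : E3 → ℂ} (hf : ContDiff ℝ 2 f)
    (hp : IsPseudoPeriodic a k f) (m : Fin 3 → ℤ) :
    coef a k (Laplacian.laplacian f) m = -((‖freq a k m‖ ^ 2 : ℝ) : ℂ) * coef a k f m := by
  have h0 : Laplacian.laplacian f = fun x => ∑ j : Fin 3, fderiv ℝ
      (fun y => fderiv ℝ f y (EuclideanSpace.single j 1)) x (EuclideanSpace.single j 1) :=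
    funext (laplacian_eq_sum_fderiv hf)
  have h1 : ∀ j : Fin 3, ContDiff ℝ 1 fun y => fderiv ℝ f y (EuclideanSpace.single j 1) :=
    fun j => contDiff_fderiv_apply hf (by norm_num) _
  rw [h0, coef_sum ha k fun j => (contDiff_fderiv_apply (m := 0) (h1 j) (by norm_num) _).continuous,
    ← sum_inner_single_sq, Finset.sum_mul]
  refine Finset.sum_congr rfl fun j _ => ?_
  rw [coef_fderiv ha (h1 j) (hp.fderiv _), coef_fderiv ha (hf.of_le (by norm_num)) hp]
  ring

lemma laplacian_pseudoPeriodic {a : ℝ} {k : E3} {f : E3 → ℂ} (hf : ContDiff ℝ 2 f)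
    (hp : IsPseudoPeriodic a k f) : IsPseudoPeriodic a k (Laplacian.laplacian f) := by
  intro x v hv
  rw [laplacian_eq_sum_fderiv hf, laplacian_eq_sum_fderiv hf, Finset.mul_sum]
  exact Finset.sum_congr rfl fun j _ => (hp.fderiv _).fderiv _ x v hv

lemma two_le_infty : (2 : WithTop ℕ∞) ≤ ∞ := WithTop.coe_le_coe.2 le_top

lemma contDiff_laplacian {f : E3 → ℂ} (hf : ContDiff ℝ ∞ f) :
    ContDiff ℝ ∞ (Laplacian.laplacian f) := by
  have h0 : Laplacian.laplacian f = fun x => ∑ j : Fin 3, fderiv ℝ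
      (fun y => fderiv ℝ f y (EuclideanSpace.single j 1)) x (EuclideanSpace.single j 1) :=
    funext (laplacian_eq_sum_fderiv (hf.of_le two_le_infty))
  rw [h0]
  exact ContDiff.sum fun j _ => contDiff_fderiv_apply (n := ∞) (contDiff_fderiv_apply (n := ∞)
    hf le_rfl _) le_rfl _

/-- The Fourier coefficients of a smooth function decay rapidly. -/
lemma decay_coef {a : ℝ} (ha : 0 < a) {f : E3 → ℂ} (hf : ContDiff ℝ ∞ f)
    (hp : IsPseudoPeriodic a 0 f) : Decay a (coef a 0 f) := by
  intro n
  induction n generalizing f with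
  | zero =>
    have hp' : IsPeriodic a f := fun x v hv => by simpa using hp x v hv
    obtain ⟨C, hC⟩ := hp'.bounded ha hf.continuous
    exact ⟨C, fun m => by simpa using norm_coef_le ha 0 hC m⟩
  | succ n ih =>
    have hf2 : ContDiff ℝ 2 f := hf.of_le two_le_infty
    -- The coefficients of f - Δf are those of f times the weight, so the induction hypothesis for f
    -- - Δf gains one power.
    have hg : ContDiff ℝ ∞ fun x => f x + (-1) * Laplacian.laplacian f x :=
      hf.add (contDiff_const.mul (contDiff_laplacian hf))
    have hgp : IsPseudoPeriodic a 0 fun x => f x + (-1) * Laplacian.laplacian f x := by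
      intro x v hv
      change f (x + v) + (-1) * Laplacian.laplacian f (x + v) = _ * (f x + _)
      rw [hp x v hv, laplacian_pseudoPeriodic hf2 hp x v hv]
      ring
    obtain ⟨C, hC⟩ := ih hg hgp
    refine ⟨C, fun m => ?_⟩
    have hw := weight_pos a m
    have h1 : coef a 0 (fun x => f x + (-1) * Laplacian.laplacian f x) m
        = ((weight a m : ℝ) : ℂ) * coef a 0 f m := by
      rw [coef_add ha 0 (g := fun x => (-1) * Laplacian.laplacian f x) hf.continuous
          (continuous_const.mul (contDiff_laplacian hf).continuous),
        coef_const_mul, coef_laplacian ha hf2 hp, weight, freq, zero_add]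
      push_cast
      ring
    have h2 := hC m
    rw [h1, norm_mul, Complex.norm_real, Real.norm_of_nonneg hw.le] at h2
    calc _ = weight a m ^ n * (weight a m * ‖coef a 0 f m‖) := by ring
      _ ≤ C := h2

/-- The Fourier coefficients of a product. -/
lemma coef_mul {a : ℝ} (ha : 0 < a) {V : E3 → ℂ} (hV : ContDiff ℝ ∞ V)
    (hVp : IsPseudoPeriodic a 0 V) {k : E3} {f : E3 → ℂ} (hf : Continuous f) (m : Fin 3 → ℤ) :
    coef a k (fun x => V x * f x) m = conv (coef a 0 V) (coef a k f) m := by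
  have hdec := decay_coef ha hV hVp
  have h1 := eq_synth_coef ha hV.continuous hVp (hdec.summable ha)
  -- The smooth factor V is expanded in its absolutely convergent series and integrated term by
  -- term; f need only be continuous.
  have h2 := (hasSum_integral_mul_synth ha 0 (hdec.summable_norm ha)
    ((continuous_conj_char a k m).mul hf)).mul_left (cellVol a : ℂ)⁻¹
  rw [← h1] at h2
  have h3 : coef a k (fun x => V x * f x) m = (cellVol a : ℂ)⁻¹ *
      ∫ x in cell a, conj (char a k m x) * f x * V x := by
    rw [coef]
    congr 1
    exact integral_congr_ae (Eventually.of_forall fun x => by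
      change conj (char a k m x) * (V x * f x) = conj (char a k m x) * f x * V x
      ring)
  rw [h3, conv]
  refine (h2.congr_fun fun g => ?_).tsum_eq.symm
  have h5 : ∫ x in cell a, conj (char a k m x) * f x * char a 0 g x
      = ∫ x in cell a, conj (char a k (m - g) x) * f x := by
    refine integral_congr_ae (Eventually.of_forall fun x => ?_)
    change conj (char a k m x) * f x * char a 0 g x = conj (char a k (m - g) x) * f x
    rw [mul_right_comm, conj_char_eq, conj_char_eq, char_mul_char]
    congr 2
    · rw [add_zero]
    · abel
  change coef a 0 V g * coef a k f (m - g) = (cellVol a : ℂ)⁻¹ * (coef a 0 V g *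
    ∫ x in cell a, conj (char a k m x) * f x * char a 0 g x)
  rw [h5, coef, coef]
  ring

end Laplacian

/-! ### Eigenfunctions and their coefficients -/

section Eigenfunctions

/-- The Fourier coefficients of the potential. -/
def potCoef (a : ℝ) (V : E3 → ℝ) : (Fin 3 → ℤ) → ℂ := coef a 0 (fun x => (V x : ℂ))

lemma IsAdmissible.contDiff_ofReal {a : ℝ} {V : E3 → ℝ} (hV : IsAdmissible a V) :
    ContDiff ℝ ∞ fun x => (V x : ℂ) := Complex.ofRealCLM.contDiff.comp hV.smooth

lemma IsAdmissible.pseudoPeriodic {a : ℝ} {V : E3 → ℝ} (hV : IsAdmissible a V) :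
    IsPseudoPeriodic a 0 fun x => (V x : ℂ) := fun x v hv => by
  simp [hV.periodic x v hv]

lemma IsAdmissible.decay {a : ℝ} (ha : 0 < a) {V : E3 → ℝ} (hV : IsAdmissible a V) :
    Decay a (potCoef a V) := decay_coef ha hV.contDiff_ofReal hV.pseudoPeriodic

lemma IsPseudoPeriodic.bounded {a : ℝ} (ha : 0 < a) {k : E3} {f : E3 → ℂ} (hf : Continuous f)
    (hp : IsPseudoPeriodic a k f) : ∃ C, ∀ x, ‖f x‖ ≤ C := by
  obtain ⟨C, hC⟩ := IsPeriodic.bounded ha (f := fun x => conj (char a k 0 x) * f x)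
    ((continuous_conj_char a k 0).mul hf) ((char_pseudoPeriodic ha k 0).conj_mul hp)
  refine ⟨C, fun x => ?_⟩
  have := hC x
  rwa [norm_mul, RCLike.norm_conj, norm_char, one_mul] at this

lemma continuous_laplacian {f : E3 → ℂ} (hf : ContDiff ℝ 2 f) :
    Continuous (Laplacian.laplacian f) := by
  have h0 : Laplacian.laplacian f = fun x => ∑ j : Fin 3, fderiv ℝ
      (fun y => fderiv ℝ f y (EuclideanSpace.single j 1)) x (EuclideanSpace.single j 1) :=
    funext (laplacian_eq_sum_fderiv hf)
  rw [h0]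
  exact continuous_finsetSum _ fun j _ => (contDiff_fderiv_apply (m := 0) (n := 1)
    (contDiff_fderiv_apply hf (by norm_num) _) (by norm_num) _).continuous

lemma coef_schrodinger {a : ℝ} (ha : 0 < a) {V : E3 → ℝ} (hV : IsAdmissible a V) {k : E3}
    {f : E3 → ℂ} (hf : ContDiff ℝ 2 f) (hp : IsPseudoPeriodic a k f) (μ : ℂ) (m : Fin 3 → ℤ) :
    coef a k (fun x => (-1 : ℂ) * Laplacian.laplacian f x + ((V x : ℂ) * f x + (-μ) * f x)) m
      = ((‖freq a k m‖ ^ 2 : ℝ) : ℂ) * coef a k f m + conv (potCoef a V) (coef a k f) m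
        - μ * coef a k f m := by
  have hVc : Continuous fun x => (V x : ℂ) := hV.contDiff_ofReal.continuous
  rw [coef_add ha k (f := fun x => (-1 : ℂ) * Laplacian.laplacian f x)
      (g := fun x => (V x : ℂ) * f x + (-μ) * f x)
      (continuous_const.mul (continuous_laplacian hf))
      ((hVc.mul hf.continuous).add (continuous_const.mul hf.continuous)),
    coef_add ha k (f := fun x => (V x : ℂ) * f x) (g := fun x => (-μ) * f x)
      (hVc.mul hf.continuous) (continuous_const.mul hf.continuous),
    coef_const_mul, coef_const_mul, coef_laplacian ha hf hp,
    coef_mul ha hV.contDiff_ofReal hV.pseudoPeriodic hf.continuous, potCoef]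
  ring

/-- Eigenfunctions are the Fourier series of rapidly decreasing solutions of the eigenvalue equation
in Fourier space. -/
lemma mem_eigenspace_iff {a : ℝ} (ha : 0 < a) {V : E3 → ℝ} (hV : IsAdmissible a V) {k : E3}
    {μ : ℝ} {f : E3 → ℂ} :
    f ∈ eigenspace a V k μ ↔ ∃ c, Decay a c ∧ f = synth a k c ∧
      ∀ m, ((‖freq a k m‖ ^ 2 : ℝ) : ℂ) * c m + conv (potCoef a V) c m = μ * c m := by
  have hVc : Continuous fun x => (V x : ℂ) := hV.contDiff_ofReal.continuous
  constructor
  · rintro ⟨hf, hp, heq⟩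
    obtain ⟨B, hB⟩ := hp.bounded ha hf.continuous
    have hc : ∀ m, ((‖freq a k m‖ ^ 2 : ℝ) : ℂ) * coef a k f m
        + conv (potCoef a V) (coef a k f) m = μ * coef a k f m := by
      intro m
      have h1 := coef_schrodinger ha hV hf hp μ m
      have h2 : (fun x => (-1 : ℂ) * Laplacian.laplacian f x + ((V x : ℂ) * f x + (-(μ : ℂ)) * f x))
          = fun x => (0 : ℂ) * f x := by
        ext x
        linear_combination heq x
      rw [h2, coef_const_mul, zero_mul] at h1
      linear_combination -h1
    have hdec := decay_of_eigen ha (hV.decay ha) (norm_coef_le ha k hB) hc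
    exact ⟨_, hdec, eq_synth_coef ha hf.continuous hp (hdec.summable ha), hc⟩
  · rintro ⟨c, hdec, rfl, hc⟩
    have hf : ContDiff ℝ 2 (synth a k c) := by exact_mod_cast contDiff_synth ha k hdec 2
    have hp := synth_pseudoPeriodic ha k c
    refine ⟨hf, hp, fun x => ?_⟩
    set g := fun x => (-1 : ℂ) * Laplacian.laplacian (synth a k c) x
      + ((V x : ℂ) * synth a k c x + (-(μ : ℂ)) * synth a k c x) with hg
    -- The residual g of the differential equation is continuous and pseudo-periodic with vanishing
    -- coefficients. Zero is summable, so g equals its Fourier series and vanishes.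
    have hcoef : coef a k g = 0 := by
      ext m
      rw [hg, coef_schrodinger ha hV hf hp, show coef a k (synth a k c) = c from
        funext (coef_synth ha k (hdec.summable_norm ha)), hc, sub_self]
      rfl
    have hgc : Continuous g := (continuous_const.mul (continuous_laplacian hf)).add
      ((hVc.mul hf.continuous).add (continuous_const.mul hf.continuous))
    have hgp : IsPseudoPeriodic a k g := by
      intro x v hv
      simp only [hg]
      rw [laplacian_pseudoPeriodic hf hp x v hv, hp x v hv, hV.periodic x v hv]
      ring
    have h1 := eq_synth_coef ha hgc hgp (by rw [hcoef]; exact summable_zero)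
    have h2 : g x = 0 := by rw [h1, hcoef]; simp [synth]
    simp only [hg] at h2
    linear_combination h2

lemma synth_sum {a : ℝ} (ha : 0 < a) (k : E3) {n : ℕ} {c : Fin n → (Fin 3 → ℤ) → ℂ}
    (hc : ∀ i, Decay a (c i)) (z : Fin n → ℂ) :
    synth a k (fun m => ∑ i, z i * c i m) = ∑ i, z i • synth a k (c i) := by
  ext x
  rw [Finset.sum_apply]
  simp only [Pi.smul_apply, smul_eq_mul, synth, Finset.sum_mul, ← tsum_mul_left, ← mul_assoc]
  rw [Summable.tsum_finsetSum]
  intro i _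
  simp only [mul_assoc]
  exact (summable_synth ((hc i).summable_norm ha) x).mul_left _

lemma Decay.sum {a : ℝ} {n : ℕ} {c : Fin n → (Fin 3 → ℤ) → ℂ} (hc : ∀ i, Decay a (c i))
    (z : Fin n → ℂ) : Decay a (fun m => ∑ i, z i * c i m) := by
  have h : ∀ s : Finset (Fin n), Decay a (fun m => ∑ i ∈ s, z i * c i m) := by
    intro s
    induction s using Finset.induction_on with
    | empty => exact fun n => ⟨0, fun m => by simp⟩
    | insert i s hi ih =>
      simp only [Finset.sum_insert hi]
      exact ((hc i).const_mul _).add ih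
  exact h _

end Eigenfunctions

/-! ### Diagonal, shift and convolution operators on ℓ² -/

section SequenceSpace

/-- Square-summable sequences indexed by the reciprocal lattice. -/
abbrev Seq2 : Type := lp (fun _ : Fin 3 → ℤ => ℂ) 2

lemma hasSum_norm_sq (u : Seq2) : HasSum (fun m => ‖u m‖ ^ 2) (‖u‖ ^ 2) := by
  have h := lp.hasSum_norm (p := 2) (by norm_num) u
  simpa using h

lemma memℓp_two {c : (Fin 3 → ℤ) → ℂ} (h : Summable fun m => ‖c m‖ ^ 2) :
    Memℓp (E := fun _ : Fin 3 → ℤ => ℂ) c 2 := by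
  refine memℓp_gen ?_
  simpa using h

lemma norm_le_of_tsum_sq {u : Seq2} {B : ℝ} (hB : 0 ≤ B) (h : ∑' m, ‖u m‖ ^ 2 ≤ B ^ 2) :
    ‖u‖ ≤ B := by
  rw [(hasSum_norm_sq u).tsum_eq] at h
  exact (pow_le_pow_iff_left₀ (norm_nonneg _) hB two_ne_zero).1 h

lemma summable_diag {d : (Fin 3 → ℤ) → ℂ} {B : ℝ} (hd : ∀ m, ‖d m‖ ≤ B) (u : Seq2) :
    Summable fun m => ‖d m * u m‖ ^ 2 := by
  refine Summable.of_nonneg_of_le (fun m => sq_nonneg _) (fun m => ?_)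
    ((hasSum_norm_sq u).summable.mul_left (B ^ 2))
  rw [norm_mul, mul_pow]
  exact mul_le_mul_of_nonneg_right (pow_le_pow_left₀ (norm_nonneg _) (hd m) 2) (sq_nonneg _)

/-- The diagonal operator with bounded entries `d`. -/
def diagOp (d : (Fin 3 → ℤ) → ℂ) (B : ℝ) (hd : ∀ m, ‖d m‖ ≤ B) : Seq2 →L[ℂ] Seq2 :=
  LinearMap.mkContinuous
    { toFun := fun u => ⟨fun m => d m * u m, memℓp_two (summable_diag hd u)⟩
      map_add' := fun u v => by
        ext m
        exact mul_add _ _ _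
      map_smul' := fun z u => by
        ext m
        exact mul_left_comm _ _ _ } B (fun u => by
    have hB : 0 ≤ B := (norm_nonneg _).trans (hd 0)
    refine norm_le_of_tsum_sq (mul_nonneg hB (norm_nonneg u)) ?_
    rw [mul_pow, ← (hasSum_norm_sq u).tsum_eq, ← tsum_mul_left]
    refine (summable_diag hd u).tsum_le_tsum (fun m => ?_)
      ((hasSum_norm_sq u).summable.mul_left (B ^ 2))
    change ‖d m * u m‖ ^ 2 ≤ _
    rw [norm_mul, mul_pow]
    exact mul_le_mul_of_nonneg_right (pow_le_pow_left₀ (norm_nonneg _) (hd m) 2) (sq_nonneg _))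

lemma diagOp_apply {d : (Fin 3 → ℤ) → ℂ} {B : ℝ} (hd : ∀ m, ‖d m‖ ≤ B) (u : Seq2)
    (m : Fin 3 → ℤ) : diagOp d B hd u m = d m * u m := rfl

lemma norm_diagOp_le {d : (Fin 3 → ℤ) → ℂ} {B : ℝ} (hd : ∀ m, ‖d m‖ ≤ B) :
    ‖diagOp d B hd‖ ≤ B :=
  LinearMap.mkContinuous_norm_le _ ((norm_nonneg _).trans (hd 0)) _

lemma inner_eq_tsum (u v : Seq2) : inner ℂ u v = ∑' m, conj (u m) * v m := by
  rw [lp.inner_eq_tsum]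
  refine tsum_congr fun m => ?_
  rw [RCLike.inner_apply, mul_comm]

lemma diagOp_isSymmetric {d : (Fin 3 → ℤ) → ℂ} {B : ℝ} (hd : ∀ m, ‖d m‖ ≤ B)
    (hr : ∀ m, conj (d m) = d m) : (diagOp d B hd).IsSymmetric := by
  intro u v
  change inner ℂ (diagOp d B hd u) v = inner ℂ u (diagOp d B hd v)
  rw [inner_eq_tsum, inner_eq_tsum]
  refine tsum_congr fun m => ?_
  rw [diagOp_apply, diagOp_apply, map_mul, hr]
  ring

/-- Only finitely many entries exceed ε/2; keeping just these gives a finite-rank operator within ε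
in norm. -/
lemma diagOp_compact {d : (Fin 3 → ℤ) → ℂ} {B : ℝ} (hd : ∀ m, ‖d m‖ ≤ B)
    (h0 : Tendsto (fun m => ‖d m‖) cofinite (𝓝 0)) : IsCompactOperator (diagOp d B hd) := by
  have hcl := isClosed_setOfPred_isCompactOperator (σ₁₂ := RingHom.id ℂ) (M₁ := Seq2) (M₂ := Seq2)
  suffices h : diagOp d B hd ∈ closure {f : Seq2 →L[ℂ] Seq2 | IsCompactOperator f} by
    rw [hcl.closure_eq] at h
    exact h
  rw [Metric.mem_closure_iff]
  intro ε hε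
  have hfin : {m | ¬ ‖d m‖ < ε / 2}.Finite := h0.eventually (gt_mem_nhds (half_pos hε))
  let s := hfin.toFinset
  let P : (Fin 3 → ℤ) → Seq2 →L[ℂ] Seq2 := fun m =>
    (lp.singleContinuousLinearMap ℂ (fun _ : Fin 3 → ℤ => ℂ) 2 m).comp
      (lp.evalCLM ℂ (fun _ : Fin 3 → ℤ => ℂ) 2 m)
  have hP : ∀ m (u : Seq2) n, P m u n = if n = m then u m else 0 := by
    intro m u n
    change (lp.single (E := fun _ : Fin 3 → ℤ => ℂ) 2 m (u m)) n = _
    rw [lp.single_apply, Pi.single_apply]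
  have hPc : ∀ m, IsCompactOperator (P m) := fun m => by
    have h1 : IsCompactOperator (lp.singleContinuousLinearMap ℂ (fun _ : Fin 3 → ℤ => ℂ) 2 m) :=
      isCompactOperator_of_locallyCompactSpace_rng _
    exact h1.comp_clm _
  refine ⟨∑ m ∈ s, d m • P m, ?_, ?_⟩
  · have : ∑ m ∈ s, d m • P m ∈ compactOperator (RingHom.id ℂ) Seq2 Seq2 :=
      Submodule.sum_mem _ fun m _ => Submodule.smul_mem _ _ (hPc m)
    exact this
  · have hbd : ∀ m, ‖(if m ∈ s then 0 else d m)‖ ≤ ε / 2 := by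
      intro m
      by_cases hm : m ∈ s
      · rw [if_pos hm, norm_zero]; positivity
      · rw [if_neg hm]
        have : ‖d m‖ < ε / 2 := by
          by_contra hc
          exact hm (hfin.mem_toFinset.2 hc)
        exact this.le
    have heq : diagOp d B hd - ∑ m ∈ s, d m • P m = diagOp _ _ hbd := by
      ext u n
      have h1 : (diagOp d B hd - ∑ m ∈ s, d m • P m) u n
          = d n * u n - ∑ m ∈ s, d m * P m u n := by
        rw [_root_.sub_apply, sum_apply, lp.coeFn_sub, Pi.sub_apply, diagOp_apply,
          lp.coeFn_sum, Finset.sum_apply]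
        rfl
      rw [h1, diagOp_apply]
      simp only [hP]
      by_cases hn : n ∈ s
      · rw [if_pos hn, Finset.sum_eq_single n]
        · simp
        · intro m _ hm
          rw [if_neg hm.symm, mul_zero]
        · exact fun hc => absurd hn hc
      · rw [if_neg hn, Finset.sum_eq_zero, sub_zero]
        intro m hm
        rw [if_neg (fun hc : n = m => hn (hc ▸ hm)), mul_zero]
    rw [dist_eq_norm, heq]
    exact (norm_diagOp_le hbd).trans_lt (half_lt_self hε)

/-- Translation of sequences. -/
def shiftOp (g : Fin 3 → ℤ) : Seq2 →L[ℂ] Seq2 :=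
  LinearMap.mkContinuous
    { toFun := fun u => ⟨fun m => u (m - g), memℓp_two
        ((hasSum_norm_sq u).summable.comp_injective (sub_left_injective (b := g)))⟩
      map_add' := fun u v => rfl
      map_smul' := fun z u => rfl } 1 (fun u => by
    rw [one_mul]
    refine norm_le_of_tsum_sq (norm_nonneg u) ?_
    rw [← (hasSum_norm_sq u).tsum_eq]
    exact ((Equiv.subRight g).tsum_eq fun m => ‖u m‖ ^ 2).le)

lemma shiftOp_apply (g : Fin 3 → ℤ) (u : Seq2) (m : Fin 3 → ℤ) : shiftOp g u m = u (m - g) := rfl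

lemma norm_shiftOp_le (g : Fin 3 → ℤ) : ‖shiftOp g‖ ≤ 1 :=
  LinearMap.mkContinuous_norm_le _ zero_le_one _

lemma inner_shiftOp (g : Fin 3 → ℤ) (u v : Seq2) :
    inner ℂ u (shiftOp g v) = inner ℂ (shiftOp (-g) u) v := by
  rw [inner_eq_tsum, inner_eq_tsum, ← (Equiv.subRight (-g)).tsum_eq]
  refine tsum_congr fun m => ?_
  rw [shiftOp_apply, shiftOp_apply, Equiv.subRight_apply]
  congr 2
  rw [sub_neg_eq_add, add_sub_cancel_right]

/-- Convolution as an operator. -/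
def convOp (V : (Fin 3 → ℤ) → ℂ) : Seq2 →L[ℂ] Seq2 := ∑' g, V g • shiftOp g

lemma summable_convOp {V : (Fin 3 → ℤ) → ℂ} (hV : Summable fun m => ‖V m‖) :
    Summable fun g => V g • shiftOp g := by
  refine Summable.of_norm_bounded hV fun g => ?_
  rw [norm_smul]
  exact mul_le_of_le_one_right (norm_nonneg _) (norm_shiftOp_le g)

lemma hasSum_convOp_apply {V : (Fin 3 → ℤ) → ℂ} (hV : Summable fun m => ‖V m‖) (u : Seq2) :
    HasSum (fun g => V g • shiftOp g u) (convOp V u) := by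
  have h := (summable_convOp hV).hasSum.mapL (ContinuousLinearMap.apply ℂ Seq2 u)
  simp only [ContinuousLinearMap.apply_apply, _root_.smul_apply] at h
  exact h

lemma convOp_apply {V : (Fin 3 → ℤ) → ℂ} (hV : Summable fun m => ‖V m‖) (u : Seq2)
    (m : Fin 3 → ℤ) : convOp V u m = conv V u m := by
  have h := (lp.evalCLM ℂ (fun _ : Fin 3 → ℤ => ℂ) 2 m).hasSum (hasSum_convOp_apply hV u)
  exact h.tsum_eq.symm

/-- The adjoint of a shift is the opposite shift, so the hypothesis on V is what the substitution g
↦ -g requires. -/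
lemma convOp_isSymmetric {V : (Fin 3 → ℤ) → ℂ} (hV : Summable fun m => ‖V m‖)
    (hr : ∀ g, conj (V g) = V (-g)) : (convOp V).IsSymmetric := by
  intro u v
  change inner ℂ (convOp V u) v = inner ℂ u (convOp V v)
  have h1 := (innerSL ℂ u).hasSum (hasSum_convOp_apply hV v)
  have h2 := (innerSL ℂ v).hasSum (hasSum_convOp_apply hV u)
  have h3 := (Complex.conjCLE : ℂ →L[ℝ] ℂ).hasSum h2
  have h4 := (Equiv.neg (Fin 3 → ℤ)).hasSum_iff.2 h3
  have h5 : inner ℂ (convOp V u) v = conj (inner ℂ v (convOp V u)) := (inner_conj_symm _ _).symm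
  rw [h5]
  refine h4.unique (h1.congr_fun fun g => ?_)
  change conj (inner ℂ v (V (-g) • shiftOp (-g) u)) = inner ℂ u (V g • shiftOp g v)
  rw [inner_smul_right, inner_smul_right, map_mul, inner_conj_symm, hr, neg_neg, inner_shiftOp]

end SequenceSpace

/-! ### The Bloch problem as a pencil -/

section BlochPencil

/-- The square root `(1 + |k + G|²)^(-1/2)` of the free resolvent. -/
def resRoot (a : ℝ) (k : E3) (m : Fin 3 → ℤ) : ℝ := (√(1 + ‖freq a k m‖ ^ 2))⁻¹

lemma resRoot_pos (a : ℝ) (k : E3) (m : Fin 3 → ℤ) : 0 < resRoot a k m := by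
  unfold resRoot; positivity

lemma resRoot_sq (a : ℝ) (k : E3) (m : Fin 3 → ℤ) :
    resRoot a k m ^ 2 = (1 + ‖freq a k m‖ ^ 2)⁻¹ := by
  rw [resRoot, inv_pow, Real.sq_sqrt (by positivity)]

lemma resRoot_sq_mul (a : ℝ) (k : E3) (m : Fin 3 → ℤ) :
    resRoot a k m ^ 2 * (1 + ‖freq a k m‖ ^ 2) = 1 := by
  rw [resRoot_sq]; exact inv_mul_cancel₀ (by positivity)

lemma resRoot_le_one (a : ℝ) (k : E3) (m : Fin 3 → ℤ) : resRoot a k m ≤ 1 := by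
  have h := resRoot_sq_mul a k m
  have h2 := resRoot_pos a k m
  nlinarith [sq_nonneg (resRoot a k m * ‖freq a k m‖)]

lemma norm_resRoot_le (a : ℝ) (k : E3) (m : Fin 3 → ℤ) : ‖(resRoot a k m : ℂ)‖ ≤ 1 := by
  rw [Complex.norm_real, Real.norm_of_nonneg (resRoot_pos a k m).le]
  exact resRoot_le_one a k m

/-- The operator `(1 + |k + G|²)^(-1/2)`. -/
def rootOp (a : ℝ) (k : E3) : Seq2 →L[ℂ] Seq2 :=
  diagOp (fun m => (resRoot a k m : ℂ)) 1 (norm_resRoot_le a k)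

lemma rootOp_apply (a : ℝ) (k : E3) (u : Seq2) (m : Fin 3 → ℤ) :
    rootOp a k u m = resRoot a k m * u m := rfl

lemma rootOp_isSymmetric (a : ℝ) (k : E3) : (rootOp a k).IsSymmetric :=
  diagOp_isSymmetric _ fun _ => Complex.conj_ofReal _

lemma rootOp_injective (a : ℝ) (k : E3) : Function.Injective (rootOp a k) := by
  intro u v h
  ext m
  have h1 := congrArg (fun w : Seq2 => w m) h
  simp only [rootOp_apply] at h1
  have h2 : (resRoot a k m : ℂ) ≠ 0 := by exact_mod_cast (resRoot_pos a k m).ne'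
  exact mul_left_cancel₀ h2 h1

lemma rootOp_compact {a : ℝ} (ha : 0 < a) (k : E3) : IsCompactOperator (rootOp a k) := by
  refine diagOp_compact _ ?_
  have hs : Summable fun m => resRoot a k m ^ 4 := by
    refine Summable.of_nonneg_of_le (fun m => by have := resRoot_pos a k m; positivity)
      (fun m => ?_) ((summable_weight ha).mul_left ((2 * (1 + ‖k‖ ^ 2)) ^ 2))
    have h1 : resRoot a k m ^ 2 ≤ 2 * (1 + ‖k‖ ^ 2) * (weight a m)⁻¹ := by
      have hw := weight_pos a m
      rw [resRoot_sq, ← div_eq_mul_inv, inv_le_comm₀ (by positivity) (by positivity), inv_div,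
        div_le_iff₀ (by positivity), mul_comm]
      exact weight_le_freq a k m
    calc resRoot a k m ^ 4 = (resRoot a k m ^ 2) ^ 2 := by ring
      _ ≤ (2 * (1 + ‖k‖ ^ 2) * (weight a m)⁻¹) ^ 2 := pow_le_pow_left₀ (sq_nonneg _) h1 2
      _ = _ := by ring
  have h0 := hs.tendsto_cofinite_zero
  rw [Metric.tendsto_nhds]
  intro ε hε
  filter_upwards [h0.eventually (gt_mem_nhds (pow_pos hε 4))] with m hm
  rw [Real.dist_eq, sub_zero, abs_norm, Complex.norm_real,
    Real.norm_of_nonneg (resRoot_pos a k m).le]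
  exact lt_of_pow_lt_pow_left₀ 4 hε.le hm

/-- The shift that makes the Bloch operator positive. -/
def energyShift (a : ℝ) (V : E3 → ℝ) : ℝ := 1 + ‖convOp (potCoef a V)‖

/-- The form of the shifted Bloch operator at `k`. -/
def blochOp (a : ℝ) (V : E3 → ℝ) (k : E3) : Seq2 →L[ℂ] Seq2 :=
  1 + rootOp a k * (convOp (potCoef a V) + ((‖convOp (potCoef a V)‖ : ℝ) : ℂ) • 1) * rootOp a k

/-- Passing from k to k + κ changes |k+G|² by 2κ·(k+G) + |κ|². The growth in G is absorbed by the
factor (1+|k+G|²)⁻¹, as 2|p| ≤ 1 + |p|². -/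
lemma norm_pert_le (a : ℝ) (k κ : E3) (m : Fin 3 → ℤ) :
    ‖((resRoot a k m ^ 2 * (2 * inner ℝ κ (freq a k m) + ‖κ‖ ^ 2) : ℝ) : ℂ)‖
      ≤ ‖κ‖ + ‖κ‖ ^ 2 := by
  rw [Complex.norm_real, Real.norm_eq_abs, abs_mul, abs_of_nonneg (sq_nonneg _)]
  have h1 := resRoot_sq_mul a k m
  have h2 := sq_nonneg (resRoot a k m)
  have h3 : |2 * inner ℝ κ (freq a k m) + ‖κ‖ ^ 2| ≤ 2 * (‖κ‖ * ‖freq a k m‖) + ‖κ‖ ^ 2 := by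
    refine (abs_add_le _ _).trans ?_
    rw [abs_mul, abs_two, abs_of_nonneg (sq_nonneg ‖κ‖)]
    gcongr
    exact abs_real_inner_le_norm _ _
  have h4 : 2 * (‖κ‖ * ‖freq a k m‖) + ‖κ‖ ^ 2
      ≤ (‖κ‖ + ‖κ‖ ^ 2) * (1 + ‖freq a k m‖ ^ 2) := by
    nlinarith [mul_nonneg (norm_nonneg κ) (sq_nonneg (‖freq a k m‖ - 1)),
      mul_nonneg (sq_nonneg ‖κ‖) (sq_nonneg ‖freq a k m‖)]
  calc _ ≤ resRoot a k m ^ 2 * ((‖κ‖ + ‖κ‖ ^ 2) * (1 + ‖freq a k m‖ ^ 2)) :=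
        mul_le_mul_of_nonneg_left (h3.trans h4) h2
    _ = (‖κ‖ + ‖κ‖ ^ 2) * (resRoot a k m ^ 2 * (1 + ‖freq a k m‖ ^ 2)) := by ring
    _ = _ := by rw [h1, mul_one]

/-- The perturbation of the form when the quasi-momentum moves from `k` to `k + κ`. -/
def pertOp (a : ℝ) (k κ : E3) : Seq2 →L[ℂ] Seq2 :=
  diagOp (fun m => ((resRoot a k m ^ 2 * (2 * inner ℝ κ (freq a k m) + ‖κ‖ ^ 2) : ℝ) : ℂ))
    (‖κ‖ + ‖κ‖ ^ 2) (norm_pert_le a k κ)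

lemma norm_pertOp_le (a : ℝ) (k κ : E3) : ‖pertOp a k κ‖ ≤ ‖κ‖ + ‖κ‖ ^ 2 := norm_diagOp_le _

lemma pertOp_isSymmetric (a : ℝ) (k κ : E3) : (pertOp a k κ).IsSymmetric :=
  diagOp_isSymmetric _ fun _ => Complex.conj_ofReal _

lemma pertOp_zero (a : ℝ) (k : E3) : pertOp a k 0 = 0 := by
  have := norm_pertOp_le a k 0
  simpa using this

lemma conj_potCoef (a : ℝ) (V : E3 → ℝ) (g : Fin 3 → ℤ) :
    conj (potCoef a V g) = potCoef a V (-g) := by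
  rw [potCoef, coef, coef, map_mul, map_inv₀, Complex.conj_ofReal, ← integral_conj]
  congr 2
  ext x
  rw [map_mul, Complex.conj_conj, Complex.conj_ofReal, conj_char_eq, neg_zero, neg_neg]

/-- With W the convolution by V̂, the operator W + ‖W‖ is nonnegative, so the identity in `blochOp`
gives the coercivity constant 1. -/
lemma blochOp_isPencil {a : ℝ} (ha : 0 < a) {V : E3 → ℝ} (hV : IsAdmissible a V) (k : E3) :
    IsPencil (rootOp a k) (blochOp a V k) 1 := by
  have hs := (hV.decay ha).summable_norm ha
  have hW := convOp_isSymmetric hs (conj_potCoef a V)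
  set W := convOp (potCoef a V) with hWdef
  have hN : ∀ u v, inner ℂ u (blochOp a V k v) = inner ℂ u v
      + (inner ℂ (rootOp a k u) (W (rootOp a k v))
        + ((‖W‖ : ℝ) : ℂ) * inner ℂ (rootOp a k u) (rootOp a k v)) := by
    intro u v
    have h1 : blochOp a V k v = v + rootOp a k (W (rootOp a k v)
        + ((‖W‖ : ℝ) : ℂ) • rootOp a k v) := rfl
    rw [h1, inner_add_right, ← (rootOp_isSymmetric a k).apply_clm, inner_add_right,
      inner_smul_right]
  refine ⟨rootOp_isSymmetric a k, rootOp_compact ha k, rootOp_injective a k, ?_, one_pos, ?_⟩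
  · intro u v
    change inner ℂ (blochOp a V k u) v = inner ℂ u (blochOp a V k v)
    rw [← inner_conj_symm, hN, hN, map_add, map_add, map_mul, inner_conj_symm, inner_conj_symm,
      inner_conj_symm, Complex.conj_ofReal, hW.apply_clm]
  · intro u
    have h2 := (abs_le.1 (abs_re_inner_apply_le W (rootOp a k u) (rootOp a k u))).1
    rw [hN, Complex.add_re, Complex.add_re, Complex.re_ofReal_mul, one_mul,
      show (inner ℂ u u).re = ‖u‖ ^ 2 from (norm_sq_eq_re_inner (𝕜 := ℂ) u).symm,
      show (inner ℂ (rootOp a k u) (rootOp a k u)).re = ‖rootOp a k u‖ ^ 2 from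
        (norm_sq_eq_re_inner (𝕜 := ℂ) _).symm]
    nlinarith

lemma blochOp_add_pertOp_isPencil {a : ℝ} (ha : 0 < a) {V : E3 → ℝ} (hV : IsAdmissible a V)
    (k : E3) {κ : E3} (hκ : ‖κ‖ + ‖κ‖ ^ 2 ≤ 1 / 2) :
    IsPencil (rootOp a k) (blochOp a V k + pertOp a k κ) (1 / 2) := by
  have h := blochOp_isPencil ha hV k
  refine ⟨h.symmA, h.compact, h.inj, ?_, by norm_num, fun u => ?_⟩
  · have := h.symmN.add (pertOp_isSymmetric a k κ)
    exact this
  · have h1 := h.coercive u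
    have h2 := (abs_le.1 (abs_re_inner_apply_le (pertOp a k κ) u u)).1
    have h3 := (norm_pertOp_le a k κ).trans hκ
    rw [_root_.add_apply, inner_add_right, Complex.add_re]
    nlinarith [mul_le_mul_of_nonneg_right h3 (sq_nonneg ‖u‖)]

lemma norm_freq_add_sq (a : ℝ) (k κ : E3) (m : Fin 3 → ℤ) :
    ‖freq a (k + κ) m‖ ^ 2 = ‖freq a k m‖ ^ 2 + 2 * inner ℝ κ (freq a k m) + ‖κ‖ ^ 2 := by
  have : freq a (k + κ) m = freq a k m + κ := by rw [freq, freq]; abel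
  rw [this, norm_add_sq_real, real_inner_comm]

/-- The eigenvalue equation of the pencil in Fourier space. -/
lemma mem_genEig_bloch {a : ℝ} (ha : 0 < a) {V : E3 → ℝ} (hV : IsAdmissible a V) (k κ : E3)
    (μ : ℝ) (u : Seq2) :
    u ∈ genEig (rootOp a k) (blochOp a V k + pertOp a k κ) (μ + energyShift a V) ↔
      ∀ m, ((‖freq a (k + κ) m‖ ^ 2 : ℝ) : ℂ) * rootOp a k u m
        + conv (potCoef a V) (rootOp a k u) m = μ * rootOp a k u m := by
  have hs := (hV.decay ha).summable_norm ha
  rw [mem_genEig, lp.ext_iff, funext_iff]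
  refine forall_congr' fun m => ?_
  have h1 : (blochOp a V k + pertOp a k κ) u m = u m + resRoot a k m *
      (conv (potCoef a V) (rootOp a k u) m
        + ((‖convOp (potCoef a V)‖ : ℝ) : ℂ) * rootOp a k u m)
      + ((resRoot a k m ^ 2 * (2 * inner ℝ κ (freq a k m) + ‖κ‖ ^ 2) : ℝ) : ℂ) * u m := by
    rw [← convOp_apply hs]
    rfl
  have h2 : (((μ + energyShift a V : ℝ) : ℂ) • rootOp a k (rootOp a k u)) m
      = ((μ + energyShift a V : ℝ) : ℂ) * (resRoot a k m * rootOp a k u m) := rfl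
  have h3 : (resRoot a k m : ℂ) ≠ 0 := by exact_mod_cast (resRoot_pos a k m).ne'
  have h4 : (resRoot a k m : ℂ) ^ 2 * (1 + (‖freq a k m‖ : ℂ) ^ 2) = 1 := by
    exact_mod_cast resRoot_sq_mul a k m
  change (blochOp a V k + pertOp a k κ) u m
    = (((μ + energyShift a V : ℝ) : ℂ) • rootOp a k (rootOp a k u)) m ↔ _
  rw [h1, h2, norm_freq_add_sq, energyShift]
  set X := conv (potCoef a V) (rootOp a k u) m
  rw [rootOp_apply]
  push_cast
  constructor
  · intro h
    refine mul_left_cancel₀ h3 ?_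
    linear_combination h + u m * h4
  · intro h
    linear_combination (resRoot a k m : ℂ) * h - u m * h4

/-- The preimage under the root operator of a rapidly decreasing sequence. -/
lemma exists_rootOp_eq {a : ℝ} (ha : 0 < a) (k : E3) {c : (Fin 3 → ℤ) → ℂ} (hc : Decay a c) :
    ∃ u : Seq2, ∀ m, rootOp a k u m = c m := by
  have hd : Decay a (fun m => ((resRoot a k m)⁻¹ : ℂ) * c m) := by
    refine hc.mul_of_le (B := 2 * (1 + ‖k‖ ^ 2)) fun m => ?_
    have h1 := resRoot_pos a k m
    have h2 := resRoot_le_one a k m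
    rw [norm_inv, Complex.norm_real, Real.norm_of_nonneg h1.le]
    have h3 : (resRoot a k m)⁻¹ ≤ 1 + ‖freq a k m‖ ^ 2 := by
      rw [inv_le_iff_one_le_mul₀ h1]
      have := resRoot_sq_mul a k m
      nlinarith [sq_nonneg ‖freq a k m‖]
    exact h3.trans (freq_le_weight a k m)
  have hsum : Summable fun m => ‖((resRoot a k m)⁻¹ : ℂ) * c m‖ ^ 2 := by
    obtain ⟨B, hB⟩ := hd 0
    refine Summable.of_nonneg_of_le (fun m => sq_nonneg _) (fun m => ?_)
      ((hd.summable_norm ha).mul_left B)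
    rw [sq]
    have h1 := hB m
    rw [pow_zero, one_mul] at h1
    exact mul_le_mul_of_nonneg_right h1 (norm_nonneg _)
  refine ⟨⟨_, memℓp_two hsum⟩, fun m => ?_⟩
  rw [rootOp_apply]
  have h3 : (resRoot a k m : ℂ) ≠ 0 := by exact_mod_cast (resRoot_pos a k m).ne'
  exact mul_inv_cancel_left₀ h3 _

/-- An ℓ² sequence is bounded, which is all that the regularity bootstrap needs to start. -/
lemma decay_of_mem_genEig {a : ℝ} (ha : 0 < a) {V : E3 → ℝ} (hV : IsAdmissible a V) {k κ : E3}
    {μ : ℝ} {u : Seq2}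
    (hu : u ∈ genEig (rootOp a k) (blochOp a V k + pertOp a k κ) (μ + energyShift a V)) :
    Decay a (rootOp a k u) :=
  decay_of_eigen ha (hV.decay ha)
    (fun m => lp.norm_apply_le_norm two_ne_zero (rootOp a k u) m)
    ((mem_genEig_bloch ha hV k κ μ u).1 hu)

/-- The eigenvalues of the pencil are those of the Floquet-Bloch problem. -/
lemma hasEigs_bloch_iff {a : ℝ} (ha : 0 < a) {V : E3 → ℝ} (hV : IsAdmissible a V) (k κ : E3)
    (n : ℕ) (t : ℝ) :
    HasEigs (rootOp a k) (blochOp a V k + pertOp a k κ) n (t + energyShift a V) ↔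
      ∃ F : Fin n → E3 → ℂ, LinearIndependent ℂ F ∧
        ∀ i, ∃ s ≤ t, F i ∈ eigenspace a V (k + κ) s := by
  constructor
  · rintro ⟨u, hu, hus⟩
    have hus' : ∀ i, ∃ s ≤ t, u i ∈ genEig (rootOp a k) (blochOp a V k + pertOp a k κ)
        (s + energyShift a V) := fun i => by
      obtain ⟨s, hs, h⟩ := hus i
      exact ⟨s - energyShift a V, by linarith, by rwa [sub_add_cancel]⟩
    choose s hs hmem using hus'
    have hdec : ∀ i, Decay a (rootOp a k (u i)) := fun i => decay_of_mem_genEig ha hV (hmem i)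
    refine ⟨fun i => synth a (k + κ) (rootOp a k (u i)), ?_, fun i => ⟨s i, hs i, ?_⟩⟩
    · rw [Fintype.linearIndependent_iff]
      intro z hz
      rw [← synth_sum ha (k + κ) hdec z] at hz
      have h0 : (fun m => ∑ i, z i * rootOp a k (u i) m) = 0 := by
        refine synth_injective ha (k + κ) ((Decay.sum hdec z).summable_norm ha) ?_ ?_
        · simp
        · rw [hz]; ext x; simp [synth]
      have h1 : rootOp a k (∑ i, z i • u i) = 0 := by
        ext m
        rw [map_sum, lp.coeFn_sum, Finset.sum_apply]
        have := congrFun h0 m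
        simp only [map_smul]
        exact this
      have h2 := rootOp_injective a k (h1.trans (map_zero _).symm)
      exact Fintype.linearIndependent_iff.1 hu z h2
    · exact (mem_eigenspace_iff ha hV).2 ⟨_, hdec i, rfl, (mem_genEig_bloch ha hV k κ (s i) (u i)).1
        (hmem i)⟩
  · rintro ⟨F, hF, hFs⟩
    choose s hs hmem using hFs
    choose c hc hFc hceq using fun i => (mem_eigenspace_iff ha hV).1 (hmem i)
    choose u hu using fun i => exists_rootOp_eq ha k (hc i)
    have hu' : ∀ i, (rootOp a k (u i) : (Fin 3 → ℤ) → ℂ) = c i := fun i => funext (hu i)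
    refine ⟨u, ?_, fun i => ⟨s i + energyShift a V, by linarith [hs i], ?_⟩⟩
    · rw [Fintype.linearIndependent_iff]
      intro z hz
      refine Fintype.linearIndependent_iff.1 hF z ?_
      have h1 : (fun m => ∑ i, z i * c i m) = 0 := by
        have h2 : rootOp a k (∑ i, z i • u i) = 0 := by rw [hz, map_zero]
        ext m
        have h3 := congrArg (fun w : Seq2 => w m) h2
        simp only [map_sum, map_smul, lp.coeFn_sum, Finset.sum_apply] at h3
        simp only [← hu']
        exact h3
      simp only [hFc]
      rw [← synth_sum ha (k + κ) hc z, h1]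
      ext x
      simp [synth]
    · rw [mem_genEig_bloch ha hV, hu']
      exact hceq i

end BlochPencil

/-! ### Existence and lower bound of pencil eigenvalues -/

section PencilCounting

variable {H : Type*} [NormedAddCommGroup H] [InnerProductSpace ℂ H] {A N : H →L[ℂ] H} {α : ℝ}

/-- For an eigenvector u with eigenvalue s, coercivity gives α‖u‖² ≤ s‖A u‖² ≤ s‖A‖²‖u‖². -/
lemma IsPencil.exists_pos_le_of_hasEigs (h : IsPencil A N α) {n : ℕ} (hn : 0 < n) :
    ∃ c > 0, ∀ ν, HasEigs A N n ν → c ≤ ν := by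
  have hα := h.pos
  refine ⟨α / (‖A‖ ^ 2 + 1), by positivity, fun ν hν => ?_⟩
  obtain ⟨F, hF, hs⟩ := hν
  obtain ⟨s, hsν, hmem⟩ := hs ⟨0, hn⟩
  set u := F ⟨0, hn⟩
  have hu : 0 < ‖u‖ ^ 2 := by have := norm_pos_iff.2 (hF.ne_zero ⟨0, hn⟩); positivity
  have h1 := h.form_self hmem
  have h2 := h.coercive u
  have h3 := h.apply_norm_sq_pos (hF.ne_zero ⟨0, hn⟩)
  have h4 : ‖A u‖ ^ 2 ≤ ‖A‖ ^ 2 * ‖u‖ ^ 2 := by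
    rw [← mul_pow]
    exact pow_le_pow_left₀ (norm_nonneg _) (A.le_opNorm u) 2
  have hs0 : 0 < s := by
    by_contra hs0
    nlinarith [mul_pos hα hu]
  refine le_trans ?_ hsν
  rw [div_le_iff₀ (by positivity)]
  refine le_of_mul_le_mul_right ?_ hu
  nlinarith [mul_le_mul_of_nonneg_left h4 hs0.le, mul_pos hs0 hu]

/-- A pencil on a space with `n` linearly independent vectors has `n` eigenvalues. -/
lemma IsPencil.exists_hasEigs [CompleteSpace H] (h : IsPencil A N α) {ι : Type*} [Fintype ι]
    {F : ι → H} (hF : LinearIndependent ℂ F) : ∃ ν, HasEigs A N (Fintype.card ι) ν := by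
  let S := Submodule.span ℂ (Set.range F)
  have : FiniteDimensional ℂ S := FiniteDimensional.span_of_finite ℂ (Set.finite_range F)
  -- An injective linear map on a finite-dimensional space is bounded below; this bounds the
  -- quotient ⟨u, N u⟩/‖A u‖² on the span.
  obtain ⟨K, -, hK⟩ := LinearMap.exists_antilipschitzWith ((A : H →ₗ[ℂ] H) ∘ₗ S.subtype)
    (LinearMap.ker_eq_bot.2 (h.inj.comp Subtype.val_injective))
  refine ⟨‖N‖ * K ^ 2 + 1, h.hasEigs_of_form_le (by positivity) hF fun u hu => ?_⟩
  have h1 : ‖u‖ ≤ K * ‖A u‖ := by simpa using hK.le_mul_dist (⟨u, hu⟩ : S) 0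
  have h2 : (inner ℂ u (N u)).re ≤ ‖N‖ * ‖u‖ ^ 2 := by
    have h3 : (inner ℂ u (N u)).re ≤ ‖u‖ * ‖N u‖ := re_inner_le_norm (𝕜 := ℂ) u (N u)
    have h4 := N.le_opNorm u
    nlinarith [norm_nonneg u]
  have h5 : ‖u‖ ^ 2 ≤ (K * ‖A u‖) ^ 2 := pow_le_pow_left₀ (norm_nonneg u) h1 2
  nlinarith [mul_le_mul_of_nonneg_left h5 (norm_nonneg N), sq_nonneg ‖A u‖]

end PencilCounting

lemma exists_linearIndependent_seq2 (n : ℕ) : ∃ F : Fin n → Seq2, LinearIndependent ℂ F := by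
  let e : Fin n → (Fin 3 → ℤ) := fun i _ => (i : ℤ)
  have he : Function.Injective e := fun i j hij => by
    have := congrFun hij 0
    simp only [e] at this
    exact Fin.ext (by exact_mod_cast this)
  refine ⟨fun i => lp.single 2 (e i) 1, Fintype.linearIndependent_iff.2 fun z hz i => ?_⟩
  have h := congrArg (fun w : Seq2 => w (e i)) hz
  simp only [lp.coeFn_sum, Finset.sum_apply, lp.coeFn_smul, Pi.smul_apply, lp.single_apply,
    Pi.single_apply, he.eq_iff] at h
  simpa using h

/-! ### From pencil eigenvalues to the bands -/

section Bands

variable {a : ℝ} {V : E3 → ℝ}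

lemma band_eq (ha : 0 < a) (hV : IsAdmissible a V) (n : ℕ) (k κ : E3) :
    band a V n (k + κ) = sInf {t | HasEigs (rootOp a k) (blochOp a V k + pertOp a k κ) n
      (t + energyShift a V)} := by
  rw [band]
  congr 1
  ext t
  exact (hasEigs_bloch_iff ha hV k κ n t).symm

/-- The infimum in `band` is meaningful only for a set bounded below; positivity of the pencil
eigenvalues supplies the bound. -/
lemma band_le {α : ℝ} (ha : 0 < a) (hV : IsAdmissible a V) {n : ℕ} (hn : 0 < n) {k κ : E3}
    (hp : IsPencil (rootOp a k) (blochOp a V k + pertOp a k κ) α) {ν : ℝ}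
    (h : HasEigs (rootOp a k) (blochOp a V k + pertOp a k κ) n ν) :
    band a V n (k + κ) ≤ ν - energyShift a V := by
  rw [band_eq ha hV]
  refine csInf_le ⟨-energyShift a V, fun t ht => ?_⟩ (by simpa using h)
  obtain ⟨c, hc, hcν⟩ := hp.exists_pos_le_of_hasEigs hn
  have := hcν _ ht
  linarith

/-- Here the set must be nonempty, since the infimum of the empty set of reals is 0 by convention;
ℓ² contains n independent vectors, so n eigenvalues exist. -/
lemma le_band {α : ℝ} (ha : 0 < a) (hV : IsAdmissible a V) {n : ℕ} {k κ : E3}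
    (hp : IsPencil (rootOp a k) (blochOp a V k + pertOp a k κ) α) {ν₀ : ℝ}
    (h : ∀ ν, HasEigs (rootOp a k) (blochOp a V k + pertOp a k κ) n ν → ν₀ ≤ ν) :
    ν₀ - energyShift a V ≤ band a V n (k + κ) := by
  rw [band_eq ha hV]
  obtain ⟨F, hF⟩ := exists_linearIndependent_seq2 n
  obtain ⟨ν, hν⟩ := hp.exists_hasEigs hF
  rw [Fintype.card_fin] at hν
  refine le_csInf ⟨ν - energyShift a V, by simpa using hν⟩ fun t ht => ?_
  have := h _ ht
  linarith

lemma energy_pos (ha : 0 < a) (hV : IsAdmissible a V) (k : E3) {n : ℕ} (hn : 0 < n) {μ : ℝ}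
    (h : band a V n k = μ) : 0 < μ + energyShift a V := by
  have hp : IsPencil (rootOp a k) (blochOp a V k + pertOp a k 0) 1 := by
    rw [pertOp_zero, add_zero]
    exact blochOp_isPencil ha hV k
  obtain ⟨c, hc, hcν⟩ := hp.exists_pos_le_of_hasEigs hn
  have := le_band ha hV hp hcν
  rw [add_zero, h] at this
  linarith

/-- The bands near `k`, up to quadratic errors, in terms of the eigenvalues of the first order
perturbation on a three-fold eigenspace. -/
lemma band_expansion (ha : 0 < a) (hV : IsAdmissible a V) {b : ℕ} (hb : 1 < b) {k : E3} {μ : ℝ}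
    (h₁ : band a V (b - 1) k = μ) (h₃ : band a V (b + 1) k = μ) {e : Fin 3 → Seq2}
    (he : Submodule.span ℂ (Set.range e)
      = genEig (rootOp a k) (blochOp a V k) (μ + energyShift a V)) :
    ∃ C z₀ : ℝ, 0 < z₀ ∧ ∀ κ : E3, ‖κ‖ + ‖κ‖ ^ 2 ≤ z₀ → ∀ (f : Fin 3 → Seq2) (l : Fin 3 → ℝ),
      Submodule.span ℂ (Set.range f) = Submodule.span ℂ (Set.range e) →
      (∀ i j, inner ℂ (rootOp a k (f i)) (rootOp a k (f j)) = if i = j then 1 else 0) →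
      (∀ i j, inner ℂ (f i) (pertOp a k κ (f j)) = if i = j then (l i : ℂ) else 0) →
      Antitone l → ∀ j : Fin 3,
        |band a V (b + 1 - j) (k + κ) - (μ + l j)| ≤ C * (‖κ‖ + ‖κ‖ ^ 2) ^ 2 := by
  have hp := blochOp_isPencil ha hV k
  have hp0 : IsPencil (rootOp a k) (blochOp a V k + pertOp a k 0) 1 := by
    rwa [pertOp_zero, add_zero]
  obtain ⟨m, rfl⟩ : ∃ m, b = m + 2 := ⟨b - 2, by omega⟩
  have hν := energy_pos ha hV k (by omega) h₁
  set ν₀ := μ + energyShift a V with hν₀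
  -- With b = m + 2, the value of band b - 1 says that there are fewer than m + 1 eigenvalues below
  -- ν₀.
  have hlow : ∀ ν < ν₀, ¬ HasEigs (rootOp a k) (blochOp a V k) (m + 1) ν := by
    intro ν hlt hc
    have h := band_le ha hV (κ := 0) (Nat.succ_pos m) hp0 (by rwa [pertOp_zero, add_zero])
    rw [add_zero] at h
    have h' : band a V (m + 1) k = μ := h₁
    rw [h'] at h
    linarith
  -- The infimum defining band b + 1 is attained at ν₀: without m + 3 eigenvalues up to ν₀, the
  -- (m+3)-rd would stay a positive distance above it.
  have hup : HasEigs (rootOp a k) (blochOp a V k) (m + 3) ν₀ := by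
    by_contra hc
    obtain ⟨ν₁, hlt, h⟩ := hp.exists_lt_of_not_hasEigs hν hc
    have h' := le_band ha hV (κ := 0) hp0 (ν₀ := ν₁) (n := m + 3)
      (by rwa [pertOp_zero, add_zero])
    have h'' : band a V (m + 3) k = μ := h₃
    rw [add_zero, h''] at h'
    linarith
  obtain ⟨C, z₀, hz₀, H⟩ := hp.perturb hν hlow hup he
  -- The radius 1/4 keeps the perturbed pencil coercive and makes |l j| ≤ ν₀/4; the last radius
  -- helps to make |C|‖Z‖² ≤ ν₀/4. Together they give the positivity that the upper bound of
  -- `perturb` asks for.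
  refine ⟨|C|, min z₀ (min (1 / 4) (ν₀ / (4 * (|C| + 1)))), by positivity,
    fun κ hκ f l hf1 hf2 hf3 hl j => ?_⟩
  rw [le_min_iff, le_min_iff] at hκ
  obtain ⟨hκ1, hκ2, hκ3⟩ := hκ
  rw [le_div_iff₀ (by positivity)] at hκ3
  have hZ := norm_pertOp_le a k κ
  set z := ‖pertOp a k κ‖
  have hz0 : 0 ≤ z := norm_nonneg _
  have hpk := blochOp_add_pertOp_isPencil ha hV k (κ := κ) (by linarith)
  rw [he] at hf1
  have hfm : ∀ i, f i ∈ genEig (rootOp a k) (blochOp a V k) ν₀ := fun i => by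
    rw [← hf1]; exact Submodule.subset_span ⟨i, rfl⟩
  obtain ⟨hj1, hj2⟩ := H _ _ (pertOp_isSymmetric a k κ) (hZ.trans hκ1) hpk f l hfm hf2 hf1 hf3 hl j
  have hA : ‖rootOp a k (f j)‖ ^ 2 = 1 := by
    have := norm_sq_eq_re_inner (𝕜 := ℂ) (rootOp a k (f j))
    rw [hf2] at this
    simpa using this
  have hfj : ‖f j‖ ^ 2 ≤ ν₀ := by
    have := hp.coercive (f j)
    rw [hp.form_self (hfm j), hA] at this
    linarith
  have hlj : |l j| ≤ z * ν₀ := by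
    have h1 := abs_re_inner_apply_le (pertOp a k κ) (f j) (f j)
    rw [hf3] at h1
    simp only [if_true, Complex.ofReal_re] at h1
    nlinarith
  have hCz : |C| * z ^ 2 ≤ ν₀ / 4 := by
    have hC := abs_nonneg C
    have h1 : z * |C| ≤ ν₀ / 4 := by nlinarith [mul_le_mul_of_nonneg_right hZ hC]
    nlinarith [mul_le_mul_of_nonneg_right (hZ.trans hκ2) (mul_nonneg hz0 hC)]
  have hCz' : -(|C| * z ^ 2) ≤ C * z ^ 2 := by nlinarith [neg_abs_le C, sq_nonneg z]
  have hCz'' : C * z ^ 2 ≤ |C| * z ^ 2 := by nlinarith [le_abs_self C, sq_nonneg z]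
  have hpos : 0 < ν₀ + l j + C * z ^ 2 := by
    nlinarith [neg_abs_le (l j)]
  have hn : 0 < m + 3 - (j : ℕ) := by omega
  have u1 := band_le ha hV hn hpk (hj1 hpos)
  have u2 := le_band ha hV hpk hj2
  have hzz : |C| * z ^ 2 ≤ |C| * (‖κ‖ + ‖κ‖ ^ 2) ^ 2 :=
    mul_le_mul_of_nonneg_left (pow_le_pow_left₀ hz0 hZ 2) (abs_nonneg C)
  have hidx : m + 2 + 1 - (j : ℕ) = m + 3 - j := by omega
  rw [hidx, abs_le]
  constructor <;> linarith

end Bands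

/-! ### Point symmetries at K -/

section PointSymmetry

/-- The matrix `Q` is orthogonal and permutes the dual lattice, by `σ₀`, and its translate by `K`,
by `σ`. -/
structure PermutesFreq (a : ℝ) (Q : Matrix (Fin 3) (Fin 3) ℝ) (σ₀ σ : Equiv.Perm (Fin 3 → ℤ)) :
    Prop where
  recip : ∀ m, Matrix.toEuclideanLin Q (recip a m) = recip a (σ₀ m)
  freq : ∀ m, Matrix.toEuclideanLin Q (freq a (pointK a) m) = freq a (pointK a) (σ m)
  sub : ∀ m g, σ m - σ₀ g = σ (m - g)
  norm : ∀ x : E3, ‖Matrix.toEuclideanLin Q x‖ = ‖x‖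

lemma inner_toEuclideanLin_transpose (Q : Matrix (Fin 3) (Fin 3) ℝ) (x y : E3) :
    inner ℝ x (Matrix.toEuclideanLin Q.transpose y) = inner ℝ (Matrix.toEuclideanLin Q x) y := by
  rw [← Matrix.conjTranspose_eq_transpose_of_trivial, Matrix.toEuclideanLin_conjTranspose_eq_adjoint,
    LinearMap.adjoint_inner_right]

/-- The action of `R` on the dual lattice, in coordinates; with `s = 1` its action on the translate
by `K`. -/
def permR (s : ℤ) : Equiv.Perm (Fin 3 → ℤ) where
  toFun m := ![s - m 0 - m 1 - m 2, m 0, m 1]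
  invFun n := ![n 1, n 2, s - n 0 - n 1 - n 2]
  left_inv m := by ext i; fin_cases i <;> simp; ring
  right_inv n := by ext i; fin_cases i <;> simp

/-- The action of `T` on the dual lattice, in coordinates; with `s = 1` its action on the translate
by `K`. -/
def permT (s : ℤ) : Equiv.Perm (Fin 3 → ℤ) where
  toFun m := ![s - m 0 - m 1 - m 2, m 2, m 0]
  invFun n := ![n 2, s - n 0 - n 1 - n 2, n 1]
  left_inv m := by ext i; fin_cases i <;> simp; ring
  right_inv n := by ext i; fin_cases i <;> simp; ring

/-- R moves K by the reciprocal vector q₁, so it permutes K plus the dual lattice; this shift is the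
s = 1 in `permR`. -/
lemma permutesFreq_R (a : ℝ) : PermutesFreq a matR (permR 0) (permR 1) where
  recip m := by
    ext i
    fin_cases i <;>
      simp [recip, permR, matR, dualBasis, Fin.sum_univ_three, Matrix.toLpLin_apply] <;> ring
  freq m := by
    ext i
    fin_cases i <;>
      simp [freq, pointK, recip, permR, matR, dualBasis, Fin.sum_univ_three, Matrix.toLpLin_apply] <;> ring
  sub m g := by ext i; fin_cases i <;> simp [permR]; ring
  norm x := by
    rw [EuclideanSpace.norm_eq, EuclideanSpace.norm_eq]
    congr 1
    simp [matR, Fin.sum_univ_three, Matrix.toLpLin_apply, Matrix.vecHead, Matrix.vecTail]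
    ring

lemma permutesFreq_T (a : ℝ) : PermutesFreq a matT (permT 0) (permT 1) where
  recip m := by
    ext i
    fin_cases i <;>
      simp [recip, permT, matT, dualBasis, Fin.sum_univ_three, Matrix.toLpLin_apply] <;> ring
  freq m := by
    ext i
    fin_cases i <;>
      simp [freq, pointK, recip, permT, matT, dualBasis, Fin.sum_univ_three, Matrix.toLpLin_apply] <;> ring
  sub m g := by ext i; fin_cases i <;> simp [permT]; ring
  norm x := by
    rw [EuclideanSpace.norm_eq, EuclideanSpace.norm_eq]
    congr 1
    simp [matT, Fin.sum_univ_three, Matrix.toLpLin_apply, Matrix.vecHead, Matrix.vecTail]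
    ring

variable {a : ℝ} {Q : Matrix (Fin 3) (Fin 3) ℝ} {σ₀ σ : Equiv.Perm (Fin 3 → ℤ)}

lemma PermutesFreq.rotate_synth (h : PermutesFreq a Q σ₀ σ) (c : (Fin 3 → ℤ) → ℂ) :
    rotate Q (synth a (pointK a) c) = synth a (pointK a) (fun m => c (σ.symm m)) := by
  ext x
  rw [rotate, synth, synth, ← σ.tsum_eq fun m => c (σ.symm m) * char a (pointK a) m x]
  refine tsum_congr fun m => ?_
  rw [σ.symm_apply_apply, char, char, inner_toEuclideanLin_transpose, h.freq]

lemma PermutesFreq.rotate_synth_zero (h : PermutesFreq a Q σ₀ σ) (c : (Fin 3 → ℤ) → ℂ) :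
    rotate Q (synth a 0 c) = synth a 0 (fun m => c (σ₀.symm m)) := by
  ext x
  rw [rotate, synth, synth, ← σ₀.tsum_eq fun m => c (σ₀.symm m) * char a 0 m x]
  refine tsum_congr fun m => ?_
  rw [σ₀.symm_apply_apply, char, char, inner_toEuclideanLin_transpose, WeylPoint.freq,
    WeylPoint.freq, zero_add, zero_add, h.recip]

lemma PermutesFreq.norm_freq (h : PermutesFreq a Q σ₀ σ) (m : Fin 3 → ℤ) :
    ‖WeylPoint.freq a (pointK a) (σ m)‖ = ‖WeylPoint.freq a (pointK a) m‖ := by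
  rw [← h.freq, h.norm]

/-- Q preserves |K + G|, which is comparable with the weight up to constants; hence permuting
coefficients preserves decay. -/
lemma PermutesFreq.weight_le (h : PermutesFreq a Q σ₀ σ) (m : Fin 3 → ℤ) :
    weight a (σ m) ≤ (2 * (1 + ‖pointK a‖ ^ 2)) ^ 2 * weight a m := by
  calc weight a (σ m) ≤ _ := weight_le_freq a (pointK a) (σ m)
    _ ≤ 2 * (1 + ‖pointK a‖ ^ 2) * (2 * (1 + ‖pointK a‖ ^ 2) * weight a m) := by
      rw [h.norm_freq]
      exact mul_le_mul_of_nonneg_left (freq_le_weight a (pointK a) m) (by positivity)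
    _ = _ := by ring

lemma PermutesFreq.decay (h : PermutesFreq a Q σ₀ σ) {c : (Fin 3 → ℤ) → ℂ} (hc : Decay a c) :
    Decay a (fun m => c (σ.symm m)) := by
  intro n
  obtain ⟨C, hC⟩ := hc n
  refine ⟨((2 * (1 + ‖pointK a‖ ^ 2)) ^ 2) ^ n * C, fun m => ?_⟩
  have h1 := h.weight_le (σ.symm m)
  rw [σ.apply_symm_apply] at h1
  have h2 := pow_le_pow_left₀ (weight_pos a m).le h1 n
  rw [mul_pow] at h2
  calc _ ≤ ((2 * (1 + ‖pointK a‖ ^ 2)) ^ 2) ^ n * weight a (σ.symm m) ^ n * ‖c (σ.symm m)‖ :=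
        mul_le_mul_of_nonneg_right h2 (norm_nonneg _)
    _ = ((2 * (1 + ‖pointK a‖ ^ 2)) ^ 2) ^ n * (weight a (σ.symm m) ^ n * ‖c (σ.symm m)‖) := by ring
    _ ≤ _ := mul_le_mul_of_nonneg_left (hC _) (by positivity)

lemma potential_eq_synth (ha : 0 < a) {V : E3 → ℝ} (hV : IsAdmissible a V) :
    (fun x => (V x : ℂ)) = synth a 0 (potCoef a V) :=
  eq_synth_coef ha hV.contDiff_ofReal.continuous hV.pseudoPeriodic ((hV.decay ha).summable ha)

lemma PermutesFreq.potCoef_eq (ha : 0 < a) {V : E3 → ℝ} (hV : IsAdmissible a V)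
    (h : PermutesFreq a Q σ₀ σ) (hQ : rotate Q V = V) (g : Fin 3 → ℤ) :
    potCoef a V (σ₀ g) = potCoef a V g := by
  have hs := (hV.decay ha).summable_norm ha
  have h1 : (fun m => potCoef a V (σ₀.symm m)) = potCoef a V := by
    refine synth_injective ha 0 (σ₀.symm.summable_iff (f := fun m => ‖potCoef a V m‖) |>.2 hs) hs ?_
    rw [← h.rotate_synth_zero, ← potential_eq_synth ha hV]
    ext x
    exact congrArg Complex.ofReal (congrFun hQ x)
  have h2 := congrFun h1 (σ₀ g)
  simp only [σ₀.symm_apply_apply] at h2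
  exact h2.symm

/-- The point symmetries preserve the eigenspaces at `K`. -/
lemma PermutesFreq.rotate_mem (ha : 0 < a) {V : E3 → ℝ} (hV : IsAdmissible a V)
    (h : PermutesFreq a Q σ₀ σ) (hQ : rotate Q V = V) {μ : ℝ} {F : E3 → ℂ}
    (hF : F ∈ eigenspace a V (pointK a) μ) : rotate Q F ∈ eigenspace a V (pointK a) μ := by
  obtain ⟨c, hc, rfl, hceq⟩ := (mem_eigenspace_iff ha hV).1 hF
  refine (mem_eigenspace_iff ha hV).2 ⟨_, h.decay hc, h.rotate_synth c, fun m => ?_⟩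
  obtain ⟨m, rfl⟩ := σ.surjective m
  have h1 : conv (potCoef a V) (fun m => c (σ.symm m)) (σ m) = conv (potCoef a V) c m := by
    rw [conv, conv, ← σ₀.tsum_eq]
    refine tsum_congr fun g => ?_
    rw [h.potCoef_eq ha hV hQ, h.sub, σ.symm_apply_apply]
  rw [h1, σ.symm_apply_apply, h.norm_freq]
  exact hceq m

/-- The function `x ↦ conj F(-x)`. -/
def conjReflect (F : E3 → ℂ) : E3 → ℂ := fun x => conj (F (-x))

/-- Conjugation and reflection each reverse the quasi-momentum, so their composition preserves it
and just conjugates the coefficients. -/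
lemma conjReflect_synth (k : E3) (c : (Fin 3 → ℤ) → ℂ) :
    conjReflect (synth a k c) = synth a k (fun m => conj (c m)) := by
  ext x
  rw [conjReflect, synth, synth, Complex.conj_tsum]
  refine tsum_congr fun m => ?_
  rw [map_mul, conj_char, char, inner_neg_right, Complex.ofReal_neg, mul_neg, neg_neg]

lemma Decay.conj {c : (Fin 3 → ℤ) → ℂ} (hc : Decay a c) :
    Decay a (fun m => (starRingEnd ℂ) (c m)) := by
  intro n
  obtain ⟨C, hC⟩ := hc n
  exact ⟨C, fun m => by rw [RCLike.norm_conj]; exact hC m⟩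

/-- A real even potential is fixed by `conjReflect`, so its coefficients are real. -/
lemma conj_potCoef_self (ha : 0 < a) {V : E3 → ℝ} (hV : IsAdmissible a V) (g : Fin 3 → ℤ) :
    conj (potCoef a V g) = potCoef a V g := by
  have hd := hV.decay ha
  have h1 : (fun m => conj (potCoef a V m)) = potCoef a V := by
    refine synth_injective ha 0 (hd.conj.summable_norm ha) (hd.summable_norm ha) ?_
    rw [← conjReflect_synth, ← potential_eq_synth ha hV]
    ext x
    rw [conjReflect, Complex.conj_ofReal, hV.even]
  exact congrFun h1 g

lemma conjReflect_mem (ha : 0 < a) {V : E3 → ℝ} (hV : IsAdmissible a V) {k : E3} {μ : ℝ}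
    {F : E3 → ℂ} (hF : F ∈ eigenspace a V k μ) : conjReflect F ∈ eigenspace a V k μ := by
  obtain ⟨c, hc, rfl, hceq⟩ := (mem_eigenspace_iff ha hV).1 hF
  refine (mem_eigenspace_iff ha hV).2 ⟨_, hc.conj, conjReflect_synth k c, fun m => ?_⟩
  have h1 : conv (potCoef a V) (fun m => conj (c m)) m = conj (conv (potCoef a V) c m) := by
    rw [conv, conv, Complex.conj_tsum]
    refine tsum_congr fun g => ?_
    rw [map_mul, conj_potCoef_self ha hV]
  have h2 := congrArg conj (hceq m)
  rw [map_add, map_mul, map_mul, Complex.conj_ofReal, Complex.conj_ofReal] at h2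
  rw [h1]
  exact h2

end PointSymmetry

/-! ### Symmetries of inner products and momentum matrix elements -/

section InnerProducts

variable {a : ℝ} {V : E3 → ℝ} {k : E3} {μ ν : ℝ}

lemma cellInner_conj_symm (a : ℝ) (F G : E3 → ℂ) : conj (cellInner a F G) = cellInner a G F := by
  rw [cellInner, cellInner, ← integral_conj]
  congr 1
  ext x
  rw [map_mul, Complex.conj_conj, mul_comm]

lemma cellInner_self_eq_zero (ha : 0 < a) (hV : IsAdmissible a V) {F : E3 → ℂ}
    (hF : F ∈ eigenspace a V k μ) (h : cellInner a F F = 0) : F = 0 := by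
  obtain ⟨c, hc, rfl, -⟩ := (mem_eigenspace_iff ha hV).1 hF
  have h1 := cellInner_synth ha k hc hc
  rw [h] at h1
  have h2 := Complex.hasSum_re h1
  have h3 : ∀ m, ((cellVol a : ℂ) * (conj (c m) * c m)).re = cellVol a * ‖c m‖ ^ 2 := fun m => by
    rw [Complex.conj_mul', ← Complex.ofReal_pow, ← Complex.ofReal_mul, Complex.ofReal_re]
  simp only [h3, Complex.zero_re] at h2
  have hv := cellVol_pos ha
  have h4 := (hasSum_zero_iff_of_nonneg (fun m => by positivity)).1 h2
  ext x
  have h5 : c = 0 := by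
    ext m
    have := congrFun h4 m
    simpa [hv.ne'] using this
  simp [h5, synth]

/-- In Fourier space 2i∂ⱼ is multiplication by -2(k+G)ⱼ. This real symbol, which rotates with the
frequencies, yields all the symmetries of `gradInner` below. -/
lemma hasSum_gradInner (ha : 0 < a) {c d : (Fin 3 → ℤ) → ℂ} (hc : Decay a c) (hd : Decay a d)
    (j : Fin 3) : HasSum (fun m => (-2 * cellVol a * freq a k m j : ℝ) * (conj (c m) * d m))
      (gradInner a (synth a k c) (synth a k d) j) := by
  have h1 : (fun x => 2 * Complex.I * fderiv ℝ (synth a k d) x (EuclideanSpace.single j 1))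
      = synth a k (fun m => 2 * Complex.I * (Complex.I *
        (inner ℝ (freq a k m) (EuclideanSpace.single j 1) : ℝ) * d m)) := by
    ext x
    rw [fderiv_synth ha k hd, synth, synth, ← tsum_mul_left]
    exact tsum_congr fun m => by ring
  rw [gradInner, h1]
  refine (cellInner_synth ha k hc ((hd.fderiv k _).const_mul _)).congr_fun fun m => ?_
  rw [EuclideanSpace.inner_single_right]
  simp only [conj_trivial, one_mul]
  push_cast
  linear_combination (-2 * (cellVol a : ℂ) * conj (c m) * freq a k m j * d m) * Complex.I_sq

lemma gradInner_conj_symm (ha : 0 < a) (hV : IsAdmissible a V) {F G : E3 → ℂ}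
    (hF : F ∈ eigenspace a V k μ) (hG : G ∈ eigenspace a V k ν) (j : Fin 3) :
    conj (gradInner a F G j) = gradInner a G F j := by
  obtain ⟨c, hc, rfl, -⟩ := (mem_eigenspace_iff ha hV).1 hF
  obtain ⟨d, hd, rfl, -⟩ := (mem_eigenspace_iff ha hV).1 hG
  refine HasSum.unique ?_ (hasSum_gradInner ha hd hc j)
  refine (Complex.hasSum_conj'.2 (hasSum_gradInner ha hc hd j)).congr_fun fun m => ?_
  rw [map_mul, map_mul, Complex.conj_ofReal, Complex.conj_conj]
  ring

lemma cellInner_conjReflect (ha : 0 < a) (hV : IsAdmissible a V) {F G : E3 → ℂ}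
    (hF : F ∈ eigenspace a V k μ) (hG : G ∈ eigenspace a V k ν) :
    cellInner a (conjReflect F) (conjReflect G) = conj (cellInner a F G) := by
  obtain ⟨c, hc, rfl, -⟩ := (mem_eigenspace_iff ha hV).1 hF
  obtain ⟨d, hd, rfl, -⟩ := (mem_eigenspace_iff ha hV).1 hG
  rw [conjReflect_synth, conjReflect_synth]
  refine (cellInner_synth ha k hc.conj hd.conj).unique ?_
  refine (Complex.hasSum_conj'.2 (cellInner_synth ha k hc hd)).congr_fun fun m => ?_
  rw [map_mul, map_mul, Complex.conj_ofReal]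

lemma gradInner_conjReflect (ha : 0 < a) (hV : IsAdmissible a V) {F G : E3 → ℂ}
    (hF : F ∈ eigenspace a V k μ) (hG : G ∈ eigenspace a V k ν) (j : Fin 3) :
    gradInner a (conjReflect F) (conjReflect G) j = conj (gradInner a F G j) := by
  obtain ⟨c, hc, rfl, -⟩ := (mem_eigenspace_iff ha hV).1 hF
  obtain ⟨d, hd, rfl, -⟩ := (mem_eigenspace_iff ha hV).1 hG
  rw [conjReflect_synth, conjReflect_synth]
  refine (hasSum_gradInner ha hc.conj hd.conj j).unique ?_
  refine (Complex.hasSum_conj'.2 (hasSum_gradInner ha hc hd j)).congr_fun fun m => ?_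
  rw [map_mul, map_mul, Complex.conj_ofReal]

variable {Q : Matrix (Fin 3) (Fin 3) ℝ} {σ₀ σ : Equiv.Perm (Fin 3 → ℤ)}

lemma PermutesFreq.cellInner_rotate (ha : 0 < a) (hV : IsAdmissible a V)
    (h : PermutesFreq a Q σ₀ σ) {F G : E3 → ℂ}
    (hF : F ∈ eigenspace a V (pointK a) μ) (hG : G ∈ eigenspace a V (pointK a) ν) :
    cellInner a (rotate Q F) (rotate Q G) = cellInner a F G := by
  obtain ⟨c, hc, rfl, -⟩ := (mem_eigenspace_iff ha hV).1 hF
  obtain ⟨d, hd, rfl, -⟩ := (mem_eigenspace_iff ha hV).1 hG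
  rw [h.rotate_synth, h.rotate_synth]
  refine (cellInner_synth ha _ (h.decay hc) (h.decay hd)).unique ?_
  exact σ.symm.hasSum_iff.2 (cellInner_synth ha _ hc hd)

/-- Reindexing the sum over frequencies by σ replaces each frequency vector by its image under Q. -/
lemma PermutesFreq.gradInner_rotate (ha : 0 < a) (hV : IsAdmissible a V)
    (h : PermutesFreq a Q σ₀ σ) {F G : E3 → ℂ}
    (hF : F ∈ eigenspace a V (pointK a) μ) (hG : G ∈ eigenspace a V (pointK a) ν) (j : Fin 3) :
    gradInner a (rotate Q F) (rotate Q G) j = ∑ l, (Q j l : ℂ) * gradInner a F G l := by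
  obtain ⟨c, hc, rfl, -⟩ := (mem_eigenspace_iff ha hV).1 hF
  obtain ⟨d, hd, rfl, -⟩ := (mem_eigenspace_iff ha hV).1 hG
  rw [h.rotate_synth, h.rotate_synth]
  refine (hasSum_gradInner ha (h.decay hc) (h.decay hd) j).unique ?_
  rw [← σ.hasSum_iff]
  refine (hasSum_sum fun l _ => (hasSum_gradInner ha hc hd l).mul_left (Q j l : ℂ)).congr_fun
    fun m => ?_
  have h1 : WeylPoint.freq a (pointK a) (σ m) j
      = ∑ l, Q j l * WeylPoint.freq a (pointK a) m l := by
    rw [← h.freq, Matrix.toLpLin_apply]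
    rfl
  simp only [Function.comp_apply, σ.symm_apply_apply, h1, Fin.sum_univ_three]
  push_cast
  ring

end InnerProducts

/-! ### Orthonormal families in eigenspaces -/

section Sesquilinear

variable {a : ℝ} {V : E3 → ℝ} {k : E3} {μ : ℝ}

lemma cellInner_smul_right (a : ℝ) (F G : E3 → ℂ) (z : ℂ) :
    cellInner a F (z • G) = z * cellInner a F G := by
  rw [cellInner, cellInner, ← integral_const_mul]
  congr 1
  ext x
  simp only [Pi.smul_apply, smul_eq_mul]
  ring

lemma cellInner_smul_left (a : ℝ) (F G : E3 → ℂ) (z : ℂ) :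
    cellInner a (z • F) G = conj z * cellInner a F G := by
  rw [← cellInner_conj_symm, cellInner_smul_right, map_mul, cellInner_conj_symm]

lemma cellInner_sum_right (ha : 0 < a) {F : E3 → ℂ} (hF : Continuous F) {ι : Type*} [Fintype ι]
    {G : ι → E3 → ℂ} (hG : ∀ i, Continuous (G i)) (z : ι → ℂ) :
    cellInner a F (∑ i, z i • G i) = ∑ i, z i * cellInner a F (G i) := by
  have h : (fun x => conj (F x) * (∑ i, z i • G i) x)
      = fun x => ∑ i, conj (F x) * (z i • G i) x := by
    ext x
    rw [Finset.sum_apply, Finset.mul_sum]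
  rw [cellInner, h, integral_finsetSum]
  · exact Finset.sum_congr rfl fun i _ => cellInner_smul_right a F (G i) (z i)
  · exact fun i _ => integrable_cell ha
      ((Complex.continuous_conj.comp hF).mul ((hG i).const_smul (z i)))

lemma continuous_of_mem {F : E3 → ℂ} (hF : F ∈ eigenspace a V k μ) : Continuous F :=
  ContDiff.continuous hF.1

lemma mem_blochL2_of_mem (ha : 0 < a) {F : E3 → ℂ} (hF : F ∈ eigenspace a V k μ) :
    F ∈ blochL2 a k := by
  obtain ⟨C, hC⟩ := IsPseudoPeriodic.bounded ha (continuous_of_mem hF) hF.2.1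
  have : IsFiniteMeasure (volume.restrict (cell a)) :=
    ⟨by simpa using (isCompact_cell ha).measure_lt_top⟩
  exact ⟨MemLp.of_bound (continuous_of_mem hF).aestronglyMeasurable C (Eventually.of_forall hC),
    hF.2.1⟩

lemma exists_smul_normalized (ha : 0 < a) (hV : IsAdmissible a V) {F : E3 → ℂ}
    (hF : F ∈ eigenspace a V k μ) (h0 : F ≠ 0) :
    ∃ z : ℂ, cellInner a (z • F) (z • F) = 1 := by
  have h1 : cellInner a F F = ((∫ x in cell a, ‖F x‖ ^ 2 : ℝ) : ℂ) := by
    refine Eq.trans ?_ (integral_ofReal (𝕜 := ℂ))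
    rw [cellInner]
    congr 1
    ext x
    rw [Complex.conj_mul', ← Complex.ofReal_pow]
    rfl
  have h2 : 0 ≤ ∫ x in cell a, ‖F x‖ ^ 2 := integral_nonneg fun x => sq_nonneg _
  set r := ∫ x in cell a, ‖F x‖ ^ 2
  have h3 : r ≠ 0 := fun hr => h0 (cellInner_self_eq_zero ha hV hF (by rw [h1, hr]; rfl))
  have h4 : (√r) ^ 2 = r := Real.sq_sqrt h2
  have h5 : √r ≠ 0 := fun h => h3 (by rw [← h4, h]; norm_num)
  refine ⟨((√r : ℝ) : ℂ)⁻¹, ?_⟩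
  rw [cellInner_smul_right, cellInner_smul_left, h1, map_inv₀, Complex.conj_ofReal]
  have h6 : ((√r : ℝ) : ℂ) ^ 2 = (r : ℂ) := by exact_mod_cast h4
  have h7 : ((√r : ℝ) : ℂ) ≠ 0 := by exact_mod_cast h5
  rw [← h6]
  field_simp

/-- An orthonormal family in an eigenspace is linearly independent. -/
lemma linearIndependent_of_orthonormal (ha : 0 < a) {Φ : Fin 3 → E3 → ℂ}
    (hΦ : ∀ i, Φ i ∈ eigenspace a V k μ)
    (ho : ∀ i j, cellInner a (Φ i) (Φ j) = if i = j then 1 else 0) : LinearIndependent ℂ Φ := by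
  rw [Fintype.linearIndependent_iff]
  intro z hz i
  have h := cellInner_sum_right ha (continuous_of_mem (hΦ i)) (fun j => continuous_of_mem (hΦ j)) z
  have h0 : cellInner a (Φ i) 0 = 0 := by simp [cellInner]
  rw [hz, h0] at h
  simpa [ho] using h.symm

lemma span_eq_of_orthonormal (ha : 0 < a)
    (hdim : Module.finrank ℂ (eigenspace a V k μ) = 3) {Φ : Fin 3 → E3 → ℂ}
    (hΦ : ∀ i, Φ i ∈ eigenspace a V k μ)
    (ho : ∀ i j, cellInner a (Φ i) (Φ j) = if i = j then 1 else 0) :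
    Submodule.span ℂ (Set.range Φ) = eigenspace a V k μ := by
  have hfin : FiniteDimensional ℂ (eigenspace a V k μ) :=
    Module.finite_of_finrank_pos (by rw [hdim]; norm_num)
  refine Submodule.eq_of_le_of_finrank_eq (Submodule.span_le.2 ?_) ?_
  · rintro _ ⟨i, rfl⟩
    exact hΦ i
  · rw [finrank_span_eq_card (linearIndependent_of_orthonormal ha hΦ ho), hdim, Fintype.card_fin]

end Sesquilinear

/-! ### Decomposition under R and existence of symmetry bases -/

section Sectors

variable {a : ℝ} {V : E3 → ℝ} {μ : ℝ}

lemma toEuclideanLin_R_transpose (x : E3) :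
    Matrix.toEuclideanLin matR.transpose x = !₂[x 1, -x 0, -x 2] := by
  ext i
  fin_cases i <;>
    simp [matR, Matrix.toLpLin_apply, Matrix.mulVec, dotProduct, Fin.sum_univ_three]

lemma rotate_R_four (F : E3 → ℂ) : rotate matR (rotate matR (rotate matR (rotate matR F))) = F := by
  ext x
  simp only [rotate, toEuclideanLin_R_transpose]
  congr 1
  ext i
  fin_cases i <;> simp

/-- The component of a function in the sector with multiplier `s`. -/
def sectorPart (s : ℂ) (F : E3 → ℂ) : E3 → ℂ :=
  (1 / 4 : ℂ) • (F + s ^ 3 • rotate matR F + s ^ 2 • rotate matR (rotate matR F)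
    + s • rotate matR (rotate matR (rotate matR F)))

lemma rotate_sectorPart {s : ℂ} (hs : s ^ 4 = 1) (F : E3 → ℂ) :
    rotate matR (sectorPart s F) = s • sectorPart s F := by
  have h4 := rotate_R_four F
  have h : rotate matR (sectorPart s F) = (1 / 4 : ℂ) • (rotate matR F
      + s ^ 3 • rotate matR (rotate matR F) + s ^ 2 • rotate matR (rotate matR (rotate matR F))
      + s • rotate matR (rotate matR (rotate matR (rotate matR F)))) := rfl
  rw [h, h4, sectorPart]
  ext x
  simp only [Pi.smul_apply, Pi.add_apply, smul_eq_mul]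
  linear_combination (-(1 / 4) * (rotate matR F x)) * hs

/-- Discrete Fourier inversion for the cyclic group of order four generated by R. -/
lemma eq_sum_sectorPart (F : E3 → ℂ) : F = sectorPart 1 F + sectorPart Complex.I F
    + sectorPart (-1) F + sectorPart (-Complex.I) F := by
  ext x
  simp only [sectorPart, Pi.smul_apply, Pi.add_apply, smul_eq_mul]
  linear_combination (-(1 / 2) * rotate matR (rotate matR F) x) * Complex.I_sq

lemma sectorPart_mem (ha : 0 < a) (hV : IsAdmissible a V) {F : E3 → ℂ}
    (hF : F ∈ eigenspace a V (pointK a) μ) (s : ℂ) :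
    sectorPart s F ∈ eigenspace a V (pointK a) μ := by
  have hr : ∀ {G}, G ∈ eigenspace a V (pointK a) μ → rotate matR G ∈ eigenspace a V (pointK a) μ :=
    fun hG => (permutesFreq_R a).rotate_mem ha hV hV.invR hG
  exact Submodule.smul_mem _ _ (add_mem (add_mem (add_mem hF (Submodule.smul_mem _ _ (hr hF)))
    (Submodule.smul_mem _ _ (hr (hr hF)))) (Submodule.smul_mem _ _ (hr (hr (hr hF)))))

/-- Rotation preserves the inner product of eigenfunctions, so that product equals itself times conj
s · t. -/
lemma cellInner_eq_zero_of_rotate (ha : 0 < a) (hV : IsAdmissible a V) {F G : E3 → ℂ}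
    (hF : F ∈ eigenspace a V (pointK a) μ) (hG : G ∈ eigenspace a V (pointK a) μ) {s t : ℂ}
    (hs : rotate matR F = s • F) (ht : rotate matR G = t • G) (hst : conj s * t ≠ 1) :
    cellInner a F G = 0 := by
  have h := (permutesFreq_R a).cellInner_rotate ha hV hF hG
  rw [hs, ht, cellInner_smul_right, cellInner_smul_left] at h
  have h2 : (conj s * t - 1) * cellInner a F G = 0 := by linear_combination h
  exact (mul_eq_zero.1 h2).resolve_left (sub_ne_zero.2 hst)

lemma rotate_conjReflect {F : E3 → ℂ} {s : ℂ} (h : rotate matR F = s • F) :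
    rotate matR (conjReflect F) = conj s • conjReflect F := by
  ext x
  have h1 := congrFun h (-x)
  simp only [rotate, conjReflect, Pi.smul_apply, smul_eq_mul, map_neg] at h1 ⊢
  rw [h1, map_mul]

lemma conjReflect_conjReflect (F : E3 → ℂ) : conjReflect (conjReflect F) = F := by
  ext x
  simp [conjReflect]

lemma conjReflect_smul (z : ℂ) (F : E3 → ℂ) : conjReflect (z • F) = conj z • conjReflect F := by
  ext x
  simp [conjReflect]

/-- The component lies both in the eigenspace and in the sector orthogonal to it, so it is
orthogonal to itself. -/
lemma H1.sectorPart_one (ha : 0 < a) (hV : IsAdmissible a V) (hH : H1 a V μ) {F : E3 → ℂ}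
    (hF : F ∈ eigenspace a V (pointK a) μ) : sectorPart 1 F = 0 := by
  have hm := sectorPart_mem ha hV hF 1
  exact cellInner_self_eq_zero ha hV hm (hH.orthogonal _ hm _
    ⟨mem_blochL2_of_mem ha hm, rotate_sectorPart (by norm_num) F⟩)

lemma I_pow_four : Complex.I ^ 4 = 1 := by
  linear_combination (Complex.I ^ 2 - 1) * Complex.I_sq

/-- The three multipliers of a symmetry basis. -/
def multiplier : Fin 3 → ℂ := ![Complex.I, -1, -Complex.I]

lemma I_pow_eq_multiplier (l : Fin 3) : Complex.I ^ ((l : ℕ) + 1) = multiplier l := by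
  fin_cases l
  · simp [multiplier]
  · simp [multiplier]
  · change Complex.I ^ 3 = -Complex.I
    linear_combination Complex.I * Complex.I_sq

lemma conj_multiplier_mul_ne {i j : Fin 3} (h : i ≠ j) : conj (multiplier i) * multiplier j ≠ 1 := by
  fin_cases i <;> fin_cases j <;> first | exact absurd rfl h | skip
  all_goals
    simp [multiplier]
    try norm_num [Complex.ext_iff]

/-- The eigenspace is the sum of its sectors. The sector of 1 is absent, that of i is a line, and
`conjReflect` maps the latter onto that of -i. Dimension three leaves room for a vector in the
sector of -1. -/
theorem exists_symmetryBasis (ha : 0 < a) (hV : IsAdmissible a V) (hH : H1 a V μ) :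
    ∃ Φ, IsSymmetryBasis a V μ Φ := by
  set E := eigenspace a V (pointK a) μ with hE
  obtain ⟨⟨G, hG⟩, hG0, hGspan⟩ := finrank_eq_one_iff'.1 hH.simple
  have hG0' : G ≠ 0 := fun h => hG0 (Subtype.ext h)
  have hGR : rotate matR G = Complex.I • G := hG.2.2
  have hGE : G ∈ E := hG.1
  have hspan1 : ∀ F ∈ E, rotate matR F = Complex.I • F → ∃ z : ℂ, z • G = F := by
    intro F hF hR
    obtain ⟨z, hz⟩ := hGspan ⟨F, hF, mem_blochL2_of_mem ha hF, hR⟩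
    exact ⟨z, congrArg Subtype.val hz⟩
  have hspan3 : ∀ F ∈ E, rotate matR F = (-Complex.I) • F → ∃ z : ℂ, z • conjReflect G = F := by
    intro F hF hR
    obtain ⟨z, hz⟩ := hspan1 _ (conjReflect_mem ha hV hF) (by
      rw [rotate_conjReflect hR, map_neg, Complex.conj_I, neg_neg])
    exact ⟨conj z, by rw [← conjReflect_smul, hz, conjReflect_conjReflect]⟩
  -- Without a vector in the sector of -1, the eigenspace would be spanned by G and its conjugate
  -- reflection, so have dimension at most 2.
  have hex : ∃ F ∈ E, rotate matR F = (-1 : ℂ) • F ∧ F ≠ 0 := by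
    by_contra hno
    push Not at hno
    have hle : E ≤ Submodule.span ℂ (Set.range ![G, conjReflect G]) := by
      intro F hF
      have h1 := hH.sectorPart_one ha hV hF
      have h2 : sectorPart (-1) F = 0 := hno _ (sectorPart_mem ha hV hF _)
        (rotate_sectorPart (by norm_num) F)
      obtain ⟨z, hz⟩ := hspan1 _ (sectorPart_mem ha hV hF _) (rotate_sectorPart I_pow_four F)
      obtain ⟨w, hw⟩ := hspan3 _ (sectorPart_mem ha hV hF _)
        (rotate_sectorPart (by rw [Even.neg_pow (by decide), I_pow_four]) F)
      rw [eq_sum_sectorPart F, h1, h2, ← hz, ← hw, zero_add, add_zero]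
      exact add_mem (Submodule.smul_mem _ _ (Submodule.subset_span ⟨0, rfl⟩))
        (Submodule.smul_mem _ _ (Submodule.subset_span ⟨1, rfl⟩))
    have : FiniteDimensional ℂ (Submodule.span ℂ (Set.range ![G, conjReflect G])) :=
      FiniteDimensional.span_of_finite ℂ (Set.finite_range _)
    have h3 := Submodule.finrank_mono hle
    have h4 : Module.finrank ℂ (Submodule.span ℂ (Set.range ![G, conjReflect G])) ≤ 2 :=
      (finrank_range_le_card (R := ℂ) ![G, conjReflect G]).trans (by simp)
    rw [hE, hH.threefold] at h3
    omega
  obtain ⟨F, hFE, hFR, hF0⟩ := hex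
  obtain ⟨z, hz⟩ := exists_smul_normalized ha hV hGE hG0'
  obtain ⟨w, hw⟩ := exists_smul_normalized ha hV hFE hF0
  let Φ : Fin 3 → E3 → ℂ := ![z • G, w • F, conjReflect (z • G)]
  have hm : ∀ i, Φ i ∈ E := by
    intro i
    fin_cases i
    · exact Submodule.smul_mem _ _ hGE
    · exact Submodule.smul_mem _ _ hFE
    · exact conjReflect_mem ha hV (Submodule.smul_mem _ _ hGE)
  have h0 : rotate matR (z • G) = Complex.I • z • G := by
    rw [smul_comm, ← hGR]; rfl
  have hR : ∀ i, rotate matR (Φ i) = multiplier i • Φ i := by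
    intro i
    fin_cases i
    · exact h0
    · change rotate matR (w • F) = (-1 : ℂ) • w • F
      rw [smul_comm, ← hFR]; rfl
    · have := rotate_conjReflect h0
      rw [Complex.conj_I] at this
      exact this
  have ho : ∀ i j, cellInner a (Φ i) (Φ j) = if i = j then 1 else 0 := by
    intro i j
    split_ifs with hij
    · subst hij
      fin_cases i
      · exact hz
      · exact hw
      · change cellInner a (conjReflect (z • G)) (conjReflect (z • G)) = 1
        exact (cellInner_conjReflect ha hV (hm 0) (hm 0)).trans
          ((congrArg conj hz).trans (map_one _))
    · exact cellInner_eq_zero_of_rotate ha hV (hm i) (hm j) (hR i) (hR j)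
        (conj_multiplier_mul_ne hij)
  exact ⟨Φ, span_eq_of_orthonormal ha hH.threefold hm ho, ho, fun l =>
    ⟨mem_blochL2_of_mem ha (hm l), by rw [I_pow_eq_multiplier]; exact hR l⟩, fun x => rfl⟩

end Sectors

/-! ### Unitary invariants of matrices -/

section UnitaryInvariance

variable {H : Type*} [NormedAddCommGroup H] [InnerProductSpace ℂ H]

/-- Two orthonormal bases of the same space give unitarily equivalent matrices. -/
lemma exists_unitary_of_span_eq {A Z : H →L[ℂ] H} (hA : A.IsSymmetric) {e e' : Fin 3 → H}
    (he : ∀ i j, inner ℂ (A (e i)) (A (e j)) = if i = j then 1 else 0)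
    (he' : ∀ i j, inner ℂ (A (e' i)) (A (e' j)) = if i = j then 1 else 0)
    (hspan : Submodule.span ℂ (Set.range e') = Submodule.span ℂ (Set.range e)) :
    ∃ U : Matrix (Fin 3) (Fin 3) ℂ, U.conjTranspose * U = 1 ∧
      (Matrix.of fun i j => inner ℂ (e' i) (Z (e' j)))
        = U.conjTranspose * (Matrix.of fun i j => inner ℂ (e i) (Z (e j))) * U := by
  have hex : ∀ j, ∃ z : Fin 3 → ℂ, ∑ k, z k • e k = e' j := fun j => by
    have : e' j ∈ Submodule.span ℂ (Set.range e) := by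
      rw [← hspan]; exact Submodule.subset_span ⟨j, rfl⟩
    exact (Submodule.mem_span_range_iff_exists_fun ℂ).1 this
  choose z hz using hex
  let U : Matrix (Fin 3) (Fin 3) ℂ := Matrix.of fun k j => z j k
  have hU : ∀ j, e' j = ∑ k, U k j • e k := fun j => (hz j).symm
  refine ⟨U, ?_, ?_⟩
  · ext i j
    have h1 := inner_sum_apply_sum (A * A) e U i j
    have h2 : (Matrix.of fun k m => inner ℂ (e k) ((A * A) (e m)) : Matrix (Fin 3) (Fin 3) ℂ)
        = 1 := by
      ext k m
      rw [Matrix.of_apply, Matrix.one_apply, ← he k m, mul_apply_eq_comp, hA.apply_clm]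
    rw [h2, Matrix.mul_one, ← hU, ← hU, mul_apply_eq_comp, ← hA.apply_clm, he'] at h1
    rw [← h1, Matrix.one_apply]
  · ext i j
    rw [Matrix.of_apply, hU, hU]
    exact inner_sum_apply_sum Z e U i j

lemma trace_sq_unitary {U M : Matrix (Fin 3) (Fin 3) ℂ} (hU : U.conjTranspose * U = 1) :
    (U.conjTranspose * M * U * (U.conjTranspose * M * U)).trace = (M * M).trace := by
  have hU2 : U * U.conjTranspose = 1 := mul_eq_one_comm.1 hU
  have h1 : U.conjTranspose * M * U * (U.conjTranspose * M * U)
      = U.conjTranspose * (M * M) * U := by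
    calc _ = U.conjTranspose * M * (U * U.conjTranspose) * M * U := by
          simp only [Matrix.mul_assoc]
      _ = _ := by rw [hU2, Matrix.mul_one]; simp only [Matrix.mul_assoc]
  rw [h1, Matrix.trace_mul_comm, ← Matrix.mul_assoc, hU2, Matrix.one_mul]

lemma det_unitary {U M : Matrix (Fin 3) (Fin 3) ℂ} (hU : U.conjTranspose * U = 1) :
    (U.conjTranspose * M * U).det = M.det := by
  rw [Matrix.det_mul, Matrix.det_mul, mul_right_comm, ← Matrix.det_mul, hU, Matrix.det_one,
    one_mul]

end UnitaryInvariance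

/-! ### The first-order matrix -/

section FirstOrder

variable {a : ℝ} {V : E3 → ℝ} {μ : ℝ}

/-- The matrix of the first order perturbation. -/
def firstOrder (a : ℝ) (Φ : Fin 3 → E3 → ℂ) (κ : E3) : Matrix (Fin 3) (Fin 3) ℂ :=
  Matrix.of fun i j => -∑ l, (κ l : ℂ) * gradInner a (Φ i) (Φ j) l

/-- An orthonormal basis of an eigenspace, in terms of the pencil. -/
lemma exists_pencil_basis (ha : 0 < a) (hV : IsAdmissible a V) {k : E3} {Φ : Fin 3 → E3 → ℂ}
    (hspan : Submodule.span ℂ (Set.range Φ) = eigenspace a V k μ)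
    (ho : ∀ i j, cellInner a (Φ i) (Φ j) = if i = j then 1 else 0) :
    ∃ e : Fin 3 → Seq2,
      Submodule.span ℂ (Set.range e)
        = genEig (rootOp a k) (blochOp a V k) (μ + energyShift a V) ∧
      (∀ i j, inner ℂ (rootOp a k (e i)) (rootOp a k (e j)) = if i = j then 1 else 0) ∧
      ∀ κ i j, inner ℂ (e i) ((pertOp a k κ - ((‖κ‖ ^ 2 : ℝ) : ℂ) • (rootOp a k * rootOp a k)) (e j))
        = firstOrder a Φ κ i j := by
  have hm : ∀ i, Φ i ∈ eigenspace a V k μ := fun i => by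
    rw [← hspan]; exact Submodule.subset_span ⟨i, rfl⟩
  choose c hc hΦ hceq using fun i => (mem_eigenspace_iff ha hV).1 (hm i)
  have hv := cellVol_pos ha
  -- The factor √|Ω| compensates the cell volume in Parseval's identity, so that orthonormality on
  -- the cell becomes orthonormality of the sequences A e i.
  set s : ℂ := ((√(cellVol a) : ℝ) : ℂ) with hs
  have hs2 : s * s = cellVol a := by
    rw [hs, ← Complex.ofReal_mul, Real.mul_self_sqrt hv.le]
  have hs0 : s ≠ 0 := by
    intro h
    rw [h, zero_mul] at hs2
    exact cellVol_ne_zero ha hs2.symm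
  have hsc : conj s = s := Complex.conj_ofReal _
  choose e he using fun i => exists_rootOp_eq ha k ((hc i).const_mul s)
  have he' : ∀ i, (rootOp a k (e i) : (Fin 3 → ℤ) → ℂ) = fun m => s * c i m := fun i =>
    funext (he i)
  refine ⟨e, le_antisymm (Submodule.span_le.2 ?_) fun u hu => ?_, fun i j => ?_, fun κ i j => ?_⟩
  · rintro _ ⟨i, rfl⟩
    have h := (mem_genEig_bloch ha hV k 0 μ (e i)).2 fun m => by
      rw [he', add_zero]
      have h1 : conv (potCoef a V) (fun m => s * c i m) m = s * conv (potCoef a V) (c i) m := by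
        rw [conv, conv, ← tsum_mul_left]
        exact tsum_congr fun g => by ring
      rw [h1]
      linear_combination s * hceq i m
    rwa [pertOp_zero, add_zero] at h
  · have hu' : u ∈ genEig (rootOp a k) (blochOp a V k + pertOp a k 0) (μ + energyShift a V) := by
      rwa [pertOp_zero, add_zero]
    have hd := decay_of_mem_genEig ha hV hu'
    have hmem : synth a k (rootOp a k u) ∈ eigenspace a V k μ :=
      (mem_eigenspace_iff ha hV).2 ⟨_, hd, rfl, by
        simpa using (mem_genEig_bloch ha hV k 0 μ u).1 hu'⟩
    rw [← hspan] at hmem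
    obtain ⟨z, hz⟩ := (Submodule.mem_span_range_iff_exists_fun ℂ).1 hmem
    simp only [hΦ] at hz
    rw [← synth_sum ha k hc z] at hz
    have h1 := synth_injective ha k ((Decay.sum hc z).summable_norm ha) (hd.summable_norm ha) hz
    have h2 : u = ∑ i, (z i * s⁻¹) • e i := by
      refine rootOp_injective a k ?_
      ext m
      rw [map_sum, lp.coeFn_sum, Finset.sum_apply, ← congrFun h1 m]
      refine Finset.sum_congr rfl fun i _ => ?_
      have h3 : rootOp a k ((z i * s⁻¹) • e i) m = (z i * s⁻¹) * rootOp a k (e i) m := by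
        rw [map_smul]; rfl
      rw [h3, he, mul_assoc, inv_mul_cancel_left₀ hs0]
    rw [h2]
    exact Submodule.sum_mem _ fun i _ => Submodule.smul_mem _ _ (Submodule.subset_span ⟨i, rfl⟩)
  · rw [inner_eq_tsum, he', he', ← ho, hΦ i, hΦ j, ← (cellInner_synth ha k (hc i) (hc j)).tsum_eq]
    refine tsum_congr fun m => ?_
    rw [map_mul, hsc, ← hs2]
    ring
  -- Subtracting |κ|²A² leaves the symbol 2κ·(k+G), to be compared with the -2(k+G) of `gradInner`;
  -- hence the sign in `firstOrder`.
  · have h1 := hasSum_sum fun l (_ : l ∈ Finset.univ) =>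
      (hasSum_gradInner ha (hc i) (hc j) l (k := k)).mul_left (κ l : ℂ)
    rw [firstOrder, Matrix.of_apply, hΦ i, hΦ j, ← h1.neg.tsum_eq, inner_eq_tsum]
    refine tsum_congr fun m => ?_
    have h2 : ((pertOp a k κ - ((‖κ‖ ^ 2 : ℝ) : ℂ) • (rootOp a k * rootOp a k)) (e j)) m
        = ((resRoot a k m ^ 2 * (2 * inner ℝ κ (freq a k m) + ‖κ‖ ^ 2) : ℝ) : ℂ) * e j m
          - ((‖κ‖ ^ 2 : ℝ) : ℂ) * (resRoot a k m * (resRoot a k m * e j m)) := rfl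
    have h3 := he i m
    have h4 := he j m
    rw [rootOp_apply] at h3 h4
    have h5 := congrArg conj h3
    rw [map_mul, map_mul, Complex.conj_ofReal, hsc] at h5
    have h6 : inner ℝ κ (freq a k m) = ∑ l, κ l * freq a k m l := by
      rw [PiLp.inner_apply]
      exact Finset.sum_congr rfl fun l _ => by rw [RCLike.inner_apply, conj_trivial, mul_comm]
    have h7 : conj (e i m) * ((pertOp a k κ
        - ((‖κ‖ ^ 2 : ℝ) : ℂ) • (rootOp a k * rootOp a k)) (e j)) m
        = 2 * (inner ℝ κ (freq a k m) : ℝ) * (conj (c i m) * c j m) * (s * s) := by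
      rw [h2]
      push_cast
      linear_combination 2 * ((inner ℝ κ (freq a k m) : ℝ) : ℂ) * ((resRoot a k m * e j m) * h5
        + s * conj (c i m) * h4)
    rw [h7, h6, hs2, Fin.sum_univ_three, Fin.sum_univ_three]
    push_cast
    ring

/-- The trace of the square and the determinant of the first order matrix do not depend on the
orthonormal basis. -/
lemma firstOrder_invariant (ha : 0 < a) (hV : IsAdmissible a V) {k : E3} {Φ Ψ : Fin 3 → E3 → ℂ}
    (hΦ : Submodule.span ℂ (Set.range Φ) = eigenspace a V k μ)
    (hoΦ : ∀ i j, cellInner a (Φ i) (Φ j) = if i = j then 1 else 0)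
    (hΨ : Submodule.span ℂ (Set.range Ψ) = eigenspace a V k μ)
    (hoΨ : ∀ i j, cellInner a (Ψ i) (Ψ j) = if i = j then 1 else 0) (κ : E3) :
    (firstOrder a Ψ κ * firstOrder a Ψ κ).trace = (firstOrder a Φ κ * firstOrder a Φ κ).trace ∧
      (firstOrder a Ψ κ).det = (firstOrder a Φ κ).det := by
  obtain ⟨e, he1, he2, he3⟩ := exists_pencil_basis ha hV hΦ hoΦ
  obtain ⟨e', he1', he2', he3'⟩ := exists_pencil_basis ha hV hΨ hoΨ
  obtain ⟨U, hU, hM⟩ := exists_unitary_of_span_eq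
    (Z := pertOp a k κ - ((‖κ‖ ^ 2 : ℝ) : ℂ) • (rootOp a k * rootOp a k))
    (rootOp_isSymmetric a k) he2 he2' (he1'.trans he1.symm)
  simp only [he3, he3'] at hM
  have hM' : firstOrder a Ψ κ = U.conjTranspose * firstOrder a Φ κ * U := hM
  rw [hM', trace_sq_unitary hU, det_unitary hU]
  exact ⟨rfl, rfl⟩

end FirstOrder

/-! ### Velocities, Fermi velocity and chirality -/

section Velocities

variable {a : ℝ} {V : E3 → ℝ} {μ : ℝ} {Φ : Fin 3 → E3 → ℂ}

lemma gradInner_smul {k : E3} {F G : E3 → ℂ} (hG : G ∈ eigenspace a V k μ) (z w : ℂ)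
    (l : Fin 3) : gradInner a (z • F) (w • G) l = conj z * w * gradInner a F G l := by
  have h1 : (fun x => 2 * Complex.I * fderiv ℝ (w • G) x (EuclideanSpace.single l 1))
      = w • fun x => 2 * Complex.I * fderiv ℝ G x (EuclideanSpace.single l 1) := by
    ext x
    have hd : DifferentiableAt ℝ G x := (ContDiff.differentiable hG.1 two_ne_zero) x
    rw [fderiv_const_smul hd, Pi.smul_apply, smul_eq_mul, _root_.smul_apply,
      smul_eq_mul]
    ring
  rw [gradInner, gradInner, h1, cellInner_smul_left, cellInner_smul_right]
  ring

namespace IsSymmetryBasis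

lemma mem (h : IsSymmetryBasis a V μ Φ) (i : Fin 3) : Φ i ∈ eigenspace a V (pointK a) μ := by
  rw [← h.span_eq]; exact Submodule.subset_span ⟨i, rfl⟩

lemma rotate_eq (h : IsSymmetryBasis a V μ Φ) (i : Fin 3) :
    rotate matR (Φ i) = multiplier i • Φ i := by
  rw [← I_pow_eq_multiplier]
  exact (h.mem_sector i).2

/-- Computing the rotated matrix element in two ways shows that this vector, if nonzero, is an
eigenvector of R whose eigenvalue is the product of the multipliers. -/
lemma gradInner_rotate (ha : 0 < a) (hV : IsAdmissible a V) (h : IsSymmetryBasis a V μ Φ)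
    (i j l : Fin 3) : conj (multiplier i) * multiplier j * gradInner a (Φ i) (Φ j) l
      = ∑ m, (matR l m : ℂ) * gradInner a (Φ i) (Φ j) m := by
  rw [← (permutesFreq_R a).gradInner_rotate ha hV (h.mem i) (h.mem j), h.rotate_eq, h.rotate_eq,
    gradInner_smul (h.mem j)]

/-- The eigenvalue would be 1, but the eigenvalues of R are i, -i and -1. -/
lemma gradInner_self (ha : 0 < a) (hV : IsAdmissible a V) (h : IsSymmetryBasis a V μ Φ)
    (i l : Fin 3) : gradInner a (Φ i) (Φ i) l = 0 := by
  have h1 : conj (multiplier i) * multiplier i = 1 := by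
    fin_cases i <;> simp [multiplier]
  have e0 := h.gradInner_rotate ha hV i i 0
  have e1 := h.gradInner_rotate ha hV i i 1
  have e2 := h.gradInner_rotate ha hV i i 2
  rw [h1] at e0 e1 e2
  simp [matR, Fin.sum_univ_three] at e0 e1 e2
  fin_cases l
  · change gradInner a (Φ i) (Φ i) 0 = 0
    linear_combination (1 / 2 : ℂ) * e0 - (1 / 2 : ℂ) * e1
  · change gradInner a (Φ i) (Φ i) 1 = 0
    linear_combination (1 / 2 : ℂ) * e0 + (1 / 2 : ℂ) * e1
  · change gradInner a (Φ i) (Φ i) 2 = 0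
    linear_combination (1 / 2 : ℂ) * e2

/-- The eigenspace of R for i is the line through ω₁, so the first component determines the vector.
-/
lemma gradInner_eq_omega1 (ha : 0 < a) (hV : IsAdmissible a V) (h : IsSymmetryBasis a V μ Φ)
    {i j : Fin 3} (hij : conj (multiplier i) * multiplier j = Complex.I) :
    gradInner a (Φ i) (Φ j) = (((√2 : ℝ) : ℂ) * gradInner a (Φ i) (Φ j) 0) • omega1 := by
  have e0 := h.gradInner_rotate ha hV i j 0
  have e2 := h.gradInner_rotate ha hV i j 2
  rw [hij] at e0 e2
  simp [matR, Fin.sum_univ_three] at e0 e2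
  have h2 : ((√2 : ℝ) : ℂ) ≠ 0 := by
    exact_mod_cast (Real.sqrt_pos.2 (two_pos (α := ℝ))).ne'
  have h3 : (((√2 : ℝ) : ℂ) * gradInner a (Φ i) (Φ j) 0) • omega1
      = gradInner a (Φ i) (Φ j) 0 • ![1, -Complex.I, 0] := by
    rw [omega1, smul_smul, mul_comm, inv_mul_cancel_left₀ h2]
  rw [h3]
  ext l
  fin_cases l
  · simp
  · simp
    linear_combination e0
  · simp
    have : (Complex.I + 1) * gradInner a (Φ i) (Φ j) 2 = 0 := by linear_combination e2
    refine (mul_eq_zero.1 this).resolve_left fun hc => ?_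
    simpa using congrArg Complex.im hc

/-- The eigenspace of R for -1 is the third axis. -/
lemma gradInner_eq_omega2 (ha : 0 < a) (hV : IsAdmissible a V) (h : IsSymmetryBasis a V μ Φ)
    {i j : Fin 3} (hij : conj (multiplier i) * multiplier j = -1) :
    gradInner a (Φ i) (Φ j) = gradInner a (Φ i) (Φ j) 2 • omega2 := by
  have e0 := h.gradInner_rotate ha hV i j 0
  have e1 := h.gradInner_rotate ha hV i j 1
  rw [hij] at e0 e1
  simp [matR, Fin.sum_univ_three] at e0 e1
  ext l
  fin_cases l
  · simp [omega2]
    linear_combination (1 / 2 : ℂ) * e0 - (1 / 2 : ℂ) * e1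
  · simp [omega2]
    linear_combination -(1 / 2 : ℂ) * e0 - (1 / 2 : ℂ) * e1
  · simp [omega2]

lemma exists_velocity (ha : 0 < a) (hV : IsAdmissible a V) (h : IsSymmetryBasis a V μ Φ) :
    ∃ υ, IsVelocity a Φ υ :=
  ⟨![_, _, _], h.gradInner_eq_omega1 ha hV (by simp [multiplier]),
    h.gradInner_eq_omega1 ha hV (by simp [multiplier]),
    h.gradInner_eq_omega2 ha hV (by simp [multiplier])⟩

end IsSymmetryBasis

lemma omega1_apply : omega1 = ![((√2 : ℝ) : ℂ)⁻¹, -(Complex.I * ((√2 : ℝ) : ℂ)⁻¹), 0] := by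
  ext l
  fin_cases l <;> simp [omega1, mul_comm]

lemma inv_sqrt_two_mul_self : ((√2 : ℝ) : ℂ)⁻¹ * ((√2 : ℝ) : ℂ)⁻¹ = 1 / 2 := by
  rw [← mul_inv, ← Complex.ofReal_mul, Real.mul_self_sqrt two_pos.le]
  norm_num

/-- The entries of the first order matrix. -/
lemma IsSymmetryBasis.firstOrder_eq (ha : 0 < a) (hV : IsAdmissible a V)
    (h : IsSymmetryBasis a V μ Φ) {υ : Fin 3 → ℂ} (hυ : IsVelocity a Φ υ) (κ : E3) :
    firstOrder a Φ κ =
      !![0, -(υ 0 * ((√2 : ℝ) : ℂ)⁻¹ * (κ 0 - Complex.I * κ 1)), -(conj (υ 2) * κ 2);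
        -(conj (υ 0) * ((√2 : ℝ) : ℂ)⁻¹ * (κ 0 + Complex.I * κ 1)), 0,
          -(υ 1 * ((√2 : ℝ) : ℂ)⁻¹ * (κ 0 - Complex.I * κ 1));
        -(υ 2 * κ 2), -(conj (υ 1) * ((√2 : ℝ) : ℂ)⁻¹ * (κ 0 + Complex.I * κ 1)), 0] := by
  have hs : ∀ i j l, gradInner a (Φ i) (Φ j) l = conj (gradInner a (Φ j) (Φ i) l) :=
    fun i j l => (gradInner_conj_symm ha hV (h.mem j) (h.mem i) l).symm
  have h0 := h.gradInner_self ha hV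
  ext i j
  rw [firstOrder, Matrix.of_apply, Fin.sum_univ_three]
  fin_cases i <;> fin_cases j
  · simp [h0]
  · simp [hυ.eq₁, omega1_apply]; ring
  · simp [hs 0 2, hυ.eq₃, omega2]; ring
  · simp [hs 1 0, hυ.eq₁, omega1_apply]; ring
  · simp [h0]
  · simp [hυ.eq₂, omega1_apply]; ring
  · simp [hυ.eq₃, omega2]; ring
  · simp [hs 2 1, hυ.eq₂, omega1_apply]; ring
  · simp [h0]

lemma IsSymmetryBasis.trace_firstOrder (ha : 0 < a) (hV : IsAdmissible a V)
    (h : IsSymmetryBasis a V μ Φ) {υ : Fin 3 → ℂ} (hυ : IsVelocity a Φ υ) (κ : E3) :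
    (firstOrder a Φ κ).trace = 0 := by
  rw [h.firstOrder_eq ha hV hυ]
  simp [Matrix.trace, Fin.sum_univ_three]

lemma IsSymmetryBasis.trace_firstOrder_sq (ha : 0 < a) (hV : IsAdmissible a V)
    (h : IsSymmetryBasis a V μ Φ) {υ : Fin 3 → ℂ} (hυ : IsVelocity a Φ υ) (κ : E3) :
    (firstOrder a Φ κ * firstOrder a Φ κ).trace
      = (((‖υ 0‖ ^ 2 + ‖υ 1‖ ^ 2) * (κ 0 ^ 2 + κ 1 ^ 2) + 2 * ‖υ 2‖ ^ 2 * κ 2 ^ 2 : ℝ) : ℂ) := by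
  rw [h.firstOrder_eq ha hV hυ]
  push_cast
  rw [← Complex.conj_mul', ← Complex.conj_mul', ← Complex.conj_mul']
  simp only [Matrix.trace, Fin.sum_univ_three, Matrix.diag_apply, Matrix.mul_apply, Matrix.of_apply,
    Matrix.cons_val', Matrix.cons_val_zero, Matrix.cons_val_one, Matrix.cons_val]
  linear_combination (2 * (conj (υ 0) * υ 0 + conj (υ 1) * υ 1)
      * (κ 0 - Complex.I * κ 1) * (κ 0 + Complex.I * κ 1)) * inv_sqrt_two_mul_self
    - (conj (υ 0) * υ 0 + conj (υ 1) * υ 1) * (κ 1 : ℂ) ^ 2 * Complex.I_sq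

/-- The diagonal vanishes, so only the two 3-cycles contribute, and they are complex conjugates; the
scalars enter through their product alone. -/
lemma IsSymmetryBasis.det_firstOrder (ha : 0 < a) (hV : IsAdmissible a V)
    (h : IsSymmetryBasis a V μ Φ) {υ : Fin 3 → ℂ} (hυ : IsVelocity a Φ υ) (κ : E3) :
    (firstOrder a Φ κ).det = -(1 / 2) * (υ 0 * υ 1 * υ 2 * (κ 0 - Complex.I * κ 1) ^ 2
      + conj (υ 0 * υ 1 * υ 2) * (κ 0 + Complex.I * κ 1) ^ 2) * κ 2 := by
  rw [h.firstOrder_eq ha hV hυ, Matrix.det_fin_three, map_mul, map_mul]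
  simp only [Matrix.of_apply,
    Matrix.cons_val', Matrix.cons_val_zero, Matrix.cons_val_one, Matrix.cons_val]
  linear_combination -(υ 0 * υ 1 * υ 2 * (κ 0 - Complex.I * κ 1) ^ 2
      + conj (υ 0) * conj (υ 1) * conj (υ 2) * (κ 0 + Complex.I * κ 1) ^ 2) * κ 2
      * inv_sqrt_two_mul_self

/-- The first two scalars have the same modulus, by the symmetry `F ↦ conj F(-⬝)`. -/
lemma IsSymmetryBasis.norm_eq_norm (ha : 0 < a) (hV : IsAdmissible a V)
    (h : IsSymmetryBasis a V μ Φ) {υ : Fin 3 → ℂ} (hυ : IsVelocity a Φ υ) : ‖υ 0‖ = ‖υ 1‖ := by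
  have h2 : Φ 2 = conjReflect (Φ 0) := funext h.conj_symm
  have hm := conjReflect_mem ha hV (h.mem 1)
  have hR : rotate matR (conjReflect (Φ 1)) = multiplier 1 • conjReflect (Φ 1) := by
    have := rotate_conjReflect (h.rotate_eq 1)
    simpa [multiplier] using this
  -- The multiplier -1 is real, so `conjReflect` preserves its sector, which meets the eigenspace in
  -- the line through Φ 1.
  obtain ⟨z, hz⟩ : ∃ z : ℂ, conjReflect (Φ 1) = z • Φ 1 := by
    have hm' := hm
    rw [← h.span_eq] at hm'
    obtain ⟨z, hz⟩ := (Submodule.mem_span_range_iff_exists_fun ℂ).1 hm'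
    have hzi : ∀ i : Fin 3, i ≠ 1 → z i = 0 := fun i hi => by
      have h3 := cellInner_sum_right ha (continuous_of_mem (h.mem i))
        (fun j => continuous_of_mem (h.mem j)) z
      rw [hz, cellInner_eq_zero_of_rotate ha hV (h.mem i) hm (h.rotate_eq i) hR
        (conj_multiplier_mul_ne hi)] at h3
      simpa [h.orthonormal] using h3.symm
    refine ⟨z 1, ?_⟩
    rw [← hz, Fin.sum_univ_three, hzi 0 (by decide), hzi 2 (by decide)]
    simp
  have hz1 : ‖z‖ = 1 := by
    have h3 := cellInner_conjReflect ha hV (h.mem 1) (h.mem 1)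
    rw [hz, cellInner_smul_left, cellInner_smul_right, h.orthonormal, if_pos rfl, map_one, mul_one,
      Complex.conj_mul'] at h3
    have h4 : ‖z‖ ^ 2 = 1 := by exact_mod_cast h3
    exact (pow_eq_one_iff_of_nonneg (norm_nonneg z) two_ne_zero).1 h4
  -- Reflecting ⟨Φ₁, 2i∇Φ₂⟩ turns it into z ⟨Φ₃, 2i∇Φ₂⟩, a unimodular multiple of the conjugate of
  -- ⟨Φ₂, 2i∇Φ₃⟩.
  have h3 := gradInner_conjReflect ha hV (h.mem 0) (h.mem 1) 0
  have h4 := gradInner_smul (F := Φ 2) (h.mem 1) 1 z 0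
  rw [one_smul, ← hz, ← gradInner_conj_symm ha hV (h.mem 1) (h.mem 2), hυ.eq₂] at h4
  rw [← h2, h4, hυ.eq₁] at h3
  have h5 := congrArg norm h3
  have h6 : (0 : ℝ) < √2 := by positivity
  simp [omega1_apply, hz1] at h5
  exact h5.symm

/-- T does not respect the sectors of R, but it does produce another orthonormal basis of the
eigenspace. Its first-order matrix at κ is the old one at T*κ, so unitary invariants can be
compared. -/
lemma IsSymmetryBasis.rotate_T (ha : 0 < a) (hV : IsAdmissible a V)
    (h : IsSymmetryBasis a V μ Φ) (hH : H1 a V μ) :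
    (Submodule.span ℂ (Set.range fun i => rotate matT (Φ i)) = eigenspace a V (pointK a) μ) ∧
    (∀ i j, cellInner a (rotate matT (Φ i)) (rotate matT (Φ j)) = if i = j then 1 else 0) ∧
    ∀ κ : E3, firstOrder a (fun i => rotate matT (Φ i)) κ
      = firstOrder a Φ !₂[-κ 0, κ 2, -κ 1] := by
  have ho : ∀ i j, cellInner a (rotate matT (Φ i)) (rotate matT (Φ j)) = if i = j then 1 else 0 :=
    fun i j => by rw [(permutesFreq_T a).cellInner_rotate ha hV (h.mem i) (h.mem j), h.orthonormal]
  refine ⟨span_eq_of_orthonormal ha hH.threefold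
    (fun i => (permutesFreq_T a).rotate_mem ha hV hV.invT (h.mem i)) ho, ho, fun κ => ?_⟩
  ext i j
  rw [firstOrder, firstOrder, Matrix.of_apply, Matrix.of_apply]
  simp only [(permutesFreq_T a).gradInner_rotate ha hV (h.mem i) (h.mem j)]
  simp [Fin.sum_univ_three, matT]
  ring

lemma IsSymmetryBasis.velocity (ha : 0 < a) (hV : IsAdmissible a V)
    (h : IsSymmetryBasis a V μ Φ) (hH : H1 a V μ) {υ : Fin 3 → ℂ} (hυ : IsVelocity a Φ υ) :
    (∀ l, ‖υ l‖ = ‖υ 2‖) ∧ conj (υ 0 * υ 1 * υ 2) = -(υ 0 * υ 1 * υ 2) := by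
  obtain ⟨h1, h2, h3⟩ := h.rotate_T ha hV hH
  have hinv := firstOrder_invariant ha hV h.span_eq h.orthonormal h1 h2
  have hn := h.norm_eq_norm ha hV hυ
  constructor
  -- T* takes the third axis to the second. Comparing traces of squares gives |υ₁|² + |υ₂|² =
  -- 2|υ₃|².
  · have h4 := (hinv !₂[0, 0, 1]).1
    rw [h3, h.trace_firstOrder_sq ha hV hυ, h.trace_firstOrder_sq ha hV hυ, Complex.ofReal_inj] at h4
    simp at h4
    have h5 : ‖υ 1‖ = ‖υ 2‖ := by
      rw [hn] at h4
      refine (sq_eq_sq₀ (norm_nonneg _) (norm_nonneg _)).1 ?_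
      linarith
    intro l
    fin_cases l
    · exact hn.trans h5
    · exact h5
    · rfl
  -- T* takes this vector to one with third coordinate zero, where the determinant vanishes. At the
  -- vector itself it is minus the real part of υ₁υ₂υ₃.
  · have h4 := (hinv !₂[1, 0, 1]).2
    rw [h3, h.det_firstOrder ha hV hυ, h.det_firstOrder ha hV hυ] at h4
    generalize υ 0 * υ 1 * υ 2 = P at h4 ⊢
    simp at h4
    linear_combination h4

/-- The Fermi velocity and the chirality. -/
theorem exists_fermiVelocity (ha : 0 < a) (hV : IsAdmissible a V) (hH : H1 a V μ) :
    ∃ υF : ℝ, 0 ≤ υF ∧ IsFermiVelocity a V μ υF ∧ ∃ σ, IsChirality a V μ υF σ := by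
  obtain ⟨Φ, hΦ⟩ := exists_symmetryBasis ha hV hH
  obtain ⟨υ, hυ⟩ := hΦ.exists_velocity ha hV
  obtain ⟨hn, hP⟩ := hΦ.velocity ha hV hH hυ
  have hunique : ∀ Ψ w, IsSymmetryBasis a V μ Ψ → IsVelocity a Ψ w →
      ‖w 2‖ = ‖υ 2‖ ∧ w 0 * w 1 * w 2 = υ 0 * υ 1 * υ 2 := by
    intro Ψ w hΨ hw
    have hinv := firstOrder_invariant ha hV hΦ.span_eq hΦ.orthonormal hΨ.span_eq hΨ.orthonormal
    constructor
    · have h4 := (hinv !₂[0, 0, 1]).1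
      rw [hΦ.trace_firstOrder_sq ha hV hυ, hΨ.trace_firstOrder_sq ha hV hw,
        Complex.ofReal_inj] at h4
      simp at h4
      exact h4
    -- For an imaginary product P the determinant here is 2iP, so it recovers P.
    · have h4 := (hinv !₂[1, 1, 1]).2
      rw [hΦ.det_firstOrder ha hV hυ, hΨ.det_firstOrder ha hV hw, hP,
        (hΨ.velocity ha hV hH hw).2] at h4
      generalize υ 0 * υ 1 * υ 2 = P at h4 ⊢
      generalize w 0 * w 1 * w 2 = P' at h4 ⊢
      simp at h4
      linear_combination (1 / 4 * Complex.I) * h4 + (P' - P) * Complex.I_sq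
  refine ⟨‖υ 2‖, norm_nonneg _, ⟨⟨Φ, hΦ⟩, fun Ψ hΨ => ?_⟩, ?_⟩
  · obtain ⟨w, hw⟩ := hΨ.exists_velocity ha hV
    refine ⟨w, hw, fun l => ?_⟩
    rw [(hΨ.velocity ha hV hH hw).1 l, (hunique Ψ w hΨ hw).1]
  · set P := υ 0 * υ 1 * υ 2 with hPdef
    have hre : P.re = 0 := by
      have := congrArg Complex.re hP
      rw [Complex.conj_re, Complex.neg_re] at this
      linarith
    have hPi : P = Complex.I * (P.im : ℂ) := by
      apply Complex.ext <;> simp [hre]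
    have hnorm : |P.im| = ‖υ 2‖ ^ 3 := by
      have h1 : ‖P‖ = ‖υ 2‖ ^ 3 := by
        rw [hPdef, norm_mul, norm_mul, hn 0, hn 1]; ring
      rw [← h1]
      conv_rhs => rw [hPi]
      rw [norm_mul, Complex.norm_I, one_mul, Complex.norm_real, Real.norm_eq_abs]
    -- The product is i times a real number of modulus υF³, and σ is the sign of that number; if υF
    -- = 0 either sign would do.
    rcases abs_choice P.im with hc | hc
    · refine ⟨1, Or.inl rfl, fun Ψ w hΨ hw => ?_⟩
      rw [(hunique Ψ w hΨ hw).2, hPi, ← hc, hnorm]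
      push_cast
      ring
    · refine ⟨-1, Or.inr rfl, fun Ψ w hΨ hw => ?_⟩
      rw [(hunique Ψ w hΨ hw).2, hPi, ← neg_neg P.im, ← hc, hnorm]
      push_cast
      ring

end Velocities

/-! ### The cubic dispersion relation -/

section Dispersion

variable {a : ℝ} {V : E3 → ℝ} {μ : ℝ}

/-- The roots of the cubic `X³ - X + c` from its power sums. -/
lemma roots_cubic {x : Fin 3 → ℝ} {c : ℝ} (h1 : x 0 + x 1 + x 2 = 0)
    (h2 : x 0 ^ 2 + x 1 ^ 2 + x 2 ^ 2 = 2) (h3 : x 0 * x 1 * x 2 = -c) :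
    (Polynomial.X ^ 3 - Polynomial.X + Polynomial.C c : Polynomial ℝ).roots
      = {x 0, x 1, x 2} := by
  have h4 : x 0 * x 1 + x 0 * x 2 + x 1 * x 2 = -1 := by
    linear_combination (1 / 2) * (x 0 + x 1 + x 2) * h1 - (1 / 2) * h2
  have h : (Polynomial.X ^ 3 - Polynomial.X + Polynomial.C c : Polynomial ℝ)
      = (Multiset.map (fun r => Polynomial.X - Polynomial.C r) {x 0, x 1, x 2}).prod := by
    have e1 := congrArg (Polynomial.C (R := ℝ)) h1
    have e3 := congrArg (Polynomial.C (R := ℝ)) h3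
    have e4 := congrArg (Polynomial.C (R := ℝ)) h4
    simp only [map_add, map_mul, map_neg, map_one, map_zero] at e1 e3 e4
    simp only [Multiset.insert_eq_cons, Multiset.map_cons, Multiset.map_singleton,
      Multiset.prod_cons, Multiset.prod_singleton]
    linear_combination Polynomial.X ^ 2 * e1 - Polynomial.X * e4 + e3
  rw [h, Polynomial.roots_multiset_prod_X_sub_C]

/-- Diagonalization of the first order perturbation. -/
lemma exists_diagonal_pertOp (ha : 0 < a) (hV : IsAdmissible a V) {υF σ : ℝ}
    (hυF : IsFermiVelocity a V μ υF) (hσ : IsChirality a V μ υF σ) :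
    ∃ e : Fin 3 → Seq2, Submodule.span ℂ (Set.range e)
        = genEig (rootOp a (pointK a)) (blochOp a V (pointK a)) (μ + energyShift a V) ∧
      ∀ κ : E3, ∃ (f : Fin 3 → Seq2) (l : Fin 3 → ℝ), Antitone l ∧
        Submodule.span ℂ (Set.range f) = Submodule.span ℂ (Set.range e) ∧
        (∀ i j, inner ℂ (rootOp a (pointK a) (f i)) (rootOp a (pointK a) (f j))
          = if i = j then 1 else 0) ∧
        (∀ i j, inner ℂ (f i) (pertOp a (pointK a) κ (f j))
          = if i = j then ((l i + ‖κ‖ ^ 2 : ℝ) : ℂ) else 0) ∧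
        l 0 + l 1 + l 2 = 0 ∧ l 0 ^ 2 + l 1 ^ 2 + l 2 ^ 2 = 2 * υF ^ 2 * ‖κ‖ ^ 2 ∧
        l 0 * l 1 * l 2 = -(2 * σ * υF ^ 3 * (κ 0 * κ 1 * κ 2)) := by
  obtain ⟨⟨Φ, hΦ⟩, hall⟩ := hυF
  obtain ⟨υ, hυ, hn⟩ := hall Φ hΦ
  have hP := hσ.2 Φ υ hΦ hυ
  obtain ⟨e, he1, he2, he3⟩ := exists_pencil_basis ha hV hΦ.span_eq hΦ.orthonormal
  refine ⟨e, he1, fun κ => ?_⟩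
  set K := pointK a
  set Z := pertOp a K κ - ((‖κ‖ ^ 2 : ℝ) : ℂ) • (rootOp a K * rootOp a K) with hZ
  have hA := rootOp_isSymmetric a K
  have hZs : Z.IsSymmetric := by
    intro u v
    change inner ℂ (pertOp a K κ u - ((‖κ‖ ^ 2 : ℝ) : ℂ) • rootOp a K (rootOp a K u)) v
      = inner ℂ u (pertOp a K κ v - ((‖κ‖ ^ 2 : ℝ) : ℂ) • rootOp a K (rootOp a K v))
    rw [inner_sub_left, inner_sub_right, inner_smul_left, inner_smul_right, Complex.conj_ofReal,
      (pertOp_isSymmetric a K κ).apply_clm, hA.apply_clm, hA.apply_clm]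
  obtain ⟨f, l, hl, hf1, hf2, hf3, t1, t2, t3⟩ := exists_diagonalizing_basis hA hZs he2
    (M := firstOrder a Φ κ) fun i j => (he3 κ i j).symm
  have hnorm : ‖κ‖ ^ 2 = κ 0 ^ 2 + κ 1 ^ 2 + κ 2 ^ 2 := by
    rw [EuclideanSpace.norm_sq_eq, Fin.sum_univ_three]
    simp only [Real.norm_eq_abs, sq_abs]
  refine ⟨f, l, hl, hf1, hf2, fun i j => ?_, ?_, ?_, ?_⟩
  -- The subtracted term |κ|²A² is |κ|² times the identity in this basis; adding it back shifts
  -- every eigenvalue by |κ|², which is o(|κ|).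
  · have h1 : pertOp a K κ (f j)
        = Z (f j) + ((‖κ‖ ^ 2 : ℝ) : ℂ) • rootOp a K (rootOp a K (f j)) := by
      rw [hZ]
      exact (sub_add_cancel _ _).symm
    rw [h1, inner_add_right, inner_smul_right, ← hA.apply_clm, hf2, hf3]
    split_ifs
    · push_cast; ring
    · simp
  · rw [hΦ.trace_firstOrder ha hV hυ] at t1
    exact_mod_cast t1
  · rw [hΦ.trace_firstOrder_sq ha hV hυ, hn, hn, hn] at t2
    have t2' : l 0 ^ 2 + l 1 ^ 2 + l 2 ^ 2
        = (υF ^ 2 + υF ^ 2) * (κ 0 ^ 2 + κ 1 ^ 2) + 2 * υF ^ 2 * κ 2 ^ 2 := by exact_mod_cast t2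
    rw [t2', hnorm]
    ring
  · rw [hΦ.det_firstOrder ha hV hυ, hP] at t3
    simp only [map_mul, map_pow, Complex.conj_I, Complex.conj_ofReal] at t3
    have t3' : (l 0 : ℂ) * l 1 * l 2 = -(2 * σ * υF ^ 3 * (κ 0 * κ 1 * κ 2)) := by
      rw [t3]
      linear_combination (2 * (σ : ℂ) * υF ^ 3 * κ 0 * κ 1 * κ 2) * Complex.I_sq
    exact_mod_cast t3'

open Asymptotics in
lemma isLittleO_of_le_sq {f : E3 → ℝ} {B r : ℝ} (hr : 0 < r)
    (h : ∀ κ : E3, κ ≠ 0 → ‖κ‖ ≤ r → |f κ| ≤ B * ‖κ‖ ^ 2) :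
    f =o[𝓝[≠] 0] fun κ : E3 => ‖κ‖ := by
  have h1 : f =O[𝓝[≠] 0] fun κ : E3 => ‖κ‖ ^ 2 := by
    refine IsBigO.of_bound B ?_
    have h2 : ∀ᶠ κ : E3 in 𝓝[≠] 0, ‖κ‖ ≤ r := by
      refine nhdsWithin_le_nhds ?_
      filter_upwards [Metric.closedBall_mem_nhds (0 : E3) hr] with κ hκ
      simpa using hκ
    filter_upwards [h2, self_mem_nhdsWithin] with κ hκ hκ0
    rw [Real.norm_eq_abs, Real.norm_of_nonneg (sq_nonneg _)]
    exact h κ hκ0 hκ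
  refine h1.trans_isLittleO ?_
  have h3 : (fun κ : E3 => ‖κ‖ ^ 2) =o[𝓝 0] fun κ : E3 => ‖κ‖ := by
    have := (isLittleO_norm_pow_id (E' := E3) one_lt_two)
    exact this.trans_isBigO (isBigO_refl _ _).norm_right
  exact h3.mono nhdsWithin_le_nhds

end Dispersion

end WeylPoint

end

/-! ### The main theorem -/

open WeylPoint Asymptotics
theorem mainTheorem1 (a : ℝ) (ha : 0 < a) (V : E3 → ℝ) (hV : IsAdmissible a V)
    (b : ℕ) (hb : 1 < b) (μs : ℝ)
    (hμ₁ : band a V (b - 1) (pointK a) = μs)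
    (hμ₂ : band a V b (pointK a) = μs)
    (hμ₃ : band a V (b + 1) (pointK a) = μs)
    (hH1 : H1 a V μs) :
    ∃ υF : ℝ, IsFermiVelocity a V μs υF ∧
      (υF ≠ 0 →
        ∃ σ : ℝ, IsChirality a V μs υF σ ∧
        ∃ ξp ξ0 ξm : E3 → ℝ,
          (∀ κ : E3, κ ≠ 0 →
            ξm κ ≤ ξ0 κ ∧ ξ0 κ ≤ ξp κ ∧
            (Polynomial.X ^ 3 - Polynomial.X
              + Polynomial.C (2 * σ * kappaArg κ) : Polynomial ℝ).roots
                = {ξp κ, ξ0 κ, ξm κ}) ∧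
          (fun κ : E3 => band a V (b + 1) (pointK a + κ) - (μs + ξp κ * υF * ‖κ‖))
            =o[𝓝[≠] 0] (fun κ : E3 => ‖κ‖) ∧
          (fun κ : E3 => band a V b (pointK a + κ) - (μs + ξ0 κ * υF * ‖κ‖))
            =o[𝓝[≠] 0] (fun κ : E3 => ‖κ‖) ∧
          (fun κ : E3 => band a V (b - 1) (pointK a + κ) - (μs + ξm κ * υF * ‖κ‖))
            =o[𝓝[≠] 0] (fun κ : E3 => ‖κ‖)) := by
  obtain ⟨υF, hυF0, hυF, σ, hσ⟩ := exists_fermiVelocity ha hV hH1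
  refine ⟨υF, hυF, fun hne => ⟨σ, hσ, ?_⟩⟩
  obtain ⟨e, he, hdiag⟩ := exists_diagonal_pertOp ha hV hυF hσ
  choose f l hl hf1 hf2 hf3 s1 s2 s3 using hdiag
  obtain ⟨C, z₀, hz₀, hband⟩ := band_expansion ha hV hb hμ₁ hμ₃ he
  have key : ∀ j : Fin 3,
      (fun κ : E3 => band a V (b + 1 - j) (pointK a + κ) - (μs + l κ j / (υF * ‖κ‖) * υF * ‖κ‖))
        =o[𝓝[≠] 0] (fun κ : E3 => ‖κ‖) := by
    intro j
    -- For |κ| ≤ 1 one has |κ| + |κ|² ≤ 2|κ|. This explains z₀/2 in the radius and 4|C| in the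
    -- constant; the extra 1 accounts for the shift of every eigenvalue by |κ|².
    refine isLittleO_of_le_sq (B := 1 + 4 * |C|) (r := min 1 (z₀ / 2)) (by positivity)
      fun κ hκ0 hκ => ?_
    rw [le_min_iff] at hκ
    have hn := norm_nonneg κ
    have hn' : ‖κ‖ ≠ 0 := norm_ne_zero_iff.2 hκ0
    have h1 := hband κ (by nlinarith) (f κ) (fun i => l κ i + ‖κ‖ ^ 2) (hf1 κ) (hf2 κ) (hf3 κ)
      (fun i i' hi => by simpa using hl κ hi) j
    have h2 : l κ j / (υF * ‖κ‖) * υF * ‖κ‖ = l κ j := by field_simp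
    have h3 : C * (‖κ‖ + ‖κ‖ ^ 2) ^ 2 ≤ 4 * |C| * ‖κ‖ ^ 2 := by
      have h4 : (‖κ‖ + ‖κ‖ ^ 2) ^ 2 ≤ (2 * ‖κ‖) ^ 2 :=
        pow_le_pow_left₀ (by positivity) (by nlinarith) 2
      calc C * (‖κ‖ + ‖κ‖ ^ 2) ^ 2 ≤ |C| * (‖κ‖ + ‖κ‖ ^ 2) ^ 2 :=
            mul_le_mul_of_nonneg_right (le_abs_self C) (sq_nonneg _)
        _ ≤ |C| * (2 * ‖κ‖) ^ 2 := mul_le_mul_of_nonneg_left h4 (abs_nonneg C)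
        _ = _ := by ring
    rw [h2]
    rw [abs_le] at h1 ⊢
    constructor <;> nlinarith [h1.1, h1.2, sq_nonneg ‖κ‖]
  -- The roots are the ordered eigenvalues of the first-order matrix divided by υF|κ|; this is where
  -- υF ≠ 0 is needed.
  refine ⟨fun κ => l κ 0 / (υF * ‖κ‖), fun κ => l κ 1 / (υF * ‖κ‖), fun κ => l κ 2 / (υF * ‖κ‖),
    fun κ hκ => ?_, key 0, key 1, key 2⟩
  have hn : ‖κ‖ ≠ 0 := norm_ne_zero_iff.2 hκ
  have hpos : 0 ≤ υF * ‖κ‖ := mul_nonneg hυF0 (norm_nonneg κ)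
  refine ⟨div_le_div_of_nonneg_right (hl κ (by decide)) hpos,
    div_le_div_of_nonneg_right (hl κ (by decide)) hpos, ?_⟩
  refine roots_cubic (x := fun j => l κ j / (υF * ‖κ‖)) ?_ ?_ ?_
  · rw [← add_div, ← add_div, s1, zero_div]
  · rw [div_pow, div_pow, div_pow, ← add_div, ← add_div, s2]
    field_simp
  · rw [div_mul_div_comm, div_mul_div_comm, s3, kappaArg]
    field_simp
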